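/- Let $\gamma_a\ge\gamma_b>0$ and consider the Cauchy problem $$\partial_t u+\partial_x\bigl(u(1-u)e^{-\bar u+\tilde u}\bigr)=0\quad(t>0,\ x\in\mathbb R),\qquad u(0,x)=u_0(x),$$ $$\bar u(t,x)=\frac1{\gamma_a}\int_x^{x+\gamma_a}u(t,y)\,dy,\qquad \tilde u(t,x)=\frac1{\gamma_b}\int_{x-\gamma_b}^{x}u(t,y)\,dy .$$ An $H^2$ solution on $[0,T)$ is a function $u\in C([0,T);H^2(\mathbb R))$ with $u(0,\cdot)=u_0$ which satisfies the equation at every point of $(0,T)\times\mathbb R$ (elements of $H^2(\mathbb R)$ being identified with their $C^1$ representatives). **Theorem 1.1.** Let $u_0\in H^2(\mathbb R)$ with $0\le u_0(x)\le 1$ for all $x\in\mathbb R$, and suppose that $$\sup_{x\in\mathbb R}u_0'(x)>\frac{\gamma_a+\gamma_b}{\gamma_a\gamma_b}\left(\frac12+\frac{\sqrt2}{4}\sqrt{3-\min\Bigl\{-1,\ \frac{\gamma_a\gamma_b}{\gamma_a+\gamma_b}\inf_{x\in\mathbb R}u_0'(x)\Bigr\}}\right).$$ Then $u_x$ blows up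 in finite time: there are a finite $T>0$ and an $H^2$ solution $u$ on $[0,T)$ that is maximal (every $H^2$ solution with initial data $u_0$ on an interval $[0,T')$ satisfies $T'\le T$ and coincides with $u$ on $[0,T')$), and $$\sup_{x\in\mathbb R}u_x(t,x)\to+\infty\qquad\text{as } t\uparrow T .$$ -/

import Mathlib

open MeasureTheory Filter Topology

noncomputable section

namespace Traffic

/-- `g` is the weak derivative of `f` on the real line. -/
def IsWeakDeriv (f g : ℝ → ℝ) : Prop :=
  ∀ φ : ℝ → ℝ, ContDiff ℝ (⊤ : ℕ∞) φ → HasCompactSupport φ →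
    ∫ x, f x * deriv φ x = -∫ x, g x * φ x

/-- `f` belongs to the Sobolev space `H²(ℝ)` and `f₂` is its second weak derivative.
Elements of `H²(ℝ)` are identified with their continuous representatives, which are of
class `C¹` by the Sobolev embedding theorem; so `f'` is the pointwise derivative `deriv f`. -/
structure IsH2With (f f₂ : ℝ → ℝ) : Prop where
  contDiff : ContDiff ℝ 1 f
  memLp : MemLp f 2
  memLp_deriv : MemLp (deriv f) 2
  memLp_second : MemLp f₂ 2
  isWeakDeriv : IsWeakDeriv (deriv f) f₂

/-- `f ∈ H²(ℝ)`. -/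
def MemH2 (f : ℝ → ℝ) : Prop := ∃ f₂, IsH2With f f₂

/-- `u ∈ C([0,T); H²(ℝ))`: each `u t` is in `H²(ℝ)`, with second weak derivative `w t`, and
`‖u t - u s‖_{L²} + ‖(u t)' - (u s)'‖_{L²} + ‖(u t)'' - (u s)''‖_{L²} → 0` as `t → s`
in `[0,T)`. -/
def ContinuousIntoH2 (T : ℝ) (u : ℝ → ℝ → ℝ) : Prop :=
  ∃ w : ℝ → ℝ → ℝ,
    (∀ t ∈ Set.Ico 0 T, IsH2With (u t) (w t)) ∧
    ∀ s ∈ Set.Ico 0 T,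
      Tendsto (fun t => eLpNorm (u t - u s) 2 volume) (𝓝[Set.Ico 0 T] s) (𝓝 0) ∧
      Tendsto (fun t => eLpNorm (deriv (u t) - deriv (u s)) 2 volume)
        (𝓝[Set.Ico 0 T] s) (𝓝 0) ∧
      Tendsto (fun t => eLpNorm (w t - w s) 2 volume) (𝓝[Set.Ico 0 T] s) (𝓝 0)

/-- The look-ahead average `ū(x) = γa⁻¹ ∫_x^{x+γa} u(y) dy`. -/
def lookAhead (γa : ℝ) (f : ℝ → ℝ) (x : ℝ) : ℝ := 1 / γa * ∫ y in x..(x + γa), f y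

/-- The look-behind average `ũ(x) = γb⁻¹ ∫_{x-γb}^x u(y) dy`. -/
def lookBehind (γb : ℝ) (f : ℝ → ℝ) (x : ℝ) : ℝ := 1 / γb * ∫ y in (x - γb)..x, f y

/-- The flux `u (1 - u) e^{-ū + ũ}`. -/
def flux (γa γb : ℝ) (f : ℝ → ℝ) (x : ℝ) : ℝ :=
  f x * (1 - f x) * Real.exp (-lookAhead γa f x + lookBehind γb f x)

/-- `u` (written `u t x`) is an `H²` solution on `[0,T)` of the Cauchy problem
`u_t + (u (1 - u) e^{-ū + ũ})_x = 0`, `u(0,·) = u₀`: it belongs to `C([0,T); H²(ℝ))`, and the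
equation holds at every point of `(0,T) × ℝ`. -/
structure IsH2Solution (γa γb : ℝ) (u₀ : ℝ → ℝ) (T : ℝ) (u : ℝ → ℝ → ℝ) : Prop where
  continuousIntoH2 : ContinuousIntoH2 T u
  initial : u 0 = u₀
  equation : ∀ t ∈ Set.Ioo 0 T, ∀ x : ℝ,
    HasDerivAt (fun s => u s x) (-deriv (flux γa γb (u t)) x) t

/-- `u` on `[0,T)` is the maximal `H²` solution: every `H²` solution with the same initial data
on some `[0,T')` is a restriction of it. -/
structure IsMaximalH2Solution (γa γb : ℝ) (u₀ : ℝ → ℝ) (T : ℝ) (u : ℝ → ℝ → ℝ) : Prop where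
  isH2Solution : IsH2Solution γa γb u₀ T u
  maximal : ∀ (T' : ℝ) (v : ℝ → ℝ → ℝ), IsH2Solution γa γb u₀ T' v →
    T' ≤ T ∧ ∀ t ∈ Set.Ico 0 T', v t = u t

end Traffic

end

noncomputable section
namespace Traffic

/-! Write `K = 1 / γa + 1 / γb`, `E` for `expo` and `θ` for `gap`, the derivative of the exponent
`-ū + ũ`. In nonconservative form the equation is `u_t + vel * u_x + rate * u = 0`, and along a
characteristic the slope `d = u_x` satisfies the Riccati-type law `d' = E * (2 d² - 2 (1 - 2u) θ d -
u (1 - u) (θ² + θ_x))`, whose right-hand side is `charRHS`.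

Since `0 ≤ u ≤ 1` persists, `K (u - 1) ≤ θ ≤ K u`. If moreover `ℓ ≤ u_x` everywhere, then `θ_x ≤ K
(d - ℓ)`, so for `d ≥ 0` the bracket is at least a quadratic in `d` whose coefficients depend only
on `K` and `ℓ` (`quadratic_le`). A lower bound `ℓ ≤ -K` is itself preserved, because `d' ≥ 0` at a
spatial minimum of the slope lying below `-K` (`quadratic_nonneg_of_min`, `IsH2Solution.le_deriv`).
The threshold of the theorem is the larger root `R` of the quadratic. As `E ≥ 1/3`, the excess `Y`
of `sup u_x` over `R` obeys `Y' ≥ (2/3) Y²` in the sense of Dini derivatives, so no solution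
outlives an explicit time (`lt_of_riccati`).

The rest is well-posedness. `exists_local_solution` gives an existence time that depends only on a
bound for `|u_x|`; with uniqueness this yields a maximal solution and shows that `u_x` cannot remain
bounded up to the maximal time. The lower bound on `u_x` puts the unboundedness on the side of `+∞`,
and monotonicity of `Y` turns an unbounded supremum into a limit.

Local existence is a contraction argument in the uniform norm. The coefficients are frozen, the
linear transport equation is solved by characteristics, and the `H²` bound is carried as a closed
constraint. That constraint is phrased through `EnergyLE`, the `H¹` seminorm as a supremum of finite
sums of increments, which passes through products, time integrals, monotone changes of variable and
pointwise limits without any weak derivative. Weak derivatives return only at the end, together with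
strong continuity in time. -/

/-- The Cauchy–Schwarz inequality on an interval. -/
theorem sq_intervalIntegral_le {g : ℝ → ℝ} {s t : ℝ} (hst : s ≤ t)
    (hg : IntervalIntegrable g volume s t)
    (hg2 : IntervalIntegrable (fun r => g r ^ 2) volume s t) :
    (∫ r in s..t, g r) ^ 2 ≤ (t - s) * ∫ r in s..t, g r ^ 2 := by
  rcases hst.eq_or_lt with rfl | hlt
  · simp
  have hpos := sub_pos.2 hlt
  set m := (∫ r in s..t, g r) / (t - s) with hm
  have h0 : 0 ≤ ∫ r in s..t, (g r - m) ^ 2 :=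
    intervalIntegral.integral_nonneg hst fun _ _ => sq_nonneg _
  have h1 : ∫ r in s..t, (g r - m) ^ 2
      = (∫ r in s..t, g r ^ 2) - 2 * m * (∫ r in s..t, g r) + (t - s) * m ^ 2 := by
    have : ∀ r, (g r - m) ^ 2 = g r ^ 2 - 2 * m * g r + m ^ 2 := fun r => by ring
    simp_rw [this]
    rw [intervalIntegral.integral_add (hg2.sub (hg.const_mul _)) intervalIntegrable_const,
      intervalIntegral.integral_sub hg2 (hg.const_mul _),
      intervalIntegral.integral_const_mul, intervalIntegral.integral_const, smul_eq_mul]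
  have hI : ∫ r in s..t, g r = (t - s) * m := by rw [hm]; field_simp
  rw [h1, hI] at h0
  rw [hI]
  nlinarith

/-! ### The `H¹` seminorm through increments, and its calculus. -/

/-- `f` has `H¹`-seminorm at most `B`, expressed through the increments of `f` over finite
families of disjoint intervals. -/
def EnergyLE (f : ℝ → ℝ) (B : ℝ) : Prop :=
  0 ≤ B ∧ ∀ (s : Finset ℕ) (a b : ℕ → ℝ), (∀ i ∈ s, a i < b i) →
    (s : Set ℕ).PairwiseDisjoint (fun i => Set.Ioc (a i) (b i)) →
    ∑ i ∈ s, (f (b i) - f (a i)) ^ 2 / (b i - a i) ≤ B ^ 2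

namespace EnergyLE

variable {f f₁ f₂ : ℝ → ℝ} {B B₁ B₂ : ℝ}

theorem mono (h : EnergyLE f B₁) (hB : B₁ ≤ B₂) : EnergyLE f B₂ :=
  ⟨h.1.trans hB, fun s a b hab hd => (h.2 s a b hab hd).trans (by have := h.1; gcongr)⟩

/-- Minkowski's inequality for the seminorm. -/
theorem of_le_add {a b : ℝ} (h₁ : EnergyLE f₁ B₁) (h₂ : EnergyLE f₂ B₂) (ha : 0 ≤ a)
    (hb : 0 ≤ b)
    (h : ∀ x y, |f y - f x| ≤ a * |f₁ y - f₁ x| + b * |f₂ y - f₂ x|) :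
    EnergyLE f (a * B₁ + b * B₂) := by
  have hB₁ := h₁.1
  have hB₂ := h₂.1
  refine ⟨by positivity, fun s p q hpq hd => ?_⟩
  have e₁ := h₁.2 s p q hpq hd
  have e₂ := h₂.2 s p q hpq hd
  set S₁ := ∑ i ∈ s, (f₁ (q i) - f₁ (p i)) ^ 2 / (q i - p i) with hS₁
  set S₂ := ∑ i ∈ s, (f₂ (q i) - f₂ (p i)) ^ 2 / (q i - p i) with hS₂
  set C := ∑ i ∈ s, |f₁ (q i) - f₁ (p i)| * |f₂ (q i) - f₂ (p i)| / (q i - p i) with hC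
  have hCS : C ^ 2 ≤ S₁ * S₂ := by
    apply Finset.sum_sq_le_sum_mul_sum_of_sq_le_mul
    · intro i hi; have := sub_pos.2 (hpq i hi); positivity
    · intro i hi; have := sub_pos.2 (hpq i hi); positivity
    · intro i hi
      have := sub_pos.2 (hpq i hi)
      refine le_of_eq ?_
      rw [div_pow, mul_pow, sq_abs, sq_abs]
      field_simp
  have hS₁0 : 0 ≤ S₁ := Finset.sum_nonneg fun i hi => by
    have := sub_pos.2 (hpq i hi); positivity
  have hS₂0 : 0 ≤ S₂ := Finset.sum_nonneg fun i hi => by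
    have := sub_pos.2 (hpq i hi); positivity
  have hCB : C ≤ B₁ * B₂ := by
    apply le_of_sq_le_sq _ (by positivity)
    calc C ^ 2 ≤ S₁ * S₂ := hCS
      _ ≤ B₁ ^ 2 * B₂ ^ 2 := by gcongr
      _ = (B₁ * B₂) ^ 2 := by ring
  calc ∑ i ∈ s, (f (q i) - f (p i)) ^ 2 / (q i - p i)
      ≤ ∑ i ∈ s, (a ^ 2 * ((f₁ (q i) - f₁ (p i)) ^ 2 / (q i - p i))
          + 2 * a * b * (|f₁ (q i) - f₁ (p i)| * |f₂ (q i) - f₂ (p i)| / (q i - p i))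
          + b ^ 2 * ((f₂ (q i) - f₂ (p i)) ^ 2 / (q i - p i))) := by
        apply Finset.sum_le_sum
        intro i hi
        have hpos := sub_pos.2 (hpq i hi)
        have : (f (q i) - f (p i)) ^ 2
            ≤ (a * |f₁ (q i) - f₁ (p i)| + b * |f₂ (q i) - f₂ (p i)|) ^ 2 := by
          rw [← sq_abs]; gcongr; exact h _ _
        calc _ ≤ (a * |f₁ (q i) - f₁ (p i)| + b * |f₂ (q i) - f₂ (p i)|) ^ 2 / (q i - p i) := by
              gcongr
          _ = _ := by
              rw [← sq_abs (f₁ (q i) - f₁ (p i)), ← sq_abs (f₂ (q i) - f₂ (p i))]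
              ring
    _ = a ^ 2 * S₁ + 2 * a * b * C + b ^ 2 * S₂ := by
        rw [Finset.sum_add_distrib, Finset.sum_add_distrib, ← Finset.mul_sum, ← Finset.mul_sum,
          ← Finset.mul_sum]
    _ ≤ a ^ 2 * B₁ ^ 2 + 2 * a * b * (B₁ * B₂) + b ^ 2 * B₂ ^ 2 := by gcongr
    _ = _ := by ring

theorem of_le {a : ℝ} (h₁ : EnergyLE f₁ B₁) (ha : 0 ≤ a)
    (h : ∀ x y, |f y - f x| ≤ a * |f₁ y - f₁ x|) : EnergyLE f (a * B₁) := by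
  have := of_le_add (f := f) h₁ h₁ ha le_rfl (by simpa using h)
  simpa using this

theorem add (h₁ : EnergyLE f₁ B₁) (h₂ : EnergyLE f₂ B₂) :
    EnergyLE (fun x => f₁ x + f₂ x) (B₁ + B₂) := by
  have := of_le_add (f := fun x => f₁ x + f₂ x) h₁ h₂ zero_le_one zero_le_one (fun x y => by
    rw [one_mul, one_mul]
    calc _ = |(f₁ y - f₁ x) + (f₂ y - f₂ x)| := by congr 1; ring
      _ ≤ _ := abs_add_le _ _)
  simpa using this

theorem const_mul (h₁ : EnergyLE f₁ B₁) (c : ℝ) : EnergyLE (fun x => c * f₁ x) (|c| * B₁) :=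
  of_le h₁ (abs_nonneg c) fun x y => by rw [← mul_sub, abs_mul]

theorem neg (h₁ : EnergyLE f₁ B₁) : EnergyLE (fun x => -f₁ x) B₁ := by
  simpa using h₁.const_mul (-1)

theorem sub (h₁ : EnergyLE f₁ B₁) (h₂ : EnergyLE f₂ B₂) :
    EnergyLE (fun x => f₁ x - f₂ x) (B₁ + B₂) := by
  simpa [sub_eq_add_neg] using h₁.add h₂.neg

theorem mul {a b : ℝ} (h₁ : EnergyLE f₁ B₁) (h₂ : EnergyLE f₂ B₂) (ha : ∀ x, |f₁ x| ≤ a)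
    (hb : ∀ x, |f₂ x| ≤ b) : EnergyLE (fun x => f₁ x * f₂ x) (a * B₂ + b * B₁) := by
  have ha0 := (abs_nonneg _).trans (ha 0)
  have hb0 := (abs_nonneg _).trans (hb 0)
  refine of_le_add h₂ h₁ ha0 hb0 fun x y => ?_
  calc _ = |f₁ y * (f₂ y - f₂ x) + f₂ x * (f₁ y - f₁ x)| := by congr 1; ring
    _ ≤ |f₁ y| * |f₂ y - f₂ x| + |f₂ x| * |f₁ y - f₁ x| := by
      rw [← abs_mul, ← abs_mul]; exact abs_add_le _ _
    _ ≤ _ := by gcongr; exacts [ha y, hb x]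

theorem exp {a : ℝ} (h₁ : EnergyLE f₁ B₁) (ha : ∀ x, f₁ x ≤ a) :
    EnergyLE (fun x => Real.exp (f₁ x)) (Real.exp a * B₁) := by
  have key : ∀ p q : ℝ, p ≤ q → q ≤ a →
      |Real.exp q - Real.exp p| ≤ Real.exp a * |q - p| := by
    intro p q hpq hqa
    rw [abs_of_nonneg (sub_nonneg.2 (Real.exp_le_exp.2 hpq)), abs_of_nonneg (sub_nonneg.2 hpq)]
    have h1 := Real.add_one_le_exp (p - q)
    have h2 : Real.exp p = Real.exp q * Real.exp (p - q) := by rw [← Real.exp_add]; ring_nf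
    have h3 : Real.exp q - Real.exp p ≤ Real.exp q * (q - p) := by
      rw [h2]; nlinarith [Real.exp_pos q]
    exact h3.trans (mul_le_mul_of_nonneg_right (Real.exp_le_exp.2 hqa) (by linarith))
  refine of_le h₁ (Real.exp_pos a).le fun x y => ?_
  rcases le_total (f₁ x) (f₁ y) with h | h
  · exact key _ _ h (ha y)
  · rw [abs_sub_comm, abs_sub_comm (f₁ y)]
    exact key _ _ h (ha x)

/-- A strictly increasing map sends disjoint intervals to disjoint intervals, and each denominator
grows by a factor at most `c ^ 2`. The seminorm is thus multiplied by the square root of the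
Lipschitz constant, which is why the latter is written as a square. -/
theorem comp {X : ℝ → ℝ} {c : ℝ} (h₁ : EnergyLE f₁ B₁) (hX : StrictMono X) (hc : 0 ≤ c)
    (hXc : ∀ x y, x < y → X y - X x ≤ c ^ 2 * (y - x)) : EnergyLE (fun x => f₁ (X x)) (c * B₁) := by
  refine ⟨mul_nonneg hc h₁.1, fun s a b hab hd => ?_⟩
  have := h₁.2 s (fun i => X (a i)) (fun i => X (b i)) (fun i hi => hX (hab i hi)) (by
    intro i hi j hj hij
    have h := hd hi hj hij
    simp only [Function.onFun, Set.Ioc_disjoint_Ioc] at h ⊢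
    rw [← hX.monotone.map_min, ← hX.monotone.map_max]
    exact hX.monotone h)
  calc _ ≤ ∑ i ∈ s, c ^ 2 * ((f₁ (X (b i)) - f₁ (X (a i))) ^ 2 / (X (b i) - X (a i))) := by
        apply Finset.sum_le_sum
        intro i hi
        have h1 := sub_pos.2 (hab i hi)
        have h2 := sub_pos.2 (hX (hab i hi))
        rw [← mul_div_assoc, div_le_div_iff₀ h1 h2]
        nlinarith [hXc _ _ (hab i hi), sq_nonneg (f₁ (X (b i)) - f₁ (X (a i)))]
    _ = c ^ 2 * _ := by rw [← Finset.mul_sum]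
    _ ≤ c ^ 2 * B₁ ^ 2 := by gcongr
    _ = _ := by ring

theorem comp_add_const (h₁ : EnergyLE f₁ B₁) (c : ℝ) : EnergyLE (fun x => f₁ (x + c)) B₁ := by
  simpa using h₁.comp (X := fun x => x + c) (c := 1) (fun x y h => by simpa using h) zero_le_one
    (fun x y _ => by simp)

/-- Lower semicontinuity: each finite sum of increments is continuous for pointwise convergence.
This makes the constraint set of the fixed point argument closed. -/
theorem of_tendsto {ι : Type*} {l : Filter ι} [l.NeBot] {F : ι → ℝ → ℝ}
    (hF : ∀ᶠ n in l, EnergyLE (F n) B) (hlim : ∀ x, Tendsto (fun n => F n x) l (𝓝 (f x))) :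
    EnergyLE f B := by
  obtain ⟨n, hn⟩ := hF.exists
  refine ⟨hn.1, fun s a b hab hd => ?_⟩
  refine le_of_tendsto (f := fun n => ∑ i ∈ s, (F n (b i) - F n (a i)) ^ 2 / (b i - a i)) ?_
    (hF.mono fun n hn => hn.2 s a b hab hd)
  exact tendsto_finsetSum _ fun i _ => (((hlim _).sub (hlim _)).pow 2).div_const _

theorem const (c : ℝ) : EnergyLE (fun _ => c) 0 := ⟨le_rfl, by simp⟩

/-- The one-interval case of the energy bound is Hölder continuity of exponent 1/2. -/
theorem abs_sub_le (h : EnergyLE f B) (x y : ℝ) : |f y - f x| ≤ B * √|y - x| := by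
  have key : ∀ x y, x < y → |f y - f x| ≤ B * √|y - x| := by
    intro x y hxy
    have hpos := sub_pos.2 hxy
    have := h.2 {0} (fun _ => x) (fun _ => y) (by simpa using hxy) (by simp)
    simp only [Finset.sum_singleton] at this
    rw [div_le_iff₀ hpos] at this
    have hB := h.1
    apply abs_le_of_sq_le_sq' _ (by positivity) |> abs_le.2
    rw [mul_pow, Real.sq_sqrt (abs_nonneg _), abs_of_pos hpos]
    exact this
  rcases lt_trichotomy x y with hxy | rfl | hxy
  · exact key x y hxy
  · simp
  · rw [abs_sub_comm, abs_sub_comm y]; exact key y x hxy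

theorem continuous (h : EnergyLE f B) : Continuous f := by
  rw [continuous_iff_continuousAt]
  intro x
  rw [ContinuousAt, tendsto_iff_norm_sub_tendsto_zero]
  refine squeeze_zero (fun _ => norm_nonneg _) (fun y => h.abs_sub_le x y) ?_
  have : Continuous fun y : ℝ => B * √|y - x| := by fun_prop
  simpa using this.tendsto x

/-- Cauchy–Schwarz in the time variable for every increment, followed by exchanging the finite sum
with the time integral. -/
theorem intervalIntegral {F : ℝ → ℝ → ℝ} {s t : ℝ}
    (hF : ∀ r ∈ Set.uIcc s t, EnergyLE (F r) B) (hc : ∀ x, Continuous fun r => F r x) :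
    EnergyLE (fun x => ∫ r in s..t, F r x) (|t - s| * B) := by
  wlog hst : s ≤ t generalizing s t
  · have := this (s := t) (t := s) (by rwa [Set.uIcc_comm]) (le_of_not_ge hst)
    simp_rw [intervalIntegral.integral_symm t s]
    rw [abs_sub_comm]
    exact this.neg
  have hB := (hF s Set.left_mem_uIcc).1
  refine ⟨by positivity, fun A a b hab hd => ?_⟩
  rw [abs_of_nonneg (sub_nonneg.2 hst)]
  have hint : ∀ {h : ℝ → ℝ}, Continuous h → IntervalIntegrable h volume s t :=
    fun hh => hh.intervalIntegrable _ _
  calc ∑ i ∈ A, ((∫ r in s..t, F r (b i)) - ∫ r in s..t, F r (a i)) ^ 2 / (b i - a i)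
      ≤ ∑ i ∈ A, (t - s) * ∫ r in s..t, (F r (b i) - F r (a i)) ^ 2 / (b i - a i) := by
        apply Finset.sum_le_sum
        intro i hi
        have hpos := sub_pos.2 (hab i hi)
        rw [← intervalIntegral.integral_sub (hint (hc _)) (hint (hc _)),
          intervalIntegral.integral_div, ← mul_div_assoc]
        gcongr
        have hcont := (hc (b i)).sub (hc (a i))
        exact sq_intervalIntegral_le hst (hint hcont) (hint (hcont.pow 2))
    _ = (t - s) * ∫ r in s..t, ∑ i ∈ A, (F r (b i) - F r (a i)) ^ 2 / (b i - a i) := by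
        rw [← Finset.mul_sum, intervalIntegral.integral_finsetSum]
        intro i _
        have h1 := hc (b i)
        have h2 := hc (a i)
        exact hint (by fun_prop)
    _ ≤ (t - s) * ∫ r in s..t, B ^ 2 := by
        have := sub_nonneg.2 hst
        gcongr
        apply intervalIntegral.integral_mono_on hst
        · apply hint
          apply continuous_finsetSum
          intro i _
          have h1 := hc (b i)
          have h2 := hc (a i)
          fun_prop
        · exact hint continuous_const
        · intro r hr
          exact (hF r (by rwa [Set.uIcc_of_le hst])).2 A a b hab hd
    _ = ((t - s) * B) ^ 2 := by rw [intervalIntegral.integral_const, smul_eq_mul]; ring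

end EnergyLE


/-! ### Finite energy, weak derivatives and Sobolev inequalities on the line. -/

/-- By Cauchy–Schwarz, the squared sum of the `|Δf|` is at most the energy times the total length of
the intervals, whence `δ = (ε / (B + 1)) ^ 2`. -/
theorem EnergyLE.absolutelyContinuousOnInterval {f : ℝ → ℝ} {B : ℝ} (h : EnergyLE f B)
    (a b : ℝ) : AbsolutelyContinuousOnInterval f a b := by
  rw [absolutelyContinuousOnInterval_iff]
  intro ε hε
  have hB := h.1
  refine ⟨(ε / (B + 1)) ^ 2, by positivity, ?_⟩
  rintro ⟨n, I⟩ ⟨-, hd⟩ hlen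
  simp only at hd hlen ⊢
  set s := (Finset.range n).filter fun i => (I i).1 ≠ (I i).2 with hs
  have hsum : ∀ F : ℕ → ℝ, (∀ i, (I i).1 = (I i).2 → F i = 0) →
      ∑ i ∈ Finset.range n, F i = ∑ i ∈ s, F i := by
    intro F hF
    rw [hs, Finset.sum_filter]
    refine Finset.sum_congr rfl fun i _ => ?_
    by_cases hi : (I i).1 = (I i).2
    · simp [hi, hF i hi]
    · simp [hi]
  rw [hsum _ (fun i hi => by rw [hi, dist_self])] at hlen ⊢
  set p : ℕ → ℝ := fun i => min (I i).1 (I i).2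
  set q : ℕ → ℝ := fun i => max (I i).1 (I i).2
  have hpq : ∀ i ∈ s, p i < q i := by
    intro i hi
    rw [hs, Finset.mem_filter] at hi
    exact min_lt_max.2 hi.2
  have hdist : ∀ i, dist (I i).1 (I i).2 = q i - p i := fun i => by
    rw [dist_comm, Real.dist_eq]; exact (max_sub_min_eq_abs' _ _ |>.trans (abs_sub_comm _ _)).symm
  have hdf : ∀ i, dist (f (I i).1) (f (I i).2) = |f (q i) - f (p i)| := by
    intro i
    simp only [p, q]
    rcases le_total (I i).1 (I i).2 with hle | hle
    · rw [min_eq_left hle, max_eq_right hle, dist_comm, Real.dist_eq]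
    · rw [min_eq_right hle, max_eq_left hle, Real.dist_eq]
  have key := h.2 s p q hpq (hd.subset (by
    intro i hi
    have hi' : i ∈ s := hi
    rw [hs, Finset.mem_filter] at hi'
    exact hi'.1))
  simp_rw [hdist] at hlen
  simp_rw [hdf]
  have hCS : (∑ i ∈ s, |f (q i) - f (p i)|) ^ 2
      ≤ (∑ i ∈ s, (f (q i) - f (p i)) ^ 2 / (q i - p i)) * ∑ i ∈ s, (q i - p i) := by
    apply Finset.sum_sq_le_sum_mul_sum_of_sq_le_mul
    · intro i hi; have := sub_pos.2 (hpq i hi); positivity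
    · intro i hi; exact (sub_pos.2 (hpq i hi)).le
    · intro i hi
      have := sub_pos.2 (hpq i hi)
      rw [sq_abs]
      field_simp
      exact le_rfl
  have hlen0 : 0 ≤ ∑ i ∈ s, (q i - p i) :=
    Finset.sum_nonneg fun i hi => (sub_pos.2 (hpq i hi)).le
  refine lt_of_pow_lt_pow_left₀ 2 hε.le ?_
  calc _ ≤ _ := hCS
    _ ≤ B ^ 2 * ∑ i ∈ s, (q i - p i) := by gcongr
    _ ≤ B ^ 2 * (ε / (B + 1)) ^ 2 := by gcongr
    _ = (B / (B + 1)) ^ 2 * ε ^ 2 := by field_simp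
    _ < 1 * ε ^ 2 := by
      gcongr
      rw [sq_lt_one_iff_abs_lt_one, abs_of_nonneg (by positivity), div_lt_one (by positivity)]
      linarith
    _ = ε ^ 2 := one_mul _

theorem ae_of_forall_uIcc {p : ℝ → Prop} (h : ∀ n : ℕ, ∀ᵐ x, x ∈ Set.uIcc (-(n : ℝ)) n → p x) :
    ∀ᵐ x, p x := by
  filter_upwards [ae_all_iff.2 h] with x hx
  obtain ⟨n, hn⟩ := exists_nat_ge |x|
  apply hx n
  rw [Set.uIcc_of_le (by linarith [abs_nonneg x])]
  exact abs_le.1 hn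

theorem EnergyLE.ae_differentiableAt {f : ℝ → ℝ} {B : ℝ} (h : EnergyLE f B) :
    ∀ᵐ x, DifferentiableAt ℝ f x :=
  ae_of_forall_uIcc fun _ => (h.absolutelyContinuousOnInterval _ _).ae_differentiableAt

/-- Cut the range into `N` windows of length `δ` and translate them all onto the first. For each `x`
there, the increments of step `δ` from the points `x + k * δ` form one disjoint family, whose total
is controlled by the energy; integrating over a window of length `δ` cancels the remaining `1 / δ`.
-/
theorem EnergyLE.sum_slope_le {f : ℝ → ℝ} {B : ℝ} (h : EnergyLE f B) {δ : ℝ} (hδ : 0 < δ)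
    (c : ℝ) (N : ℕ) :
    ∫ x in c..(c + N * δ), ((f (x + δ) - f x) / δ) ^ 2 ≤ B ^ 2 := by
  have hf := h.continuous
  have hcont : Continuous fun x => ((f (x + δ) - f x) / δ) ^ 2 := by fun_prop
  have e1 := intervalIntegral.sum_integral_adjacent_intervals
    (f := fun x => ((f (x + δ) - f x) / δ) ^ 2) (a := fun k : ℕ => c + k * δ) (n := N)
    (μ := volume) fun k _ => hcont.intervalIntegrable _ _
  simp only [Nat.cast_zero, zero_mul, add_zero] at e1
  rw [← e1]
  have e2 : ∀ k : ℕ, ∫ x in (c + k * δ)..(c + (k + 1 : ℕ) * δ), ((f (x + δ) - f x) / δ) ^ 2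
      = ∫ x in c..(c + δ), ((f (x + k * δ + δ) - f (x + k * δ)) / δ) ^ 2 := by
    intro k
    rw [intervalIntegral.integral_comp_add_right
      (f := fun x => ((f (x + δ) - f x) / δ) ^ 2) (d := k * δ)]
    push_cast
    congr 1
    ring
  simp_rw [e2]
  rw [← intervalIntegral.integral_finsetSum
    (fun k _ => Continuous.intervalIntegrable (by fun_prop) _ _)]
  calc _ ≤ ∫ x in c..(c + δ), B ^ 2 / δ := by
        apply intervalIntegral.integral_mono_on (by linarith)
        · apply Continuous.intervalIntegrable
          exact continuous_finsetSum _ fun k _ => by fun_prop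
        · exact intervalIntegrable_const
        · intro x _
          have := h.2 (Finset.range N) (fun k => x + k * δ) (fun k => x + k * δ + δ)
            (fun k _ => by simpa using hδ) (by
              intro i _ j _ hij
              simp only [Function.onFun, Set.Ioc_disjoint_Ioc]
              rcases lt_or_gt_of_ne hij with hlt | hlt
              · have : (i : ℝ) + 1 ≤ j := by exact_mod_cast hlt
                exact (min_le_left _ _).trans (le_max_of_le_right (by nlinarith))
              · have : (j : ℝ) + 1 ≤ i := by exact_mod_cast hlt
                exact (min_le_right _ _).trans (le_max_of_le_left (by nlinarith)))
          rw [le_div_iff₀ hδ, Finset.sum_mul]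
          refine le_trans (le_of_eq (Finset.sum_congr rfl fun k _ => ?_)) this
          rw [add_sub_cancel_left]
          field_simp
    _ = B ^ 2 := by
        rw [intervalIntegral.integral_const, smul_eq_mul]
        field_simp
        ring

/-- Fatou's lemma for the squared difference quotients of step `1 / (n + 1)` on `(-n, n]`, which
converge almost everywhere because `f` is locally absolutely continuous. -/
theorem EnergyLE.eLpNorm_deriv_le {f : ℝ → ℝ} {B : ℝ} (h : EnergyLE f B) :
    eLpNorm (deriv f) 2 volume ≤ ENNReal.ofReal B := by
  have hf := h.continuous
  set δ : ℕ → ℝ := fun n => 1 / ((n : ℝ) + 1) with hδ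
  have hδ0 : ∀ n, 0 < δ n := fun n => by simp only [hδ]; positivity
  set F : ℕ → ℝ → ENNReal := fun n => (Set.Ioc (-(n : ℝ)) n).indicator
    (fun x => ENNReal.ofReal (((f (x + δ n) - f x) / δ n) ^ 2)) with hF
  have hFm : ∀ n, Measurable (F n) := fun n =>
    Measurable.indicator (ENNReal.measurable_ofReal.comp
      (Continuous.measurable (by fun_prop))) measurableSet_Ioc
  have hFle : ∀ n, ∫⁻ x, F n x ≤ ENNReal.ofReal (B ^ 2) := by
    intro n
    rw [hF, lintegral_indicator measurableSet_Ioc]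
    have hcont : Continuous fun x => ((f (x + δ n) - f x) / δ n) ^ 2 := by fun_prop
    rw [← ofReal_integral_eq_lintegral_ofReal]
    · apply ENNReal.ofReal_le_ofReal
      rw [← intervalIntegral.integral_of_le (by linarith [(Nat.cast_nonneg n : (0 : ℝ) ≤ n)])]
      -- The interval has length `2 * n`, that is `2 * n * (n + 1)` windows of length `1 / (n + 1)`.
      convert! h.sum_slope_le (hδ0 n) (-(n : ℝ)) (2 * n * (n + 1)) using 2
      simp only [hδ]
      push_cast
      field_simp
      ring
    · exact (hcont.intervalIntegrable _ _).1
    · exact Eventually.of_forall fun x => sq_nonneg _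
  have hlim : ∀ᵐ x, ENNReal.ofReal ((deriv f x) ^ 2) ≤ liminf (fun n => F n x) atTop := by
    filter_upwards [h.ae_differentiableAt] with x hx
    have hs := hx.hasDerivAt.tendsto_slope_zero_right
    have hδt : Tendsto δ atTop (𝓝[>] 0) :=
      tendsto_nhdsWithin_iff.2 ⟨tendsto_one_div_add_atTop_nhds_zero_nat,
        Eventually.of_forall fun n => hδ0 n⟩
    have h1 := (hs.comp hδt)
    have h2 : Tendsto (fun n => ENNReal.ofReal (((f (x + δ n) - f x) / δ n) ^ 2)) atTop
        (𝓝 (ENNReal.ofReal ((deriv f x) ^ 2))) := by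
      refine ENNReal.tendsto_ofReal (Tendsto.pow ?_ 2)
      refine h1.congr fun n => ?_
      simp only [Function.comp, smul_eq_mul]
      rw [div_eq_inv_mul]
    have h3 : (fun n => F n x) =ᶠ[atTop]
        fun n => ENNReal.ofReal (((f (x + δ n) - f x) / δ n) ^ 2) := by
      obtain ⟨m, hm⟩ := exists_nat_gt |x|
      filter_upwards [eventually_ge_atTop m] with n hn
      rw [hF]
      refine Set.indicator_of_mem ?_ _
      have : (m : ℝ) ≤ n := by exact_mod_cast hn
      rw [abs_lt] at hm
      exact ⟨by linarith, by linarith⟩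
    exact (h2.congr' h3.symm).liminf_eq.ge
  have hint : ∫⁻ x, ENNReal.ofReal ((deriv f x) ^ 2) ≤ ENNReal.ofReal (B ^ 2) := by
    calc _ ≤ ∫⁻ x, liminf (fun n => F n x) atTop := lintegral_mono_ae hlim
      _ ≤ liminf (fun n => ∫⁻ x, F n x) atTop := lintegral_liminf_le hFm
      _ ≤ liminf (fun _ : ℕ => ENNReal.ofReal (B ^ 2)) atTop :=
          liminf_le_liminf (Eventually.of_forall hFle)
      _ = _ := liminf_const _
  rw [eLpNorm_eq_lintegral_rpow_enorm_toReal (by simp) (by simp)]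
  simp only [ENNReal.toReal_ofNat, ENNReal.rpow_ofNat, one_div]
  have h4 : ∀ x, ‖deriv f x‖ₑ ^ 2 = ENNReal.ofReal ((deriv f x) ^ 2) := fun x => by
    rw [Real.enorm_eq_ofReal_abs, ← ENNReal.ofReal_pow (abs_nonneg _), sq_abs]
  simp_rw [h4]
  calc _ ≤ (ENNReal.ofReal (B ^ 2)) ^ (2⁻¹ : ℝ) := by gcongr
    _ = ENNReal.ofReal B := by
      rw [ENNReal.ofReal_rpow_of_nonneg (sq_nonneg _) (by norm_num)]
      congr 1
      rw [← one_div, ← Real.sqrt_eq_rpow, Real.sqrt_sq h.1]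

theorem EnergyLE.memLp_deriv {f : ℝ → ℝ} {B : ℝ} (h : EnergyLE f B) : MemLp (deriv f) 2 :=
  ⟨(measurable_deriv f).aestronglyMeasurable, h.eLpNorm_deriv_le.trans_lt ENNReal.ofReal_lt_top⟩

theorem intervalIntegral_eq_integral_of_support {F : ℝ → ℝ} {R : ℝ} (hR : 0 ≤ R)
    (h : ∀ x, R < |x| → F x = 0) : ∫ x in (-R)..R, F x = ∫ x, F x := by
  rw [intervalIntegral.integral_of_le (by linarith), ← integral_Icc_eq_integral_Ioc]
  apply setIntegral_eq_integral_of_forall_compl_eq_zero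
  intro x hx
  apply h
  by_contra hc
  exact hx (abs_le.1 (not_lt.1 hc))

theorem exists_support_bound {φ : ℝ → ℝ} (hφ : HasCompactSupport φ) :
    ∃ R : ℝ, 0 ≤ R ∧ ∀ x, R ≤ |x| → φ x = 0 := by
  obtain ⟨R, hR⟩ := hφ.isBounded.exists_norm_le
  refine ⟨max R 0 + 1, by positivity, fun x hx => ?_⟩
  by_contra hc
  have := hR x (subset_tsupport _ hc)
  rw [Real.norm_eq_abs] at this
  have := le_max_left R 0
  linarith

/-- Locally absolutely continuous functions have their a.e. derivative as weak derivative. -/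
theorem isWeakDeriv_of_absolutelyContinuous {f : ℝ → ℝ}
    (hf : ∀ a b, AbsolutelyContinuousOnInterval f a b) : IsWeakDeriv f (deriv f) := by
  intro φ hφ hc
  obtain ⟨R, hR, hR'⟩ := exists_support_bound hc
  obtain ⟨R₂, hR₂, hR₂'⟩ := exists_support_bound hc.deriv
  set M := max R R₂ with hM
  have hM0 : 0 ≤ M := hR.trans (le_max_left _ _)
  have h1 : ∀ x, M ≤ |x| → φ x = 0 := fun x hx => hR' x ((le_max_left _ _).trans hx)
  have h2 : ∀ x, M ≤ |x| → deriv φ x = 0 := fun x hx => hR₂' x ((le_max_right _ _).trans hx)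
  rw [← intervalIntegral_eq_integral_of_support hM0 (fun x hx => by rw [h2 x hx.le, mul_zero]),
    ← intervalIntegral_eq_integral_of_support hM0 (fun x hx => by rw [h1 x hx.le, mul_zero])]
  have hφac : AbsolutelyContinuousOnInterval φ (-M) M :=
    ContDiffOn.absolutelyContinuousOnInterval (hφ.contDiffOn.of_le (by norm_num))
  rw [(hf (-M) M).integral_mul_deriv_eq_deriv_mul hφac, h1 M (le_abs_self M),
    h1 (-M) (by rw [abs_neg]; exact le_abs_self M)]
  ring

theorem EnergyLE.isWeakDeriv {f : ℝ → ℝ} {B : ℝ} (h : EnergyLE f B) : IsWeakDeriv f (deriv f) :=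
  isWeakDeriv_of_absolutelyContinuous h.absolutelyContinuousOnInterval

/-- For a test function `ψ` with primitive `Ψ`, the function `Ψ (x - s) - Ψ x` has compact support
even when `∫ ψ ≠ 0`, so it is an admissible test function. Testing with it shows that `h (· + s) -
h` is orthogonal to every `ψ`, and continuity removes the exceptional null set. -/
theorem eq_of_isWeakDeriv_zero {h : ℝ → ℝ} (hc : Continuous h) (hw : IsWeakDeriv h 0) (x y : ℝ) :
    h x = h y := by
  set s := y - x with hs
  have hk : ∀ᵐ z, h (z + s) - h z = 0 := by
    refine ae_eq_zero_of_integral_contDiff_smul_eq_zero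
      (Continuous.locallyIntegrable (by fun_prop)) fun ψ hψ hψc => ?_
    obtain ⟨R, hR, hR'⟩ := exists_support_bound hψc
    have hψcont : Continuous ψ := hψ.continuous
    have hΨ : ∀ x, HasDerivAt (fun x => ∫ r in (0 : ℝ)..x, ψ r) (ψ x) x := fun x =>
      intervalIntegral.integral_hasDerivAt_right (hψcont.intervalIntegrable _ _)
        (hψcont.stronglyMeasurableAtFilter _ _) hψcont.continuousAt
    set φ : ℝ → ℝ := fun x => (∫ r in (0 : ℝ)..(x - s), ψ r) - ∫ r in (0 : ℝ)..x, ψ r with hφ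
    have hφd : ∀ x, HasDerivAt φ (ψ (x - s) - ψ x) x := fun x =>
      ((hΨ (x - s)).comp_sub_const x s).sub (hΨ x)
    have hφ' : deriv φ = fun x => ψ (x - s) - ψ x := funext fun x => (hφd x).deriv
    have hφsmooth : ContDiff ℝ (⊤ : ℕ∞) φ := by
      rw [contDiff_infty_iff_deriv]
      refine ⟨fun x => (hφd x).differentiableAt, ?_⟩
      rw [hφ']
      exact (hψ.comp (contDiff_id.sub contDiff_const)).sub hψ
    have hφc : HasCompactSupport φ := by
      refine HasCompactSupport.intro (K := Set.Icc (-(R + |s|)) (R + |s|)) isCompact_Icc ?_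
      intro x hx
      rw [hφ]
      simp only
      rw [intervalIntegral.integral_interval_sub_left (hψcont.intervalIntegrable _ _)
        (hψcont.intervalIntegrable _ _)]
      apply intervalIntegral.integral_zero_ae
      refine Eventually.of_forall fun r hr => hR' r ?_
      have hx' : R + |s| < |x| := by
        by_contra hcon
        exact hx (abs_le.1 (not_lt.1 hcon))
      have hr' : |r - x| ≤ |s| := by
        have := Set.abs_sub_left_of_mem_uIcc (Set.uIoc_subset_uIcc hr)
        simpa [abs_sub_comm] using this
      have := abs_sub_abs_le_abs_sub x r
      rw [abs_sub_comm] at this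
      linarith [abs_sub_comm x r]
    have := hw φ hφsmooth hφc
    simp only [Pi.zero_apply, zero_mul, integral_zero, neg_zero, hφ'] at this
    have hint : ∀ c : ℝ, Integrable fun z => h (z + c) * ψ z := fun c =>
      Continuous.integrable_of_hasCompactSupport (by fun_prop) hψc.mul_left
    have hint2 : Integrable fun z => h z * ψ (z - s) := by
      have := (hint s).comp_sub_right s
      simpa using this
    have hint0 : Integrable fun z => h z * ψ z := by simpa using hint 0
    calc ∫ z, ψ z • (h (z + s) - h z) = ∫ z, (h (z + s) * ψ z - h z * ψ z) := by
          congr 1; ext z; rw [smul_eq_mul]; ring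
      _ = (∫ z, h (z + s) * ψ z) - ∫ z, h z * ψ z := integral_sub (hint s) hint0
      _ = (∫ z, h z * ψ (z - s)) - ∫ z, h z * ψ z := by
          congr 1
          rw [← integral_sub_right_eq_self (fun z => h (z + s) * ψ z) s]
          simp
      _ = ∫ z, h z * (ψ (z - s) - ψ z) := by
          rw [← integral_sub hint2 hint0]
          congr 1; ext z; ring
      _ = 0 := this
  have hk' : (fun z => h (z + s) - h z) = fun _ => 0 :=
    (Continuous.ae_eq_iff_eq volume (by fun_prop) (by fun_prop)).1 hk
  have := congrFun hk' x
  simp only [hs] at this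
  rw [add_sub_cancel] at this
  linarith

theorem intervalIntegrable_of_locallyIntegrable {g : ℝ → ℝ} (hg : LocallyIntegrable g) (a b : ℝ) :
    IntervalIntegrable g volume a b :=
  intervalIntegrable_iff.mpr
    ((hg.integrableOn_isCompact isCompact_uIcc).mono_set Set.uIoc_subset_uIcc)

/-- A continuous function is the primitive of its weak derivative. -/
theorem sub_eq_integral_of_isWeakDeriv {f g : ℝ → ℝ} (hf : Continuous f)
    (hg : LocallyIntegrable g) (hw : IsWeakDeriv f g) (x y : ℝ) :
    f y - f x = ∫ r in x..y, g r := by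
  have hgi : ∀ a b, IntervalIntegrable g volume a b := fun a b => intervalIntegrable_of_locallyIntegrable hg a b
  set G : ℝ → ℝ := fun x => ∫ r in (0 : ℝ)..x, g r with hG
  have hGcont : Continuous G := intervalIntegral.continuous_primitive hgi 0
  have hGac : ∀ a b, AbsolutelyContinuousOnInterval G a b := fun a b => by
    have h1 := (hgi (min a 0) (max b (max a 0))).absolutelyContinuousOnInterval_intervalIntegral
      (c := 0) (Set.mem_uIcc.2 (Or.inl ⟨min_le_right _ _,
        (le_max_right a 0).trans (le_max_right _ _)⟩))
    have h2 := (hgi (min b 0) (max b (max a 0))).absolutelyContinuousOnInterval_intervalIntegral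
      (c := 0) (Set.mem_uIcc.2 (Or.inl ⟨min_le_right _ _,
        (le_max_right a 0).trans (le_max_right _ _)⟩))
    rcases le_total a b with hab | hab
    · refine h1.mono (Set.uIcc_subset_uIcc ?_ ?_) <;> rw [Set.mem_uIcc] <;> left <;>
        constructor <;> simp [hab]
    · refine h2.mono (Set.uIcc_subset_uIcc ?_ ?_) <;> rw [Set.mem_uIcc] <;> left <;>
        constructor <;> simp [hab]
  have hGd : deriv G =ᵐ[volume] g := by
    filter_upwards [_root_.LocallyIntegrable.ae_hasDerivAt_integral hg] with z hz using (hz 0).deriv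
  have hGw := isWeakDeriv_of_absolutelyContinuous hGac
  have hwz : IsWeakDeriv (fun z => f z - G z) 0 := by
    intro φ hφ hφc
    have h1 := hw φ hφ hφc
    have h2 := hGw φ hφ hφc
    have h3 : ∫ x, deriv G x * φ x = ∫ x, g x * φ x :=
      integral_congr_ae (hGd.mono fun z hz => by simp only [hz])
    have hφ' : Continuous (deriv φ) := hφ.continuous_deriv (by norm_num)
    have hi : ∀ k : ℝ → ℝ, Continuous k → Integrable fun z => k z * deriv φ z := fun k hk =>
      (hk.mul hφ').integrable_of_hasCompactSupport hφc.deriv.mul_left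
    simp only [sub_mul, Pi.zero_apply, zero_mul, integral_zero, neg_zero]
    rw [integral_sub (hi f hf) (hi G hGcont), h1, h2, h3, sub_self]
  have := eq_of_isWeakDeriv_zero (hf.sub hGcont) hwz x y
  rw [← intervalIntegral.integral_interval_sub_left (hgi 0 y) (hgi 0 x)]
  simp only [hG, Pi.sub_apply] at this
  linarith

theorem integral_sq_eq {g : ℝ → ℝ} (hg : MemLp g 2) :
    ∫ x, g x ^ 2 = (eLpNorm g 2 volume).toReal ^ 2 := by
  rw [hg.eLpNorm_eq_integral_rpow_norm (by simp) (by simp)]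
  have h0 : 0 ≤ ∫ x, g x ^ 2 := integral_nonneg fun _ => sq_nonneg _
  simp only [ENNReal.toReal_ofNat, Real.norm_eq_abs, Real.rpow_ofNat, sq_abs]
  rw [ENNReal.toReal_ofReal (by positivity), ← one_div, ← Real.sqrt_eq_rpow, Real.sq_sqrt h0]

theorem MemLp.intervalIntegrable_sq {g : ℝ → ℝ} (hg : MemLp g 2) (a b : ℝ) :
    IntervalIntegrable (fun x => g x ^ 2) volume a b :=
  hg.integrable_sq.intervalIntegrable

theorem MemLp.intervalIntegrable {g : ℝ → ℝ} (hg : MemLp g 2) (a b : ℝ) :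
    IntervalIntegrable g volume a b :=
  intervalIntegrable_of_locallyIntegrable (hg.locallyIntegrable (by norm_num)) a b

/-- A primitive of an `L²` function has finite energy. -/
theorem energyLE_of_primitive {f g : ℝ → ℝ} (hg : MemLp g 2)
    (hfg : ∀ x y, f y - f x = ∫ r in x..y, g r) : EnergyLE f (eLpNorm g 2 volume).toReal := by
  refine ⟨ENNReal.toReal_nonneg, fun s a b hab hd => ?_⟩
  rw [← integral_sq_eq hg]
  calc _ ≤ ∑ i ∈ s, ∫ r in Set.Ioc (a i) (b i), g r ^ 2 := by
        apply Finset.sum_le_sum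
        intro i hi
        have hpos := sub_pos.2 (hab i hi)
        rw [hfg, div_le_iff₀ hpos, mul_comm, ← intervalIntegral.integral_of_le (hab i hi).le]
        exact sq_intervalIntegral_le (hab i hi).le (MemLp.intervalIntegrable hg _ _)
          (MemLp.intervalIntegrable_sq hg _ _)
    _ = ∫ r in ⋃ i ∈ s, Set.Ioc (a i) (b i), g r ^ 2 :=
        (integral_biUnion_finset s (fun i _ => measurableSet_Ioc) hd
          fun i _ => hg.integrable_sq.integrableOn).symm
    _ ≤ _ := setIntegral_le_integral hg.integrable_sq (Eventually.of_forall fun _ => sq_nonneg _)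

/-- Compare `f x` with `f y` for `y` in `[x, x + 1]` and average over `y`. Keeping the integral
local yields both the uniform bound and the decay at infinity. -/
theorem sq_le_of_primitive {f g : ℝ → ℝ} (hf : MemLp f 2) (hg : MemLp g 2)
    (hfg : ∀ x y, f y - f x = ∫ r in x..y, g r) (x : ℝ) :
    f x ^ 2 ≤ 2 * ∫ r in x..(x + 1), (f r ^ 2 + g r ^ 2) := by
  have hle : x ≤ x + 1 := by linarith
  have hf2 := MemLp.intervalIntegrable_sq hf x (x + 1)
  have hg2 := MemLp.intervalIntegrable_sq hg
  have key : ∀ y ∈ Set.Icc x (x + 1), f x ^ 2 ≤ 2 * f y ^ 2 + 2 * ∫ r in x..(x + 1), g r ^ 2 := by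
    intro y hy
    have h1 := sq_intervalIntegral_le hy.1 (MemLp.intervalIntegrable hg x y) (hg2 x y)
    rw [← hfg] at h1
    have h2 : ∫ r in x..y, g r ^ 2 ≤ ∫ r in x..(x + 1), g r ^ 2 :=
      intervalIntegral.integral_mono_interval le_rfl hy.1 hy.2
        (Eventually.of_forall fun _ => sq_nonneg _) (hg2 _ _)
    have h3 : 0 ≤ ∫ r in x..y, g r ^ 2 :=
      intervalIntegral.integral_nonneg hy.1 fun _ _ => sq_nonneg _
    have h4 : (y - x) * ∫ r in x..y, g r ^ 2 ≤ 1 * ∫ r in x..y, g r ^ 2 := by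
      gcongr; linarith [hy.2]
    nlinarith [sq_nonneg (f y + (f y - f x))]
  have := intervalIntegral.integral_mono_on hle intervalIntegrable_const
    ((hf2.const_mul 2).add intervalIntegrable_const) key
  rw [intervalIntegral.integral_add (hf2.const_mul 2) intervalIntegrable_const,
    intervalIntegral.integral_const, intervalIntegral.integral_const,
    intervalIntegral.integral_const_mul] at this
  rw [intervalIntegral.integral_add hf2 (hg2 _ _)]
  simp only [smul_eq_mul, add_sub_cancel_left, one_mul] at this
  linarith

/-- The Sobolev embedding `H¹ ⊂ L^∞`. -/
theorem abs_le_of_primitive {f g : ℝ → ℝ} (hf : MemLp f 2) (hg : MemLp g 2)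
    (hfg : ∀ x y, f y - f x = ∫ r in x..y, g r) (x : ℝ) :
    |f x| ≤ 2 * ((eLpNorm f 2 volume).toReal + (eLpNorm g 2 volume).toReal) := by
  have h1 := sq_le_of_primitive hf hg hfg x
  have h2 : ∫ r in x..(x + 1), (f r ^ 2 + g r ^ 2) ≤ ∫ r, (f r ^ 2 + g r ^ 2) := by
    rw [intervalIntegral.integral_of_le (by linarith)]
    exact setIntegral_le_integral (hf.integrable_sq.add hg.integrable_sq)
      (Eventually.of_forall fun _ => by positivity)
  rw [integral_add hf.integrable_sq hg.integrable_sq, integral_sq_eq hf, integral_sq_eq hg] at h2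
  have ha : 0 ≤ (eLpNorm f 2 volume).toReal := ENNReal.toReal_nonneg
  have hb : 0 ≤ (eLpNorm g 2 volume).toReal := ENNReal.toReal_nonneg
  apply abs_le_of_sq_le_sq _ (by positivity)
  nlinarith [mul_nonneg ha hb]

/-- Functions in `H¹` vanish at infinity. -/
theorem tendsto_zero_of_primitive {f g : ℝ → ℝ} (hf : MemLp f 2) (hg : MemLp g 2)
    (hfg : ∀ x y, f y - f x = ∫ r in x..y, g r) : Tendsto f (cocompact ℝ) (𝓝 0) := by
  set F : ℝ → ℝ := fun r => f r ^ 2 + g r ^ 2 with hF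
  have hFi : Integrable F := hf.integrable_sq.add hg.integrable_sq
  have hi : ∀ a b, IntervalIntegrable F volume a b := fun a b => hFi.intervalIntegrable
  have hsub : ∀ x, ∫ r in x..(x + 1), F r
      = (∫ r in (0 : ℝ)..(x + 1), F r) - ∫ r in (0 : ℝ)..x, F r := fun x =>
    (intervalIntegral.integral_interval_sub_left (hi _ _) (hi _ _)).symm
  have hsq : Tendsto (fun x => 2 * ∫ r in x..(x + 1), F r) (cocompact ℝ) (𝓝 0) := by
    rw [cocompact_eq_atBot_atTop, tendsto_sup]
    constructor
    · have h1 : Tendsto (fun x => ∫ r in x..0, F r) atBot (𝓝 (∫ r in Set.Iic 0, F r)) :=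
        intervalIntegral_tendsto_integral_Iic 0 hFi.integrableOn tendsto_id
      have h2 : Tendsto (fun x => ∫ r in (x + 1)..0, F r) atBot (𝓝 (∫ r in Set.Iic 0, F r)) :=
        intervalIntegral_tendsto_integral_Iic 0 hFi.integrableOn
          (tendsto_atBot_add_const_right _ _ tendsto_id)
      have h3 := (h1.sub h2).const_mul 2
      rw [sub_self, mul_zero] at h3
      refine h3.congr fun x => ?_
      rw [intervalIntegral.integral_symm 0 x, intervalIntegral.integral_symm 0 (x + 1), hsub]
      ring
    · have h1 : Tendsto (fun x => ∫ r in (0 : ℝ)..x, F r) atTop (𝓝 (∫ r in Set.Ioi 0, F r)) :=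
        intervalIntegral_tendsto_integral_Ioi 0 hFi.integrableOn tendsto_id
      have h2 : Tendsto (fun x => ∫ r in (0 : ℝ)..(x + 1), F r) atTop
          (𝓝 (∫ r in Set.Ioi 0, F r)) :=
        intervalIntegral_tendsto_integral_Ioi 0 hFi.integrableOn
          (tendsto_atTop_add_const_right _ _ tendsto_id)
      have h3 := (h2.sub h1).const_mul 2
      rw [sub_self, mul_zero] at h3
      exact h3.congr fun x => by rw [hsub]
  have hsq' : Tendsto (fun x => f x ^ 2) (cocompact ℝ) (𝓝 0) :=
    squeeze_zero (fun _ => sq_nonneg _) (sq_le_of_primitive hf hg hfg) hsq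
  have := hsq'.sqrt
  simp only [Real.sqrt_sq_eq_abs, Real.sqrt_zero] at this
  exact (tendsto_zero_iff_abs_tendsto_zero f).2 this


/-! ### Characteristics of a bounded Lipschitz field. -/

/-- The average of `Fx r` over the segment from `a` to `b`. -/
def segAvg (Fx : ℝ → ℝ → ℝ) (r a b : ℝ) : ℝ := ∫ l in (0 : ℝ)..1, Fx r (a + l * (b - a))

theorem continuous_segAvg {Fx : ℝ → ℝ → ℝ} (h : Continuous (Function.uncurry Fx))
    {ι : Type*} [TopologicalSpace ι] {r a b : ι → ℝ} (hr : Continuous r) (ha : Continuous a)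
    (hb : Continuous b) : Continuous fun i => segAvg Fx (r i) (a i) (b i) := by
  unfold segAvg
  apply intervalIntegral.continuous_parametric_intervalIntegral_of_continuous'
  exact h.comp (f := fun p : ι × ℝ => (r p.1, a p.1 + p.2 * (b p.1 - a p.1))) (by fun_prop)

@[simp] theorem segAvg_self (Fx : ℝ → ℝ → ℝ) (r a : ℝ) : segAvg Fx r a a = Fx r a := by
  simp [segAvg]

/-- Unlike an intermediate point from the mean value theorem, this factor depends continuously on
`r`, `a` and `b`. Differences of trajectories therefore solve exact linear equations with continuous
coefficients. -/
theorem sub_eq_segAvg {F Fx : ℝ → ℝ → ℝ} (h : Continuous (Function.uncurry Fx))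
    (hF : ∀ t x, HasDerivAt (F t) (Fx t x) x) (r a b : ℝ) :
    F r b - F r a = segAvg Fx r a b * (b - a) := by
  have hd : ∀ l ∈ Set.uIcc (0 : ℝ) 1, HasDerivAt (fun l => F r (a + l * (b - a)))
      (Fx r (a + l * (b - a)) * (b - a)) l := fun l _ => by
    have h1 : HasDerivAt (fun l => a + l * (b - a)) (b - a) l := by
      simpa using ((hasDerivAt_id l).mul_const (b - a)).const_add a
    exact (hF r _).comp l h1
  have hc : Continuous fun l => Fx r (a + l * (b - a)) := h.comp (by fun_prop :
    Continuous fun l : ℝ => (r, a + l * (b - a)))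
  have := intervalIntegral.integral_eq_sub_of_hasDerivAt hd
    (Continuous.intervalIntegrable (by fun_prop) _ _)
  rw [intervalIntegral.integral_mul_const] at this
  simp only [one_mul, zero_mul, add_zero, add_sub_cancel] at this
  exact this.symm

theorem abs_segAvg_le {Fx : ℝ → ℝ → ℝ} {A : ℝ} (h : ∀ t x, |Fx t x| ≤ A) (r a b : ℝ) :
    |segAvg Fx r a b| ≤ A := by
  have := intervalIntegral.norm_integral_le_of_norm_le_const (a := 0) (b := 1)
    (f := fun l => Fx r (a + l * (b - a))) (C := A) fun l _ => h _ _
  simpa [segAvg] using this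

/-- Carathéodory's form of differentiability, used to differentiate integrals and flows with respect
to a parameter. -/
theorem hasDerivAt_of_eq_mul {f k : ℝ → ℝ} {a : ℝ} (h : ∀ b, f b - f a = k b * (b - a))
    (hk : ContinuousAt k a) : HasDerivAt f (k a) a := by
  rw [hasDerivAt_iff_tendsto_slope]
  refine (hk.tendsto.mono_left nhdsWithin_le_nhds).congr' ?_
  filter_upwards [self_mem_nhdsWithin] with b hb
  rw [slope_def_field, h, mul_div_cancel_right₀ _ (sub_ne_zero.2 hb)]

theorem hasDerivAt_intervalIntegral_param {F Fx : ℝ → ℝ → ℝ}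
    (hc : Continuous (Function.uncurry F)) (h : Continuous (Function.uncurry Fx))
    (hF : ∀ t x, HasDerivAt (F t) (Fx t x) x) (s t x : ℝ) :
    HasDerivAt (fun y => ∫ r in s..t, F r y) (∫ r in s..t, Fx r x) x := by
  have hk : Continuous fun b => ∫ r in s..t, segAvg Fx r x b := by
    apply intervalIntegral.continuous_parametric_intervalIntegral_of_continuous'
    exact continuous_segAvg h (by fun_prop) (by fun_prop) (by fun_prop)
  have hi : ∀ y, IntervalIntegrable (fun r => F r y) volume s t := fun y =>
    Continuous.intervalIntegrable (hc.comp (by fun_prop : Continuous fun r : ℝ => (r, y))) _ _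
  have := hasDerivAt_of_eq_mul (f := fun y => ∫ r in s..t, F r y)
    (k := fun b => ∫ r in s..t, segAvg Fx r x b) (a := x) (fun b => by
      rw [← intervalIntegral.integral_sub (hi _) (hi _), ← intervalIntegral.integral_mul_const]
      congr 1; ext r
      exact sub_eq_segAvg h hF r x b) hk.continuousAt
  simpa using this

/-- A bounded time-dependent function on the line, with a bounded continuous space derivative. -/
structure IsField (c cx : ℝ → ℝ → ℝ) (A : ℝ) : Prop where
  cont : Continuous (Function.uncurry c)
  contx : Continuous (Function.uncurry cx)
  hasDerivAt : ∀ t x, HasDerivAt (c t) (cx t x) x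
  bound : ∀ t x, |c t x| ≤ A
  boundx : ∀ t x, |cx t x| ≤ A

theorem IsField.nonneg {c cx : ℝ → ℝ → ℝ} {A : ℝ} (h : IsField c cx A) : 0 ≤ A :=
  (abs_nonneg _).trans (h.bound 0 0)

theorem IsField.continuous_comp {c cx : ℝ → ℝ → ℝ} {A : ℝ} (h : IsField c cx A) {ι : Type*}
    [TopologicalSpace ι] {r a : ι → ℝ} (hr : Continuous r) (ha : Continuous a) :
    Continuous fun i => c (r i) (a i) := h.cont.comp (hr.prodMk ha)

theorem IsField.continuous_compx {c cx : ℝ → ℝ → ℝ} {A : ℝ} (h : IsField c cx A) {ι : Type*}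
    [TopologicalSpace ι] {r a : ι → ℝ} (hr : Continuous r) (ha : Continuous a) :
    Continuous fun i => cx (r i) (a i) := h.contx.comp (hr.prodMk ha)

theorem IsField.abs_sub_le {c cx : ℝ → ℝ → ℝ} {A : ℝ} (h : IsField c cx A) (t x y : ℝ) :
    |c t y - c t x| ≤ A * |y - x| := by
  rw [sub_eq_segAvg h.contx h.hasDerivAt, abs_mul]
  gcongr
  exact abs_segAvg_le h.boundx _ _ _

/-- `ξ` is a global characteristic of the field `c`. -/
def IsTraj (c : ℝ → ℝ → ℝ) (ξ : ℝ → ℝ) : Prop := ∀ t, HasDerivAt ξ (c t (ξ t)) t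

theorem IsTraj.continuous {c : ℝ → ℝ → ℝ} {ξ : ℝ → ℝ} (h : IsTraj c ξ) : Continuous ξ :=
  continuous_iff_continuousAt.2 fun t => (h t).continuousAt

variable {c cx : ℝ → ℝ → ℝ} {A : ℝ}

/-- The difference `z = η - ξ` solves `z' = q z` with `q = segAvg cx`, so multiplying by `exp (-∫
q)` makes it constant. Uniqueness, monotonicity, Lipschitz dependence and differentiability of the
flow all follow from this formula. -/
theorem IsTraj.sub_eq (hF : IsField c cx A) {ξ η : ℝ → ℝ} (hξ : IsTraj c ξ) (hη : IsTraj c η)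
    (s t : ℝ) : η t - ξ t = (η s - ξ s) * Real.exp (∫ r in s..t, segAvg cx r (ξ r) (η r)) := by
  have hq : Continuous fun r => segAvg cx r (ξ r) (η r) :=
    continuous_segAvg hF.contx continuous_id hξ.continuous hη.continuous
  have hQ : ∀ t, HasDerivAt (fun t => ∫ r in s..t, segAvg cx r (ξ r) (η r))
      (segAvg cx t (ξ t) (η t)) t := fun t =>
    intervalIntegral.integral_hasDerivAt_right (hq.intervalIntegrable _ _)
      (hq.stronglyMeasurableAtFilter _ _) hq.continuousAt
  have hW : ∀ t, HasDerivAt (fun t => (η t - ξ t) *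
      Real.exp (-∫ r in s..t, segAvg cx r (ξ r) (η r))) 0 t := fun t => by
    have := ((hη t).sub (hξ t)).mul (hQ t).neg.exp
    refine HasDerivAt.congr_deriv this ?_
    rw [sub_eq_segAvg hF.contx hF.hasDerivAt]
    simp only [Pi.sub_apply]
    ring
  have := is_const_of_deriv_eq_zero (fun t => (hW t).differentiableAt)
    (fun t => (hW t).deriv) t s
  simp only [intervalIntegral.integral_same, neg_zero, Real.exp_zero, mul_one] at this
  rw [← this, mul_assoc, ← Real.exp_add, neg_add_cancel, Real.exp_zero, mul_one]

theorem abs_integral_segAvg_le (hF : IsField c cx A) (ξ η : ℝ → ℝ) (s t : ℝ) :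
    |∫ r in s..t, segAvg cx r (ξ r) (η r)| ≤ A * |t - s| :=
  intervalIntegral.norm_integral_le_of_norm_le_const
    (f := fun r => segAvg cx r (ξ r) (η r)) fun _ _ => abs_segAvg_le hF.boundx _ _ _

theorem IsTraj.ext (hF : IsField c cx A) {ξ η : ℝ → ℝ} (hξ : IsTraj c ξ) (hη : IsTraj c η)
    (s : ℝ) (h : ξ s = η s) : ξ = η := by
  ext t
  have := hξ.sub_eq hF hη s t
  rw [h, sub_self, zero_mul, sub_eq_zero] at this
  exact this.symm

theorem IsTraj.abs_sub_le (hF : IsField c cx A) {ξ : ℝ → ℝ} (hξ : IsTraj c ξ) (s t : ℝ) :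
    |ξ t - ξ s| ≤ A * |t - s| := by
  have := Convex.norm_image_sub_le_of_norm_hasDerivWithin_le (f := ξ) (s := Set.univ) (C := A)
    (x := s) (y := t) (fun r _ => (hξ r).hasDerivWithinAt) (fun r _ => hF.bound _ _) convex_univ
    trivial trivial
  simpa using this

/-- The bounds on the field are global, so Picard–Lindelöf applies on time windows of any length.
Solutions on nested windows agree, and the global curve selects a window according to `|t - s|`. -/
theorem exists_traj (hF : IsField c cx A) (s x : ℝ) : ∃ ξ, IsTraj c ξ ∧ ξ s = x := by
  have hA := hF.nonneg
  have hloc : ∀ n : ℕ, ∃ ξ : ℝ → ℝ, ξ s = x ∧ ∀ t ∈ Set.Ioo (s - (n + 1)) (s + (n + 1)),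
      HasDerivAt ξ (c t (ξ t)) t := by
    intro n
    have hn : (0 : ℝ) < n + 1 := by positivity
    have hPL : IsPicardLindelof c (tmin := s - (n + 1)) (tmax := s + (n + 1))
        ⟨s, by constructor <;> linarith⟩ x (⟨A, hA⟩ * (n + 1)) 0 ⟨A, hA⟩ ⟨A, hA⟩ := by
      refine ⟨fun t _ => ?_, fun y _ => ?_, fun t _ y _ => hF.bound t y, ?_⟩
      · refine (LipschitzWith.of_dist_le_mul fun y z => ?_).lipschitzOnWith
        rw [Real.dist_eq, Real.dist_eq]
        exact hF.abs_sub_le t z y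
      · exact (hF.continuous_comp continuous_id continuous_const).continuousOn
      · simp only [add_sub_cancel_left, sub_sub_cancel, max_self, NNReal.coe_zero, sub_zero]
        exact le_rfl
    obtain ⟨ξ, h1, h2⟩ := hPL.exists_eq_forall_mem_Icc_hasDerivWithinAt₀
    exact ⟨ξ, h1, fun t ht => (h2 t (Set.Ioo_subset_Icc_self ht)).hasDerivAt
      (Icc_mem_nhds ht.1 ht.2)⟩
  choose ξ h1 h2 using hloc
  have hlip : ∀ t, LipschitzOnWith ⟨A, hA⟩ (c t) Set.univ := fun t =>
    (LipschitzWith.of_dist_le_mul fun y z => by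
      rw [Real.dist_eq, Real.dist_eq]; exact hF.abs_sub_le t z y).lipschitzOnWith
  have hagree : ∀ m n : ℕ, m ≤ n → ∀ t ∈ Set.Ioo (s - (m + 1)) (s + (m + 1)), ξ m t = ξ n t := by
    intro m n hmn
    have hmn' : (m : ℝ) ≤ n := by exact_mod_cast hmn
    have hm : (0 : ℝ) < m + 1 := by positivity
    exact ODE_solution_unique_of_mem_Ioo (s := fun _ => Set.univ) (t₀ := s) (fun t _ => hlip t)
      ⟨by linarith, by linarith⟩ (fun t ht => ⟨h2 m t ht, trivial⟩)
      (fun t ht => ⟨h2 n t ⟨by linarith [ht.1], by linarith [ht.2]⟩, trivial⟩)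
      (by rw [h1, h1])
  have hmem : ∀ t, t ∈ Set.Ioo (s - (⌈|t - s|⌉₊ + 1 : ℝ)) (s + (⌈|t - s|⌉₊ + 1)) := fun t => by
    have := Nat.le_ceil |t - s|
    constructor <;> linarith [neg_abs_le (t - s), le_abs_self (t - s)]
  refine ⟨fun t => ξ ⌈|t - s|⌉₊ t, fun t => ?_, by simpa using h1 0⟩
  have hev : (fun t => ξ ⌈|t - s|⌉₊ t) =ᶠ[𝓝 t] ξ ⌈|t - s|⌉₊ := by
    filter_upwards [Ioo_mem_nhds (hmem t).1 (hmem t).2] with r hr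
    rcases le_total ⌈|r - s|⌉₊ ⌈|t - s|⌉₊ with h | h
    · exact hagree _ _ h r (hmem r)
    · exact (hagree _ _ h r hr).symm
  exact (h2 _ t (hmem t)).congr_of_eventuallyEq hev

/-- The characteristic of `c` which passes through `x` at time `s`. -/
def flow (c : ℝ → ℝ → ℝ) (s x : ℝ) : ℝ → ℝ :=
  open Classical in if h : ∃ ξ, IsTraj c ξ ∧ ξ s = x then h.choose else fun _ => x

theorem isTraj_flow (hF : IsField c cx A) (s x : ℝ) : IsTraj c (flow c s x) := by
  have h := exists_traj hF s x
  rw [flow, dif_pos h]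
  exact h.choose_spec.1

theorem flow_self (hF : IsField c cx A) (s x : ℝ) : flow c s x s = x := by
  have h := exists_traj hF s x
  rw [flow, dif_pos h]
  exact h.choose_spec.2

theorem IsTraj.eq_flow (hF : IsField c cx A) {ξ : ℝ → ℝ} (hξ : IsTraj c ξ) (t : ℝ) :
    flow c t (ξ t) = ξ := (isTraj_flow hF t _).ext hF hξ t (flow_self hF t _)

theorem flow_flow (hF : IsField c cx A) (s x t : ℝ) : flow c t (flow c s x t) = flow c s x :=
  (isTraj_flow hF s x).eq_flow hF t

theorem flow_sub_le (hF : IsField c cx A) {x y : ℝ} (hxy : x < y) (s t : ℝ) :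
    flow c s y t - flow c s x t ≤ Real.exp (A * |t - s|) * (y - x) := by
  rw [(isTraj_flow hF s x).sub_eq hF (isTraj_flow hF s y) s t, flow_self hF, flow_self hF, mul_comm]
  have := sub_pos.2 hxy
  gcongr
  exact (abs_le.1 (abs_integral_segAvg_le hF _ _ s t)).2

theorem strictMono_flow (hF : IsField c cx A) (s t : ℝ) : StrictMono fun x => flow c s x t := by
  intro x y hxy
  have := (isTraj_flow hF s x).sub_eq hF (isTraj_flow hF s y) s t
  rw [flow_self hF, flow_self hF] at this
  have h2 := mul_pos (sub_pos.2 hxy) (Real.exp_pos (∫ r in s..t, segAvg cx r (flow c s x r)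
    (flow c s y r)))
  simp only
  linarith

theorem abs_flow_sub_le (hF : IsField c cx A) (s t x y : ℝ) :
    |flow c s y t - flow c s x t| ≤ Real.exp (A * |t - s|) * |y - x| := by
  rw [(isTraj_flow hF s x).sub_eq hF (isTraj_flow hF s y) s t, flow_self hF, flow_self hF, mul_comm,
    abs_mul, abs_of_pos (Real.exp_pos _)]
  gcongr
  exact (abs_le.1 (abs_integral_segAvg_le hF _ _ s t)).2

/-- The characteristics depend continuously on all variables. -/
theorem continuous_flow (hF : IsField c cx A) :
    Continuous fun p : ℝ × ℝ × ℝ => flow c p.1 p.2.1 p.2.2 := by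
  rw [continuous_iff_continuousAt]
  rintro ⟨s₀, x₀, t₀⟩
  rw [ContinuousAt, tendsto_iff_norm_sub_tendsto_zero]
  have hle : ∀ p : ℝ × ℝ × ℝ, ‖flow c p.1 p.2.1 p.2.2 - flow c s₀ x₀ t₀‖ ≤
      Real.exp (A * |p.2.2 - p.1|) * |p.2.1 - flow c s₀ x₀ p.1| + A * |p.2.2 - t₀| := by
    rintro ⟨s, x, t⟩
    simp only [Real.norm_eq_abs]
    have h1 := abs_flow_sub_le hF s t (flow c s₀ x₀ s) x
    rw [flow_flow hF] at h1
    have h2 := (isTraj_flow hF s₀ x₀).abs_sub_le hF t₀ t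
    calc _ = |(flow c s x t - flow c s₀ x₀ t) + (flow c s₀ x₀ t - flow c s₀ x₀ t₀)| := by
          congr 1; ring
      _ ≤ _ := (abs_add_le _ _).trans (add_le_add h1 h2)
  refine squeeze_zero (fun _ => norm_nonneg _) hle ?_
  have hcont : Continuous fun p : ℝ × ℝ × ℝ =>
      Real.exp (A * |p.2.2 - p.1|) * |p.2.1 - flow c s₀ x₀ p.1| + A * |p.2.2 - t₀| := by
    have := (isTraj_flow hF s₀ x₀).continuous
    fun_prop
  have := hcont.tendsto (s₀, x₀, t₀)
  simpa [flow_self hF] using this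

theorem IsField.continuous_flow_comp (hF : IsField c cx A) {ι : Type*} [TopologicalSpace ι]
    {s x t : ι → ℝ} (hs : Continuous s) (hx : Continuous x) (ht : Continuous t) :
    Continuous fun i => flow c (s i) (x i) (t i) :=
  (continuous_flow hF).comp (hs.prodMk (hx.prodMk ht))

/-- The logarithm of the derivative of the time-`t` map of the flow. -/
def flowLog (c cx : ℝ → ℝ → ℝ) (t a : ℝ) : ℝ := ∫ r in (0 : ℝ)..t, cx r (flow c 0 a r)

theorem hasDerivAt_flow (hF : IsField c cx A) (t a : ℝ) :
    HasDerivAt (fun x => flow c 0 x t) (Real.exp (flowLog c cx t a)) a := by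
  have hk : Continuous fun b =>
      Real.exp (∫ r in (0 : ℝ)..t, segAvg cx r (flow c 0 a r) (flow c 0 b r)) := by
    apply Real.continuous_exp.comp
    apply intervalIntegral.continuous_parametric_intervalIntegral_of_continuous'
    exact continuous_segAvg hF.contx (by fun_prop)
      (hF.continuous_flow_comp (by fun_prop) (by fun_prop) (by fun_prop))
      (hF.continuous_flow_comp (by fun_prop) (by fun_prop) (by fun_prop))
  have := hasDerivAt_of_eq_mul (f := fun x => flow c 0 x t) (a := a) (fun b => by
    rw [(isTraj_flow hF 0 a).sub_eq hF (isTraj_flow hF 0 b) 0 t, flow_self hF, flow_self hF,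
      mul_comm]) hk.continuousAt
  simpa [flowLog] using this

theorem continuous_flowLog (hF : IsField c cx A) :
    Continuous fun p : ℝ × ℝ => flowLog c cx p.1 p.2 := by
  apply intervalIntegral.continuous_parametric_intervalIntegral_of_continuous
  · exact hF.continuous_compx (by fun_prop)
      (hF.continuous_flow_comp (by fun_prop) (by fun_prop) (by fun_prop))
  · fun_prop

theorem abs_flowLog_le (hF : IsField c cx A) (t a : ℝ) : |flowLog c cx t a| ≤ A * |t| := by
  have := intervalIntegral.norm_integral_le_of_norm_le_const (a := 0) (b := t)
    (f := fun r => cx r (flow c 0 a r)) (C := A) fun l _ => hF.boundx _ _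
  simpa [flowLog] using this

theorem hasDerivAt_flowLog_left (hF : IsField c cx A) (t a : ℝ) :
    HasDerivAt (fun t => flowLog c cx t a) (cx t (flow c 0 a t)) t := by
  have hq : Continuous fun r => cx r (flow c 0 a r) :=
    hF.continuous_compx continuous_id (isTraj_flow hF 0 a).continuous
  exact intervalIntegral.integral_hasDerivAt_right (hq.intervalIntegrable _ _)
      (hq.stronglyMeasurableAtFilter _ _) hq.continuousAt

/-- By the group property the two time maps are mutually inverse, and the forward one has a positive
derivative. -/
theorem hasDerivAt_flow_inv (hF : IsField c cx A) (t x : ℝ) :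
    HasDerivAt (fun x => flow c t x 0) (Real.exp (-flowLog c cx t (flow c t x 0))) x := by
  rw [Real.exp_neg]
  refine HasDerivAt.of_local_left_inverse (f := fun a => flow c 0 a t)
    (Continuous.continuousAt (hF.continuous_flow_comp (by fun_prop) (by fun_prop) (by fun_prop)))
    (hasDerivAt_flow hF t _) (Real.exp_pos _).ne' (Eventually.of_forall fun y => ?_)
  rw [flow_flow hF, flow_self hF]


/-! ### The linear transport equation in Lagrangian coordinates. -/

/-- The time integral of `g` along the characteristics of `c`. -/
def damp (c g : ℝ → ℝ → ℝ) (t a : ℝ) : ℝ := ∫ r in (0 : ℝ)..t, g r (flow c 0 a r)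

/-- The derivative of `damp` with respect to the starting point. -/
def dampDeriv (c cx gx : ℝ → ℝ → ℝ) (t a : ℝ) : ℝ :=
  ∫ r in (0 : ℝ)..t, gx r (flow c 0 a r) * Real.exp (flowLog c cx r a)

/-- The solution of `u_t + c u_x + g u = 0` in Lagrangian coordinates. -/
def lagU (c g : ℝ → ℝ → ℝ) (u₀ : ℝ → ℝ) (t a : ℝ) : ℝ := u₀ a * Real.exp (-damp c g t a)

/-- The space derivative of the solution of `u_t + c u_x + g u = 0` in Lagrangian coordinates. -/
def lagD (c cx g gx : ℝ → ℝ → ℝ) (u₀ u₀' : ℝ → ℝ) (t a : ℝ) : ℝ :=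
  (u₀' a - u₀ a * dampDeriv c cx gx t a) * Real.exp (-(damp c g t a + flowLog c cx t a))

/-- The solution of `u_t + c u_x + g u = 0` with initial value `u₀`. -/
def transport (c g : ℝ → ℝ → ℝ) (u₀ : ℝ → ℝ) (t x : ℝ) : ℝ := lagU c g u₀ t (flow c t x 0)

/-- The space derivative of `transport`. -/
def transportDeriv (c cx g gx : ℝ → ℝ → ℝ) (u₀ u₀' : ℝ → ℝ) (t x : ℝ) : ℝ :=
  lagD c cx g gx u₀ u₀' t (flow c t x 0)

/-- Coefficients and initial value of a linear transport equation, with quantitative bounds. -/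
structure TransportData (c cx g gx : ℝ → ℝ → ℝ) (u₀ u₀' : ℝ → ℝ) (A τ L b₀ b₁ B : ℝ) :
    Prop where
  fieldc : IsField c cx A
  fieldg : IsField g gx A
  τ_nonneg : 0 ≤ τ
  small : A * τ ≤ 1 / 2
  hasDerivAt : ∀ x, HasDerivAt u₀ (u₀' x) x
  bound₀ : ∀ x, |u₀ x| ≤ 1
  bound₁ : ∀ x, |u₀' x| ≤ L
  energy₀ : EnergyLE u₀ b₀
  energy₁ : EnergyLE u₀' b₁
  energyc : ∀ t, EnergyLE (cx t) B
  energyg : ∀ t, EnergyLE (g t) B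
  energygx : ∀ t, EnergyLE (gx t) B

theorem exp_half_le_two : Real.exp (1 / 2) ≤ 2 := by
  have h1 : Real.exp (1 / 2) ^ 2 = Real.exp 1 := by rw [← Real.exp_nat_mul]; norm_num
  have h2 := Real.exp_one_lt_d9
  nlinarith [Real.exp_pos (1 / 2)]

theorem exp_one_le_three : Real.exp 1 ≤ 3 := by
  have h2 := Real.exp_one_lt_d9
  linarith

section

variable {c cx g gx : ℝ → ℝ → ℝ} {u₀ u₀' : ℝ → ℝ} {A τ L b₀ b₁ B : ℝ}

namespace TransportData

theorem continuous_u₀ (h : TransportData c cx g gx u₀ u₀' A τ L b₀ b₁ B) : Continuous u₀ :=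
  continuous_iff_continuousAt.2 fun x => (h.hasDerivAt x).continuousAt

theorem B_nonneg (h : TransportData c cx g gx u₀ u₀' A τ L b₀ b₁ B) : 0 ≤ B := (h.energyc 0).1

theorem L_nonneg (h : TransportData c cx g gx u₀ u₀' A τ L b₀ b₁ B) : 0 ≤ L :=
  (abs_nonneg _).trans (h.bound₁ 0)

theorem continuous_damp (h : TransportData c cx g gx u₀ u₀' A τ L b₀ b₁ B) :
    Continuous fun p : ℝ × ℝ => damp c g p.1 p.2 := by
  apply intervalIntegral.continuous_parametric_intervalIntegral_of_continuous
  · exact h.fieldg.continuous_comp (by fun_prop)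
      (h.fieldc.continuous_flow_comp (by fun_prop) (by fun_prop) (by fun_prop))
  · fun_prop

theorem continuous_dampDeriv (h : TransportData c cx g gx u₀ u₀' A τ L b₀ b₁ B) :
    Continuous fun p : ℝ × ℝ => dampDeriv c cx gx p.1 p.2 := by
  apply intervalIntegral.continuous_parametric_intervalIntegral_of_continuous
  · refine Continuous.mul (h.fieldg.continuous_compx (by fun_prop)
      (h.fieldc.continuous_flow_comp (by fun_prop) (by fun_prop) (by fun_prop)))
      (Real.continuous_exp.comp ?_)
    exact (continuous_flowLog h.fieldc).comp
      (f := fun q : (ℝ × ℝ) × ℝ => (q.2, q.1.2)) (by fun_prop)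
  · fun_prop

theorem continuous_lagU (h : TransportData c cx g gx u₀ u₀' A τ L b₀ b₁ B) :
    Continuous fun p : ℝ × ℝ => lagU c g u₀ p.1 p.2 := by
  have h1 := h.continuous_u₀
  have h2 := h.continuous_damp
  unfold lagU
  fun_prop

theorem continuous_lagD (h : TransportData c cx g gx u₀ u₀' A τ L b₀ b₁ B) :
    Continuous fun p : ℝ × ℝ => lagD c cx g gx u₀ u₀' p.1 p.2 := by
  have h0 := h.energy₁.continuous
  have h1 := h.continuous_u₀
  have h2 := h.continuous_damp
  have h3 := h.continuous_dampDeriv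
  have h4 := continuous_flowLog h.fieldc
  unfold lagD
  fun_prop

theorem continuous_inv (h : TransportData c cx g gx u₀ u₀' A τ L b₀ b₁ B) :
    Continuous fun p : ℝ × ℝ => (p.1, flow c p.1 p.2 0) :=
  continuous_fst.prodMk
    (h.fieldc.continuous_flow_comp continuous_fst continuous_snd continuous_const)

theorem continuous_transport (h : TransportData c cx g gx u₀ u₀' A τ L b₀ b₁ B) :
    Continuous (Function.uncurry (transport c g u₀)) :=
  h.continuous_lagU.comp h.continuous_inv

theorem continuous_transportDeriv (h : TransportData c cx g gx u₀ u₀' A τ L b₀ b₁ B) :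
    Continuous (Function.uncurry (transportDeriv c cx g gx u₀ u₀')) :=
  h.continuous_lagD.comp h.continuous_inv

theorem hasDerivAt_damp (h : TransportData c cx g gx u₀ u₀' A τ L b₀ b₁ B) (t a : ℝ) :
    HasDerivAt (damp c g t) (dampDeriv c cx gx t a) a := by
  apply hasDerivAt_intervalIntegral_param (F := fun r a => g r (flow c 0 a r))
    (Fx := fun r a => gx r (flow c 0 a r) * Real.exp (flowLog c cx r a))
  · exact h.fieldg.continuous_comp (by fun_prop)
      (h.fieldc.continuous_flow_comp (by fun_prop) (by fun_prop) (by fun_prop))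
  · exact Continuous.mul (h.fieldg.continuous_compx (by fun_prop)
      (h.fieldc.continuous_flow_comp (by fun_prop) (by fun_prop) (by fun_prop)))
      (Real.continuous_exp.comp (continuous_flowLog h.fieldc))
  · intro r a
    exact (h.fieldg.hasDerivAt r _).comp a (hasDerivAt_flow h.fieldc r a)

theorem hasDerivAt_lagU (h : TransportData c cx g gx u₀ u₀' A τ L b₀ b₁ B) (t a : ℝ) :
    HasDerivAt (lagU c g u₀ t)
      (lagD c cx g gx u₀ u₀' t a * Real.exp (flowLog c cx t a)) a := by
  refine HasDerivAt.congr_deriv ((h.hasDerivAt a).mul (h.hasDerivAt_damp t a).neg.exp) ?_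
  have : Real.exp (-(damp c g t a + flowLog c cx t a))
      = Real.exp (-damp c g t a) * Real.exp (-flowLog c cx t a) := by
    rw [← Real.exp_add]; ring_nf
  rw [lagD, this, mul_assoc, mul_assoc, ← Real.exp_add, neg_add_cancel, Real.exp_zero]
  simp only [Pi.neg_apply]
  ring

theorem hasDerivAt_transport (h : TransportData c cx g gx u₀ u₀' A τ L b₀ b₁ B) (t x : ℝ) :
    HasDerivAt (transport c g u₀ t) (transportDeriv c cx g gx u₀ u₀' t x) x := by
  refine HasDerivAt.congr_deriv ((h.hasDerivAt_lagU t (flow c t x 0)).comp x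
    (hasDerivAt_flow_inv h.fieldc t x)) ?_
  rw [mul_assoc, ← Real.exp_add, add_neg_cancel, Real.exp_zero, mul_one, transportDeriv]

theorem hasDerivAt_damp_left (h : TransportData c cx g gx u₀ u₀' A τ L b₀ b₁ B) (t a : ℝ) :
    HasDerivAt (fun t => damp c g t a) (g t (flow c 0 a t)) t := by
  have hq : Continuous fun r => g r (flow c 0 a r) :=
    h.fieldg.continuous_comp continuous_id (isTraj_flow h.fieldc 0 a).continuous
  exact intervalIntegral.integral_hasDerivAt_right (hq.intervalIntegrable _ _)
      (hq.stronglyMeasurableAtFilter _ _) hq.continuousAt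

theorem hasDerivAt_dampDeriv_left (h : TransportData c cx g gx u₀ u₀' A τ L b₀ b₁ B) (t a : ℝ) :
    HasDerivAt (fun t => dampDeriv c cx gx t a)
      (gx t (flow c 0 a t) * Real.exp (flowLog c cx t a)) t := by
  have hq : Continuous fun r => gx r (flow c 0 a r) * Real.exp (flowLog c cx r a) :=
    (h.fieldg.continuous_compx continuous_id (isTraj_flow h.fieldc 0 a).continuous).mul
      (Real.continuous_exp.comp ((continuous_flowLog h.fieldc).comp
        (continuous_id.prodMk continuous_const)))
  exact intervalIntegral.integral_hasDerivAt_right (hq.intervalIntegrable _ _)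
      (hq.stronglyMeasurableAtFilter _ _) hq.continuousAt

theorem hasDerivAt_lagU_left (h : TransportData c cx g gx u₀ u₀' A τ L b₀ b₁ B) (t a : ℝ) :
    HasDerivAt (fun t => lagU c g u₀ t a) (-(g t (flow c 0 a t) * lagU c g u₀ t a)) t := by
  refine HasDerivAt.congr_deriv ((h.hasDerivAt_damp_left t a).neg.exp.const_mul (u₀ a)) ?_
  simp only [Pi.neg_apply, lagU]
  ring

/-- With the starting point fixed, the space derivative of the solution solves a linear equation in
time in which no second derivative of the solution appears. Hence the evolution of `u_x` along
characteristics makes sense at every point for a solution that is only `H²`. -/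
theorem hasDerivAt_lagD_left (h : TransportData c cx g gx u₀ u₀' A τ L b₀ b₁ B) (t a : ℝ) :
    HasDerivAt (fun t => lagD c cx g gx u₀ u₀' t a)
      (-(lagU c g u₀ t a * gx t (flow c 0 a t)
        + (g t (flow c 0 a t) + cx t (flow c 0 a t)) * lagD c cx g gx u₀ u₀' t a)) t := by
  refine HasDerivAt.congr_deriv ((((h.hasDerivAt_dampDeriv_left t a).const_mul (u₀ a)).const_sub
    (u₀' a)).mul ((h.hasDerivAt_damp_left t a).add
      (hasDerivAt_flowLog_left h.fieldc t a)).neg.exp) ?_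
  have : Real.exp (-(damp c g t a + flowLog c cx t a))
      = Real.exp (-damp c g t a) * Real.exp (-flowLog c cx t a) := by
    rw [← Real.exp_add]; ring_nf
  have h2 : Real.exp (flowLog c cx t a) * Real.exp (-flowLog c cx t a) = 1 := by
    rw [← Real.exp_add, add_neg_cancel, Real.exp_zero]
  simp only [Pi.neg_apply, Pi.add_apply, lagU, lagD, this]
  linear_combination (-(u₀ a * gx t (flow c 0 a t) * Real.exp (-damp c g t a))) * h2

theorem lagU_flow (h : TransportData c cx g gx u₀ u₀' A τ L b₀ b₁ B) (t a : ℝ) :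
    transport c g u₀ t (flow c 0 a t) = lagU c g u₀ t a := by
  rw [transport, flow_flow h.fieldc, flow_self h.fieldc]

theorem lagD_flow (h : TransportData c cx g gx u₀ u₀' A τ L b₀ b₁ B) (t a : ℝ) :
    transportDeriv c cx g gx u₀ u₀' t (flow c 0 a t) = lagD c cx g gx u₀ u₀' t a := by
  rw [transportDeriv, flow_flow h.fieldc, flow_self h.fieldc]

theorem flow_flow_zero (h : TransportData c cx g gx u₀ u₀' A τ L b₀ b₁ B) (t x : ℝ) :
    flow c 0 (flow c t x 0) = flow c t x := flow_flow h.fieldc t x 0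

/-- The transport equation holds pointwise. -/
theorem hasDerivAt_transport_left (h : TransportData c cx g gx u₀ u₀' A τ L b₀ b₁ B) (t x : ℝ) :
    HasDerivAt (fun t => transport c g u₀ t x)
      (-(c t x * transportDeriv c cx g gx u₀ u₀' t x + g t x * transport c g u₀ t x)) t := by
  set ξ := flow c t x with hξ
  have hξt : ξ t = x := flow_self h.fieldc t x
  have hξ' : IsTraj c ξ := isTraj_flow h.fieldc t x
  -- Write `u(s, x) = u(s, ξ s) - ρ s * (ξ s - x)`. The first term is explicit along the
  -- characteristic; in the product the second factor vanishes at `s = t`, so continuity of `ρ`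
  -- suffices for differentiability there.
  set ρ : ℝ → ℝ := fun s => segAvg (transportDeriv c cx g gx u₀ u₀') s x (ξ s) with hρ
  have hρc : Continuous ρ := continuous_segAvg h.continuous_transportDeriv continuous_id
    continuous_const hξ'.continuous
  have hρt : ρ t = transportDeriv c cx g gx u₀ u₀' t x := by
    simp only [hρ, hξt, segAvg_self]
  have hprod : HasDerivAt (fun s => ρ s * (ξ s - x)) (ρ t * c t x) t := by
    rw [hasDerivAt_iff_tendsto_slope]
    have h1 := (hasDerivAt_iff_tendsto_slope.1 (hξ' t))
    rw [hξt] at h1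
    refine ((hρc.continuousAt.tendsto.mono_left nhdsWithin_le_nhds).mul h1).congr fun s => ?_
    rw [slope_def_field, slope_def_field, hξt]
    ring
  have hmain := (h.hasDerivAt_lagU_left t (ξ 0)).sub hprod
  have hfl : flow c 0 (ξ 0) = ξ := h.flow_flow_zero t x
  refine (HasDerivAt.congr_deriv hmain ?_).congr_of_eventuallyEq (Eventually.of_forall fun s => ?_)
  · rw [hρt, hfl, hξt, transport]
    ring
  · have := sub_eq_segAvg h.continuous_transportDeriv h.hasDerivAt_transport s x (ξ s)
    simp only [Pi.sub_apply]
    have h2 := h.lagU_flow s (ξ 0)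
    rw [hfl] at h2
    rw [← h2]
    simp only [hρ]
    linarith

theorem abs_damp_le (h : TransportData c cx g gx u₀ u₀' A τ L b₀ b₁ B) {t : ℝ}
    (ht : |t| ≤ τ) (a : ℝ) : |damp c g t a| ≤ 1 / 2 := by
  have := intervalIntegral.norm_integral_le_of_norm_le_const (a := 0) (b := t)
    (f := fun r => g r (flow c 0 a r)) (C := A) fun l _ => h.fieldg.bound _ _
  rw [sub_zero] at this
  exact this.trans ((mul_le_mul_of_nonneg_left ht h.fieldc.nonneg).trans h.small)

theorem abs_flowLog_le_half (h : TransportData c cx g gx u₀ u₀' A τ L b₀ b₁ B) {t : ℝ}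
    (ht : |t| ≤ τ) (a : ℝ) : |flowLog c cx t a| ≤ 1 / 2 :=
  (abs_flowLog_le h.fieldc t a).trans
    ((mul_le_mul_of_nonneg_left ht h.fieldc.nonneg).trans h.small)

theorem abs_dampDeriv_le (h : TransportData c cx g gx u₀ u₀' A τ L b₀ b₁ B) {t : ℝ}
    (ht : |t| ≤ τ) (a : ℝ) : |dampDeriv c cx gx t a| ≤ 1 := by
  have hA := h.fieldc.nonneg
  have := intervalIntegral.norm_integral_le_of_norm_le_const (a := 0) (b := t)
    (f := fun r => gx r (flow c 0 a r) * Real.exp (flowLog c cx r a)) (C := A * 2) fun r hr => by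
      rw [Real.norm_eq_abs, abs_mul, Real.abs_exp]
      have hr' : |r| ≤ τ := by
        refine le_trans ?_ ht
        have := Set.abs_sub_left_of_mem_uIcc (Set.uIoc_subset_uIcc hr)
        simpa using this
      have h1 : flowLog c cx r a ≤ 1 / 2 := (le_abs_self _).trans (h.abs_flowLog_le_half hr' a)
      have h2 := (Real.exp_le_exp.2 h1).trans exp_half_le_two
      gcongr
      exact h.fieldg.boundx _ _
  rw [sub_zero] at this
  refine this.trans ?_
  have := h.small
  nlinarith [mul_le_mul_of_nonneg_left ht hA]

theorem exp_neg_damp_le (h : TransportData c cx g gx u₀ u₀' A τ L b₀ b₁ B) {t : ℝ}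
    (ht : |t| ≤ τ) (a : ℝ) : |Real.exp (-damp c g t a)| ≤ 2 := by
  rw [Real.abs_exp]
  refine (Real.exp_le_exp.2 ?_).trans exp_half_le_two
  exact (neg_le_abs _).trans (h.abs_damp_le ht a)

theorem exp_flowLog_le (h : TransportData c cx g gx u₀ u₀' A τ L b₀ b₁ B) {t : ℝ}
    (ht : |t| ≤ τ) (a : ℝ) : |Real.exp (flowLog c cx t a)| ≤ 2 := by
  rw [Real.abs_exp]
  refine (Real.exp_le_exp.2 ?_).trans exp_half_le_two
  exact (le_abs_self _).trans (h.abs_flowLog_le_half ht a)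

theorem exp_neg_flowLog_le (h : TransportData c cx g gx u₀ u₀' A τ L b₀ b₁ B) {t : ℝ}
    (ht : |t| ≤ τ) (a : ℝ) : |Real.exp (-flowLog c cx t a)| ≤ 2 := by
  rw [Real.abs_exp]
  refine (Real.exp_le_exp.2 ?_).trans exp_half_le_two
  exact (neg_le_abs _).trans (h.abs_flowLog_le_half ht a)

theorem neg_damp_add_le (h : TransportData c cx g gx u₀ u₀' A τ L b₀ b₁ B) {t : ℝ}
    (ht : |t| ≤ τ) (a : ℝ) : -(damp c g t a + flowLog c cx t a) ≤ 1 := by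
  have h1 := (neg_le_abs _).trans (h.abs_damp_le ht a)
  have h2 := (neg_le_abs _).trans (h.abs_flowLog_le_half ht a)
  linarith

theorem abs_lagU_le' (h : TransportData c cx g gx u₀ u₀' A τ L b₀ b₁ B) {t : ℝ}
    (ht : |t| ≤ τ) (a : ℝ) : |lagU c g u₀ t a| ≤ 2 * |u₀ a| := by
  rw [lagU, abs_mul, mul_comm]
  gcongr
  exact h.exp_neg_damp_le ht a

theorem abs_lagU_le (h : TransportData c cx g gx u₀ u₀' A τ L b₀ b₁ B) {t : ℝ}
    (ht : |t| ≤ τ) (a : ℝ) : |lagU c g u₀ t a| ≤ 2 :=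
  (h.abs_lagU_le' ht a).trans (by linarith [h.bound₀ a])

theorem abs_sub_dampDeriv_le (h : TransportData c cx g gx u₀ u₀' A τ L b₀ b₁ B) {t : ℝ}
    (ht : |t| ≤ τ) (a : ℝ) : |u₀' a - u₀ a * dampDeriv c cx gx t a| ≤ L + 1 := by
  refine (abs_sub _ _).trans (add_le_add (h.bound₁ a) ?_)
  rw [abs_mul]
  exact mul_le_one₀ (h.bound₀ a) (abs_nonneg _) (h.abs_dampDeriv_le ht a)

theorem abs_lagD_le (h : TransportData c cx g gx u₀ u₀' A τ L b₀ b₁ B) {t : ℝ}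
    (ht : |t| ≤ τ) (a : ℝ) : |lagD c cx g gx u₀ u₀' t a| ≤ 3 * (L + 1) := by
  have hL := h.L_nonneg
  rw [lagD, abs_mul, mul_comm, Real.abs_exp]
  have h1 := (Real.exp_le_exp.2 (h.neg_damp_add_le ht a)).trans exp_one_le_three
  gcongr
  exact h.abs_sub_dampDeriv_le ht a

theorem exp_mul_le_two (h : TransportData c cx g gx u₀ u₀' A τ L b₀ b₁ B) {t : ℝ}
    (ht : |t| ≤ τ) : Real.exp (A * |t|) ≤ 2 :=
  (Real.exp_le_exp.2 ((mul_le_mul_of_nonneg_left ht h.fieldc.nonneg).trans h.small)).trans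
    exp_half_le_two

/-- The flow is Lipschitz with constant `exp (A * |t - s|) ≤ 2 ≤ 2 ^ 2`, so `EnergyLE.comp` applies
with the convenient factor 2. -/
theorem energy_comp_flow (h : TransportData c cx g gx u₀ u₀' A τ L b₀ b₁ B) {f : ℝ → ℝ} {C : ℝ}
    (hf : EnergyLE f C) {s t : ℝ} (ht : |t - s| ≤ τ) : EnergyLE (fun a => f (flow c s a t)) (2 * C) := by
  refine hf.comp (strictMono_flow h.fieldc s t) zero_le_two fun x y hxy => ?_
  refine (flow_sub_le h.fieldc hxy s t).trans ?_
  have := h.exp_mul_le_two ht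
  have hpos := sub_pos.2 hxy
  nlinarith

theorem abs_le_of_mem_uIcc (_h : TransportData c cx g gx u₀ u₀' A τ L b₀ b₁ B) {t r : ℝ}
    (ht : |t| ≤ τ) (hr : r ∈ Set.uIcc 0 t) : |r| ≤ τ := by
  have := Set.abs_sub_left_of_mem_uIcc hr
  rw [sub_zero, sub_zero] at this
  exact this.trans ht

theorem energy_damp (h : TransportData c cx g gx u₀ u₀' A τ L b₀ b₁ B) {t : ℝ}
    (ht : |t| ≤ τ) : EnergyLE (damp c g t) (2 * τ * B) := by
  refine (EnergyLE.intervalIntegral (F := fun r a => g r (flow c 0 a r)) (B := 2 * B)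
    (s := 0) (t := t) (fun r hr => h.energy_comp_flow (h.energyg r) ?_) fun a => ?_).mono ?_
  · rw [sub_zero]; exact h.abs_le_of_mem_uIcc ht hr
  · exact h.fieldg.continuous_comp continuous_id (isTraj_flow h.fieldc 0 a).continuous
  · rw [sub_zero]
    nlinarith [h.B_nonneg, mul_le_mul_of_nonneg_right ht h.B_nonneg]

theorem energy_flowLog (h : TransportData c cx g gx u₀ u₀' A τ L b₀ b₁ B) {t : ℝ}
    (ht : |t| ≤ τ) : EnergyLE (flowLog c cx t) (2 * τ * B) := by
  refine (EnergyLE.intervalIntegral (F := fun r a => cx r (flow c 0 a r)) (B := 2 * B)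
    (s := 0) (t := t) (fun r hr => h.energy_comp_flow (h.energyc r) ?_) fun a => ?_).mono ?_
  · rw [sub_zero]; exact h.abs_le_of_mem_uIcc ht hr
  · exact h.fieldc.continuous_compx continuous_id (isTraj_flow h.fieldc 0 a).continuous
  · rw [sub_zero]
    nlinarith [h.B_nonneg, mul_le_mul_of_nonneg_right ht h.B_nonneg]

theorem energy_dampDeriv (h : TransportData c cx g gx u₀ u₀' A τ L b₀ b₁ B) {t : ℝ}
    (ht : |t| ≤ τ) : EnergyLE (dampDeriv c cx gx t) (6 * τ * B) := by
  have hB := h.B_nonneg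
  have hA := h.fieldc.nonneg
  refine (EnergyLE.intervalIntegral
    (F := fun r a => gx r (flow c 0 a r) * Real.exp (flowLog c cx r a)) (B := 6 * B)
    (s := 0) (t := t) (fun r hr => ?_) fun a => ?_).mono ?_
  · have hr' := h.abs_le_of_mem_uIcc ht hr
    have e1 := h.energy_comp_flow (h.energygx r) (s := 0) (t := r) (by rwa [sub_zero])
    have e2 := (h.energy_flowLog hr').exp (a := 1 / 2)
      fun x => (le_abs_self _).trans (h.abs_flowLog_le_half hr' x)
    refine (e1.mul e2 (fun x => h.fieldg.boundx _ _) (h.exp_flowLog_le hr')).mono ?_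
    have hτ := h.τ_nonneg
    calc _ ≤ A * (2 * (2 * τ * B)) + 2 * (2 * B) := by gcongr; exact exp_half_le_two
      _ = 4 * (A * τ) * B + 4 * B := by ring
      _ ≤ 4 * (1 / 2) * B + 4 * B := by gcongr; exact h.small
      _ = 6 * B := by ring
  · exact (h.fieldg.continuous_compx continuous_id (isTraj_flow h.fieldc 0 a).continuous).mul
      (Real.continuous_exp.comp ((continuous_flowLog h.fieldc).comp
        (continuous_id.prodMk continuous_const)))
  · rw [sub_zero]
    nlinarith [mul_le_mul_of_nonneg_right ht hB]

theorem energy_lagU (h : TransportData c cx g gx u₀ u₀' A τ L b₀ b₁ B) {t : ℝ}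
    (ht : |t| ≤ τ) : EnergyLE (lagU c g u₀ t) (2 * b₀ + 4 * τ * B) := by
  have hB := h.B_nonneg
  have hτ := h.τ_nonneg
  have e1 := (h.energy_damp ht).neg.exp (a := 1 / 2)
    fun x => (neg_le_abs _).trans (h.abs_damp_le ht x)
  refine (h.energy₀.mul e1 h.bound₀ (h.exp_neg_damp_le ht)).mono ?_
  calc _ ≤ 1 * (2 * (2 * τ * B)) + 2 * b₀ := by gcongr; exact exp_half_le_two
    _ = _ := by ring

theorem energy_lagD (h : TransportData c cx g gx u₀ u₀' A τ L b₀ b₁ B) {t : ℝ}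
    (ht : |t| ≤ τ) :
    EnergyLE (lagD c cx g gx u₀ u₀' t) (3 * (b₀ + b₁) + 30 * (L + 1) * τ * B) := by
  have hB := h.B_nonneg
  have hτ := h.τ_nonneg
  have hL := h.L_nonneg
  have e1 := ((h.energy_damp ht).add (h.energy_flowLog ht)).neg.exp (a := 1)
    (h.neg_damp_add_le ht)
  have e2 := h.energy₁.sub (h.energy₀.mul (h.energy_dampDeriv ht) h.bound₀ (h.abs_dampDeriv_le ht))
  have h3 : ∀ x, |Real.exp (-(damp c g t x + flowLog c cx t x))| ≤ 3 := fun x => by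
    rw [Real.abs_exp]
    exact (Real.exp_le_exp.2 (h.neg_damp_add_le ht x)).trans exp_one_le_three
  refine (e2.mul e1 (h.abs_sub_dampDeriv_le ht) h3).mono ?_
  calc _ ≤ (L + 1) * (3 * (2 * τ * B + 2 * τ * B)) + 3 * (b₁ + (1 * (6 * τ * B) + 1 * b₀)) := by
        gcongr; exact exp_one_le_three
    _ = 3 * (b₀ + b₁) + (12 * (L + 1) + 18) * (τ * B) := by ring
    _ ≤ 3 * (b₀ + b₁) + (30 * (L + 1)) * (τ * B) := by gcongr; linarith
    _ = _ := by ring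

theorem energy_transport (h : TransportData c cx g gx u₀ u₀' A τ L b₀ b₁ B) {t : ℝ}
    (ht : |t| ≤ τ) : EnergyLE (transport c g u₀ t) (4 * b₀ + 8 * τ * B) :=
  (h.energy_comp_flow (h.energy_lagU ht) (s := t) (t := 0) (by rwa [zero_sub, abs_neg])).mono
    (le_of_eq (by ring))

/-- What matters is that the energy `B` of the coefficients carries a factor `τ`, with a constant
depending only on `L`. A time that is short relative to `L` then absorbs it, however large the `H²`
norm is. -/
theorem energy_transportDeriv (h : TransportData c cx g gx u₀ u₀' A τ L b₀ b₁ B) {t : ℝ}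
    (ht : |t| ≤ τ) : EnergyLE (transportDeriv c cx g gx u₀ u₀' t)
      (6 * (b₀ + b₁) + 60 * (L + 1) * τ * B) :=
  (h.energy_comp_flow (h.energy_lagD ht) (s := t) (t := 0) (by rwa [zero_sub, abs_neg])).mono
    (le_of_eq (by ring))

theorem abs_transport_le (h : TransportData c cx g gx u₀ u₀' A τ L b₀ b₁ B) {t : ℝ}
    (ht : |t| ≤ τ) (x : ℝ) : |transport c g u₀ t x| ≤ 2 := h.abs_lagU_le ht _

theorem abs_transportDeriv_le (h : TransportData c cx g gx u₀ u₀' A τ L b₀ b₁ B) {t : ℝ}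
    (ht : |t| ≤ τ) (x : ℝ) : |transportDeriv c cx g gx u₀ u₀' t x| ≤ 3 * (L + 1) :=
  h.abs_lagD_le ht _

theorem transport_zero (h : TransportData c cx g gx u₀ u₀' A τ L b₀ b₁ B) :
    transport c g u₀ 0 = u₀ := by
  ext x
  simp [transport, lagU, damp, flow_self h.fieldc]

/-- Lipschitz dependence on time of the Lagrangian solution and its derivative in `H¹`. -/
theorem exists_energy_sub (h : TransportData c cx g gx u₀ u₀' A τ L b₀ b₁ B) :
    ∃ C, 0 ≤ C ∧ ∀ s t, |s| ≤ τ → |t| ≤ τ →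
      (∀ a, |lagU c g u₀ t a - lagU c g u₀ s a| ≤ C * |t - s| * |u₀ a|) ∧
      EnergyLE (fun a => lagU c g u₀ t a - lagU c g u₀ s a) (|t - s| * C) ∧
      EnergyLE (fun a => lagD c cx g gx u₀ u₀' t a - lagD c cx g gx u₀ u₀' s a) (|t - s| * C) := by
  have hA := h.fieldc.nonneg
  have hB := h.B_nonneg
  have hτ := h.τ_nonneg
  have hL := h.L_nonneg
  have hb₀ := h.energy₀.1
  have hb₁ := h.energy₁.1
  set C₁ := A * (2 * b₀ + 4 * τ * B) + 2 * (2 * B) with hC₁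
  set C₂ := (2 * (2 * B) + A * (2 * b₀ + 4 * τ * B)) +
    ((A + A) * (3 * (b₀ + b₁) + 30 * (L + 1) * τ * B) + 3 * (L + 1) * (2 * B + 2 * B)) with hC₂
  have hC₁0 : 0 ≤ C₁ := by positivity
  have hC₂0 : 0 ≤ C₂ := by positivity
  have hmem : ∀ {s t r : ℝ}, |s| ≤ τ → |t| ≤ τ → r ∈ Set.uIcc s t → |r| ≤ τ := by
    intro s t r hs ht hr
    rw [abs_le] at hs ht ⊢
    rcases Set.mem_uIcc.1 hr with hr | hr <;> constructor <;> linarith [hr.1, hr.2]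
  have hflow : ∀ a, Continuous (flow c 0 a) := fun a => (isTraj_flow h.fieldc 0 a).continuous
  have hgc : ∀ a, Continuous fun r => g r (flow c 0 a r) := fun a =>
    h.fieldg.continuous_comp continuous_id (hflow a)
  have hgxc : ∀ a, Continuous fun r => gx r (flow c 0 a r) := fun a =>
    h.fieldg.continuous_compx continuous_id (hflow a)
  have hcxc : ∀ a, Continuous fun r => cx r (flow c 0 a r) := fun a =>
    h.fieldc.continuous_compx continuous_id (hflow a)
  have hUc : ∀ a, Continuous fun r => lagU c g u₀ r a := fun a =>
    h.continuous_lagU.comp (continuous_id.prodMk continuous_const)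
  have hDc : ∀ a, Continuous fun r => lagD c cx g gx u₀ u₀' r a := fun a =>
    h.continuous_lagD.comp (continuous_id.prodMk continuous_const)
  have hUi : ∀ s t a, lagU c g u₀ t a - lagU c g u₀ s a
      = ∫ r in s..t, -(g r (flow c 0 a r) * lagU c g u₀ r a) := fun s t a =>
    (intervalIntegral.integral_eq_sub_of_hasDerivAt (fun r _ => h.hasDerivAt_lagU_left r a)
      (((hgc a).mul (hUc a)).neg.intervalIntegrable _ _)).symm
  have hDcont : ∀ a, Continuous fun r => -(lagU c g u₀ r a * gx r (flow c 0 a r)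
        + (g r (flow c 0 a r) + cx r (flow c 0 a r)) * lagD c cx g gx u₀ u₀' r a) := fun a =>
    (((hUc a).mul (hgxc a)).add (((hgc a).add (hcxc a)).mul (hDc a))).neg
  have hDi : ∀ s t a, lagD c cx g gx u₀ u₀' t a - lagD c cx g gx u₀ u₀' s a
      = ∫ r in s..t, -(lagU c g u₀ r a * gx r (flow c 0 a r)
        + (g r (flow c 0 a r) + cx r (flow c 0 a r)) * lagD c cx g gx u₀ u₀' r a) := fun s t a =>
    (intervalIntegral.integral_eq_sub_of_hasDerivAt (fun r _ => h.hasDerivAt_lagD_left r a)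
      ((hDcont a).intervalIntegrable _ _)).symm
  refine ⟨A * 2 + C₁ + C₂, by positivity, fun s t hs ht => ⟨fun a => ?_, ?_, ?_⟩⟩
  · rw [hUi]
    have := intervalIntegral.norm_integral_le_of_norm_le_const (a := s) (b := t)
      (f := fun r => -(g r (flow c 0 a r) * lagU c g u₀ r a)) (C := A * (2 * |u₀ a|)) fun r hr => by
        rw [norm_neg, Real.norm_eq_abs, abs_mul]
        gcongr
        · exact h.fieldg.bound _ _
        · exact h.abs_lagU_le' (hmem hs ht (Set.uIoc_subset_uIcc hr)) a
    calc _ ≤ A * (2 * |u₀ a|) * |t - s| := this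
      _ = (A * 2 + 0 + 0) * |t - s| * |u₀ a| := by ring
      _ ≤ _ := by gcongr
  · simp_rw [hUi]
    refine (EnergyLE.intervalIntegral (B := C₁) (fun r hr => ?_) fun a => ?_).mono ?_
    · have hr' := hmem hs ht hr
      exact ((h.energy_comp_flow (h.energyg r) (s := 0) (t := r) (by rwa [sub_zero])).mul
        (h.energy_lagU hr') (fun x => h.fieldg.bound _ _) (h.abs_lagU_le hr')).neg
    · exact ((hgc a).mul (hUc a)).neg
    · gcongr; linarith [mul_nonneg hA zero_le_two]
  · simp_rw [hDi]
    refine (EnergyLE.intervalIntegral (B := C₂) (fun r hr => ?_) hDcont).mono ?_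
    · have hr' := hmem hs ht hr
      have hr0 : |r - 0| ≤ τ := by rwa [sub_zero]
      refine (((h.energy_lagU hr').mul (h.energy_comp_flow (h.energygx r) hr0)
        (h.abs_lagU_le hr') (fun x => h.fieldg.boundx _ _)).add
        (((h.energy_comp_flow (h.energyg r) hr0).add (h.energy_comp_flow (h.energyc r) hr0)).mul
          (h.energy_lagD hr') (fun x => (abs_add_le _ _).trans (add_le_add
            (h.fieldg.bound _ _) (h.fieldc.boundx _ _))) (h.abs_lagD_le hr'))).neg
    · gcongr; linarith [mul_nonneg hA zero_le_two]

end TransportData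

end


/-! ### `H²` regularity and strong continuity in time of transported functions. -/

namespace IsH2With

variable {f f₂ : ℝ → ℝ}

theorem hasDerivAt (h : IsH2With f f₂) (x : ℝ) : HasDerivAt f (deriv f x) x :=
  (h.contDiff.differentiable (by norm_num) x).hasDerivAt

theorem continuous (h : IsH2With f f₂) : Continuous f := h.contDiff.continuous

theorem continuous_deriv (h : IsH2With f f₂) : Continuous (deriv f) :=
  h.contDiff.continuous_deriv le_rfl

theorem sub_eq (h : IsH2With f f₂) (x y : ℝ) : f y - f x = ∫ r in x..y, deriv f r :=
  (intervalIntegral.integral_eq_sub_of_hasDerivAt (fun r _ => h.hasDerivAt r)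
    (h.continuous_deriv.intervalIntegrable _ _)).symm

theorem deriv_sub_eq (h : IsH2With f f₂) (x y : ℝ) :
    deriv f y - deriv f x = ∫ r in x..y, f₂ r :=
  sub_eq_integral_of_isWeakDeriv h.continuous_deriv
    (h.memLp_second.locallyIntegrable (by norm_num)) h.isWeakDeriv x y

theorem exists_energy (h : IsH2With f f₂) : ∃ b₀ b₁, EnergyLE f b₀ ∧ EnergyLE (deriv f) b₁ :=
  ⟨_, _, energyLE_of_primitive h.memLp_deriv h.sub_eq,
    energyLE_of_primitive h.memLp_second h.deriv_sub_eq⟩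

theorem second_ae_eq (h : IsH2With f f₂) : f₂ =ᵐ[volume] deriv (deriv f) := by
  filter_upwards [_root_.LocallyIntegrable.ae_hasDerivAt_integral
    (h.memLp_second.locallyIntegrable (by norm_num))] with x hx
  have h1 : deriv f = fun x => deriv f 0 + ∫ r in (0 : ℝ)..x, f₂ r := by
    ext y
    rw [← h.deriv_sub_eq]
    ring
  have := (hx 0).const_add (deriv f 0)
  rw [← h1] at this
  exact this.deriv.symm

/-- Taking `deriv (deriv f)` as representative removes the choice of a second weak derivative from
all later statements. -/
theorem canonical (h : IsH2With f f₂) : IsH2With f (deriv (deriv f)) := by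
  refine ⟨h.contDiff, h.memLp, h.memLp_deriv, h.memLp_second.ae_eq h.second_ae_eq, ?_⟩
  obtain ⟨_, _, _, h1⟩ := h.exists_energy
  exact h1.isWeakDeriv

theorem tendsto_zero (h : IsH2With f f₂) : Tendsto f (cocompact ℝ) (𝓝 0) :=
  tendsto_zero_of_primitive h.memLp h.memLp_deriv h.sub_eq

theorem deriv_tendsto_zero (h : IsH2With f f₂) : Tendsto (deriv f) (cocompact ℝ) (𝓝 0) :=
  tendsto_zero_of_primitive h.memLp_deriv h.memLp_second h.deriv_sub_eq

theorem abs_deriv_le (h : IsH2With f f₂) (x : ℝ) :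
    |deriv f x| ≤ 2 * ((eLpNorm (deriv f) 2 volume).toReal + (eLpNorm f₂ 2 volume).toReal) :=
  abs_le_of_primitive h.memLp_deriv h.memLp_second h.deriv_sub_eq x

theorem of_energy {f f' : ℝ → ℝ} {b₀ b₁ : ℝ} (hf : ∀ x, HasDerivAt f (f' x) x)
    (h2 : MemLp f 2) (h₀ : EnergyLE f b₀) (h₁ : EnergyLE f' b₁) :
    IsH2With f (deriv (deriv f)) := by
  have hd : deriv f = f' := funext fun x => (hf x).deriv
  refine ⟨?_, h2, h₀.memLp_deriv, ?_, ?_⟩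
  · rw [contDiff_one_iff_deriv]
    exact ⟨fun x => (hf x).differentiableAt, hd ▸ h₁.continuous⟩
  · rw [hd]; exact h₁.memLp_deriv
  · rw [hd]; exact h₁.isWeakDeriv

end IsH2With

section

variable {c cx g gx : ℝ → ℝ → ℝ} {u₀ u₀' : ℝ → ℝ} {A τ L b₀ b₁ B : ℝ}

namespace TransportData

/-- A preimage under the inverse flow is an image under the forward flow, a 2-Lipschitz map, which
at most doubles one-dimensional Hausdorff measure, that is Lebesgue measure. The pushforward measure
is thus at most twice Lebesgue measure. -/
theorem eLpNorm_comp_inv_le (h : TransportData c cx g gx u₀ u₀' A τ L b₀ b₁ B) {t : ℝ}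
    (ht : |t| ≤ τ) {f : ℝ → ℝ} (hf : Measurable f) :
    eLpNorm (fun x => f (flow c t x 0)) 2 volume ≤ 2 * eLpNorm f 2 volume := by
  have hYc : Continuous fun x => flow c t x 0 :=
    h.fieldc.continuous_flow_comp continuous_const continuous_id continuous_const
  have hmap : volume.map (fun x => flow c t x 0) ≤ (2 : ENNReal) • (volume : Measure ℝ) := by
    refine Measure.le_iff.2 fun s hs => ?_
    rw [Measure.map_apply hYc.measurable hs]
    have him : (fun x => flow c t x 0) ⁻¹' s = (fun a => flow c 0 a t) '' s := by
      ext x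
      constructor
      · intro hx
        exact ⟨_, hx, by simp only [flow_flow h.fieldc, flow_self h.fieldc]⟩
      · rintro ⟨a, ha, rfl⟩
        simpa only [Set.mem_preimage, flow_flow h.fieldc, flow_self h.fieldc] using ha
    rw [him]
    have hlip : LipschitzWith 2 fun a => flow c 0 a t := LipschitzWith.of_dist_le_mul fun x y => by
      rw [Real.dist_eq, Real.dist_eq]
      refine (abs_flow_sub_le h.fieldc 0 t y x).trans ?_
      gcongr
      exact h.exp_mul_le_two (by rwa [sub_zero])
    have := hlip.hausdorffMeasure_image_le zero_le_one s
    rw [hausdorffMeasure_real] at this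
    simpa using this
  calc _ = eLpNorm f 2 (volume.map fun x => flow c t x 0) :=
        (eLpNorm_map_measure hf.aestronglyMeasurable hYc.aemeasurable).symm
    _ ≤ eLpNorm f 2 ((2 : ENNReal) • (volume : Measure ℝ)) := eLpNorm_mono_measure _ hmap
    _ = (2 : ENNReal) ^ (1 / 2 : ℝ) * eLpNorm f 2 volume := by
        rw [eLpNorm_smul_measure_of_ne_zero (by norm_num)]
        simp
    _ ≤ 2 * eLpNorm f 2 volume := by
        gcongr
        calc (2 : ENNReal) ^ (1 / 2 : ℝ) ≤ 2 ^ (1 : ℝ) :=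
              ENNReal.rpow_le_rpow_of_exponent_le (by norm_num) (by norm_num)
          _ = 2 := ENNReal.rpow_one _

/-- Composition with the inverse flow is strongly continuous on `L²`. -/
theorem tendsto_eLpNorm_comp_inv (h : TransportData c cx g gx u₀ u₀' A τ L b₀ b₁ B)
    {F R : ℝ → ℝ → ℝ} (hFm : ∀ t, Measurable (F t)) (hR : Continuous (Function.uncurry R))
    (hR2 : ∀ t a, |t| ≤ τ → |R t a| ≤ 2) {s : ℝ} (hs : |s| ≤ τ) (hFs : MemLp (F s) 2)
    {l : Filter ℝ} [l.IsCountablyGenerated] (hl : l ≤ 𝓝 s) (hlτ : ∀ᶠ t in l, |t| ≤ τ)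
    (hF : Tendsto (fun t => eLpNorm (F t - F s) 2 volume) l (𝓝 0)) :
    Tendsto (fun t => eLpNorm (fun x => F t (flow c t x 0) * R t (flow c t x 0)
      - F s (flow c s x 0) * R s (flow c s x 0)) 2 volume) l (𝓝 0) := by
  have hA := h.fieldc.nonneg
  have hYm : ∀ t, Measurable fun x => flow c t x 0 := fun t =>
    (h.fieldc.continuous_flow_comp continuous_const continuous_id continuous_const).measurable
  have hRm : ∀ t, Measurable (R t) := fun t =>
    (hR.comp (continuous_const.prodMk continuous_id)).measurable
  have hmulR : ∀ t, |t| ≤ τ → ∀ f : ℝ → ℝ, Measurable f →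
      eLpNorm (fun x => f (flow c t x 0) * R t (flow c t x 0)) 2 volume
        ≤ 4 * eLpNorm f 2 volume := by
    intro t ht f hf
    refine (h.eLpNorm_comp_inv_le ht (f := fun a => f a * R t a) (hf.mul (hRm t))).trans ?_
    have h1 : eLpNorm (fun a => f a * R t a) 2 volume ≤ ENNReal.ofReal 2 * eLpNorm f 2 volume := by
      refine eLpNorm_le_mul_eLpNorm_of_ae_le_mul (Eventually.of_forall fun a => ?_) 2
      rw [Real.norm_eq_abs, Real.norm_eq_abs, abs_mul, mul_comm]
      gcongr
      exact hR2 t a ht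
    calc _ ≤ 2 * (ENNReal.ofReal 2 * eLpNorm f 2 volume) := by gcongr
      _ = 4 * eLpNorm f 2 volume := by
        rw [← mul_assoc]
        congr 1
        rw [ENNReal.ofReal_ofNat]
        norm_num
  rw [ENNReal.tendsto_nhds_zero]
  intro ε hε
  obtain ⟨δ, hδ0, hδ⟩ : ∃ δ : ENNReal, δ ≠ 0 ∧ 16 * δ ≤ ε := by
    refine ⟨ε / 16, (ENNReal.div_pos hε.ne' (by norm_num)).ne', ?_⟩
    rw [ENNReal.mul_div_cancel (by norm_num) (by norm_num)]
  -- Replace `F s` by a continuous function with compact support. Each replacement costs at most `4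
  -- * δ`, since composition followed by multiplication by `R` is bounded on `L²` uniformly in time.
  -- For `φ` itself dominated convergence applies: its support moves by at most `A * τ`. The errors
  -- add up to `13 * δ`.
  obtain ⟨φ, hφc, hφle, hφcont, -⟩ := hFs.exists_hasCompactSupport_eLpNorm_sub_le (by simp) hδ0
  obtain ⟨K, hK0, hK⟩ := exists_support_bound hφc
  obtain ⟨M, hM⟩ := hφc.exists_bound_of_continuous hφcont
  set k : ℝ → ℝ → ℝ := fun t x => φ (flow c t x 0) * R t (flow c t x 0)
      - φ (flow c s x 0) * R s (flow c s x 0) with hk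
  have hkc : ∀ x, Continuous fun t => k t x := fun x => by
    have h1 : Continuous fun t => flow c t x 0 :=
      h.fieldc.continuous_flow_comp continuous_id continuous_const continuous_const
    have h2 : Continuous fun t => R t (flow c t x 0) := hR.comp (continuous_id.prodMk h1)
    exact ((hφcont.comp h1).mul h2).sub continuous_const
  have hkm : ∀ t, Measurable (k t) := fun t =>
    ((hφcont.measurable.comp (hYm t)).mul ((hRm t).comp (hYm t))).sub
      ((hφcont.measurable.comp (hYm s)).mul ((hRm s).comp (hYm s)))
  have hM0 : 0 ≤ M := (norm_nonneg _).trans (hM 0)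
  have hkb : ∀ t, |t| ≤ τ → ∀ x, |φ (flow c t x 0) * R t (flow c t x 0)| ≤
      (Set.Icc (-(K + A * τ)) (K + A * τ)).indicator (fun _ => M * 2) x := by
    intro t ht x
    by_cases hx : x ∈ Set.Icc (-(K + A * τ)) (K + A * τ)
    · rw [Set.indicator_of_mem hx, abs_mul]
      gcongr
      · exact hM _
      · exact hR2 _ _ ht
    · rw [Set.indicator_of_notMem hx, hK, zero_mul, abs_zero]
      have h1 := (isTraj_flow h.fieldc t x).abs_sub_le h.fieldc t 0
      rw [flow_self h.fieldc, zero_sub, abs_neg] at h1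
      have h2 : A * |t| ≤ A * τ := by gcongr
      have h3 : K + A * τ < |x| := by
        by_contra hcon
        exact hx (abs_le.1 (not_lt.1 hcon))
      have h4 := abs_sub_abs_le_abs_sub x (flow c t x 0)
      rw [abs_sub_comm] at h4
      linarith [abs_sub_comm x (flow c t x 0)]
  have hklim : Tendsto (fun t => eLpNorm (k t) 2 volume) l (𝓝 0) := by
    have h0 : Tendsto (fun t => ∫⁻ x, ‖k t x‖ₑ ^ 2) l (𝓝 (∫⁻ _ : ℝ, 0)) := by
      refine tendsto_lintegral_filter_of_dominated_convergence
        (fun x => (Set.Icc (-(K + A * τ)) (K + A * τ)).indicator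
          (fun _ => ENNReal.ofReal ((M * 4) ^ 2)) x)
        (Eventually.of_forall fun t => ((hkm t).enorm.pow_const 2)) ?_ ?_ ?_
      · filter_upwards [hlτ] with t ht
        refine Eventually.of_forall fun x => ?_
        have h1 := hkb t ht x
        have h2 := hkb s hs x
        have h3 : |k t x| ≤ _ := (abs_sub _ _).trans (add_le_add h1 h2)
        by_cases hx : x ∈ Set.Icc (-(K + A * τ)) (K + A * τ)
        · rw [Set.indicator_of_mem hx] at h3 ⊢
          rw [Real.enorm_eq_ofReal_abs, ← ENNReal.ofReal_pow (abs_nonneg _)]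
          apply ENNReal.ofReal_le_ofReal
          gcongr
          linarith
        · rw [Set.indicator_of_notMem hx] at h3 ⊢
          have : k t x = 0 := abs_eq_zero.1 (le_antisymm (by simpa using h3) (abs_nonneg _))
          simp [this]
      · rw [lintegral_indicator measurableSet_Icc]
        simp [ENNReal.mul_eq_top]
      · refine Eventually.of_forall fun x => ?_
        have h1 : Tendsto (fun t => k t x) l (𝓝 0) := by
          have := ((hkc x).tendsto s).mono_left hl
          simpa [hk] using this
        have h2 := ((ENNReal.continuous_pow 2).tendsto _).comp h1.enorm
        simpa using! h2
    have h1 : ∀ t, eLpNorm (k t) 2 volume = (∫⁻ x, ‖k t x‖ₑ ^ 2) ^ (1 / 2 : ℝ) := fun t => by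
      rw [eLpNorm_eq_lintegral_rpow_enorm_toReal (by simp) (by simp)]
      simp
    simp_rw [h1]
    have h2 := h0.ennrpow_const (1 / 2)
    simpa using h2
  have hF' := (ENNReal.tendsto_nhds_zero.1 hF) δ (pos_iff_ne_zero.2 hδ0)
  have hk' := (ENNReal.tendsto_nhds_zero.1 hklim) δ (pos_iff_ne_zero.2 hδ0)
  filter_upwards [hF', hk', hlτ] with t h1 h2 ht
  have hdecomp : (fun x => F t (flow c t x 0) * R t (flow c t x 0)
      - F s (flow c s x 0) * R s (flow c s x 0)) =
      ((fun x => (F t - F s) (flow c t x 0) * R t (flow c t x 0))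
        + (fun x => (F s - φ) (flow c t x 0) * R t (flow c t x 0))) +
      (k t - (fun x => (F s - φ) (flow c s x 0) * R s (flow c s x 0))) := by
    ext x
    simp only [Pi.add_apply, Pi.sub_apply, hk]
    ring
  have hm : ∀ f : ℝ → ℝ, Measurable f → ∀ t,
      AEStronglyMeasurable (fun x => f (flow c t x 0) * R t (flow c t x 0)) volume := fun f hf t =>
    ((hf.comp (hYm t)).mul ((hRm t).comp (hYm t))).aestronglyMeasurable
  have m1 := hm _ ((hFm t).sub (hFm s)) t
  have m2 := hm _ ((hFm s).sub hφcont.measurable) t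
  have m3 := hm _ ((hFm s).sub hφcont.measurable) s
  have m4 : AEStronglyMeasurable (k t) volume := (hkm t).aestronglyMeasurable
  rw [hdecomp]
  calc _ ≤ (4 * δ + 4 * δ) + (δ + 4 * δ) := by
        refine (eLpNorm_add_le (m1.add m2) (m4.sub m3) one_le_two).trans (add_le_add ?_ ?_)
        · refine (eLpNorm_add_le m1 m2 one_le_two).trans (add_le_add ?_ ?_)
          · exact (hmulR t ht _ ((hFm t).sub (hFm s))).trans (by gcongr)
          · exact (hmulR t ht _ ((hFm s).sub hφcont.measurable)).trans (by gcongr)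
        · refine (eLpNorm_sub_le m4 m3 one_le_two).trans (add_le_add h2 ?_)
          exact (hmulR s hs _ ((hFm s).sub hφcont.measurable)).trans (by gcongr)
    _ = 13 * δ := by ring
    _ ≤ 16 * δ := by gcongr; norm_num
    _ ≤ ε := hδ

theorem measurable_lagU (h : TransportData c cx g gx u₀ u₀' A τ L b₀ b₁ B) (t : ℝ) :
    Measurable (lagU c g u₀ t) :=
  (h.continuous_lagU.comp (continuous_const.prodMk continuous_id)).measurable

theorem memLp_lagU (h : TransportData c cx g gx u₀ u₀' A τ L b₀ b₁ B) (h2 : MemLp u₀ 2) {t : ℝ}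
    (ht : |t| ≤ τ) : MemLp (lagU c g u₀ t) 2 :=
  h2.of_le_mul (h.measurable_lagU t).aestronglyMeasurable
    (Eventually.of_forall fun a => h.abs_lagU_le' ht a)

theorem isH2With_transport (h : TransportData c cx g gx u₀ u₀' A τ L b₀ b₁ B)
    (h2 : MemLp u₀ 2) {t : ℝ} (ht : |t| ≤ τ) :
    IsH2With (transport c g u₀ t) (deriv (deriv (transport c g u₀ t))) := by
  refine IsH2With.of_energy (h.hasDerivAt_transport t) ?_ (h.energy_transport ht)
    (h.energy_transportDeriv ht)
  refine ⟨((h.energy_transport ht).continuous).aestronglyMeasurable, ?_⟩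
  refine (h.eLpNorm_comp_inv_le ht (h.measurable_lagU t)).trans_lt ?_
  exact ENNReal.mul_lt_top (by norm_num) (h.memLp_lagU h2 ht).2

/-- No differentiability of `f` is needed: the inverse flow is a diffeomorphism, so where `f` is not
differentiable neither is the composite, and both sides take the default value 0. -/
theorem deriv_comp_flow_inv (h : TransportData c cx g gx u₀ u₀' A τ L b₀ b₁ B) (f : ℝ → ℝ)
    (t x : ℝ) : deriv (fun x => f (flow c t x 0)) x
      = deriv f (flow c t x 0) * Real.exp (-flowLog c cx t (flow c t x 0)) := by
  by_cases hd : DifferentiableAt ℝ f (flow c t x 0)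
  · exact (hd.hasDerivAt.comp x (hasDerivAt_flow_inv h.fieldc t x)).deriv
  · rw [deriv_zero_of_not_differentiableAt hd, zero_mul, deriv_zero_of_not_differentiableAt]
    intro hd'
    apply hd
    have hx : flow c 0 (flow c t x 0) t = x := by
      rw [flow_flow h.fieldc, flow_self h.fieldc]
    have h1 : DifferentiableAt ℝ (fun x => f (flow c t x 0)) (flow c 0 (flow c t x 0) t) := by
      rwa [hx]
    have h3 := h1.comp (flow c t x 0) (hasDerivAt_flow h.fieldc t (flow c t x 0)).differentiableAt
    refine h3.congr_of_eventuallyEq (Eventually.of_forall fun a => ?_)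
    simp only [Function.comp]
    rw [flow_flow h.fieldc, flow_self h.fieldc]

theorem tendsto_of_le_ofReal {f : ℝ → ENNReal} {C s : ℝ} {l : Filter ℝ} (hl : l ≤ 𝓝 s)
    (hf : ∀ᶠ t in l, f t ≤ ENNReal.ofReal (|t - s| * C)) : Tendsto f l (𝓝 0) := by
  refine tendsto_of_tendsto_of_tendsto_of_le_of_le' tendsto_const_nhds ?_
    (Eventually.of_forall fun _ => zero_le) hf
  have : Continuous fun t => ENNReal.ofReal (|t - s| * C) :=
    ENNReal.continuous_ofReal.comp (by fun_prop)
  have := (this.tendsto s).mono_left hl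
  simpa using this

/-- The solution of the transport equation is continuous in time with values in `H²`. -/
theorem tendsto_H2 (h : TransportData c cx g gx u₀ u₀' A τ L b₀ b₁ B)
    (h2 : MemLp u₀ 2) {s : ℝ} (hs : |s| ≤ τ) {l : Filter ℝ} [l.IsCountablyGenerated]
    (hl : l ≤ 𝓝 s) (hlτ : ∀ᶠ t in l, |t| ≤ τ) :
    Tendsto (fun t => eLpNorm (transport c g u₀ t - transport c g u₀ s) 2 volume) l (𝓝 0) ∧
    Tendsto (fun t => eLpNorm (deriv (transport c g u₀ t) - deriv (transport c g u₀ s)) 2 volume)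
      l (𝓝 0) ∧
    Tendsto (fun t => eLpNorm (deriv (deriv (transport c g u₀ t))
      - deriv (deriv (transport c g u₀ s))) 2 volume) l (𝓝 0) := by
  obtain ⟨C, hC0, hC⟩ := h.exists_energy_sub
  have hRexp : Continuous (Function.uncurry fun t a => Real.exp (-flowLog c cx t a)) :=
    Real.continuous_exp.comp (continuous_flowLog h.fieldc).neg
  have hRb : ∀ t a, |t| ≤ τ → |Real.exp (-flowLog c cx t a)| ≤ 2 := fun t a ht =>
    h.exp_neg_flowLog_le ht a
  have hderiv : ∀ t, deriv (transport c g u₀ t)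
      = fun x => lagD c cx g gx u₀ u₀' t (flow c t x 0) := fun t =>
    funext fun x => (h.hasDerivAt_transport t x).deriv
  refine ⟨?_, ?_, ?_⟩
  · have := h.tendsto_eLpNorm_comp_inv (F := lagU c g u₀) (R := fun _ _ => 1) h.measurable_lagU
      continuous_const (fun _ _ _ => by norm_num) hs (h.memLp_lagU h2 hs) hl hlτ ?_
    · simp only [mul_one] at this
      exact this
    · refine tendsto_of_le_ofReal (C := C * (eLpNorm u₀ 2 volume).toReal) hl ?_
      filter_upwards [hlτ] with t ht
      have h1 : eLpNorm (lagU c g u₀ t - lagU c g u₀ s) 2 volume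
          ≤ ENNReal.ofReal (C * |t - s|) * eLpNorm u₀ 2 volume :=
        eLpNorm_le_mul_eLpNorm_of_ae_le_mul
          (Eventually.of_forall fun a => (hC s t hs ht).1 a) 2
      refine h1.trans (le_of_eq ?_)
      rw [← ENNReal.ofReal_toReal h2.2.ne, ← ENNReal.ofReal_mul (by positivity),
        ENNReal.toReal_ofReal ENNReal.toReal_nonneg]
      congr 1
      ring
  · have := h.tendsto_eLpNorm_comp_inv (F := fun t => deriv (lagU c g u₀ t))
      (fun t => measurable_deriv _) hRexp hRb hs (h.energy_lagU hs).memLp_deriv hl hlτ ?_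
    · refine this.congr fun t => ?_
      congr 1
      ext x
      simp only [Pi.sub_apply]
      rw [← h.deriv_comp_flow_inv, ← h.deriv_comp_flow_inv]
      rfl
    · refine tendsto_of_le_ofReal (C := C) hl ?_
      filter_upwards [hlτ] with t ht
      have h1 : deriv (lagU c g u₀ t) - deriv (lagU c g u₀ s)
          = deriv (fun a => lagU c g u₀ t a - lagU c g u₀ s a) := funext fun a =>
        ((h.hasDerivAt_lagU t a).differentiableAt.hasDerivAt.sub
          (h.hasDerivAt_lagU s a).differentiableAt.hasDerivAt).deriv.symm
      rw [h1]
      exact (hC s t hs ht).2.1.eLpNorm_deriv_le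
  · have := h.tendsto_eLpNorm_comp_inv (F := fun t => deriv (lagD c cx g gx u₀ u₀' t))
      (fun t => measurable_deriv _) hRexp hRb hs (h.energy_lagD hs).memLp_deriv hl hlτ ?_
    · refine this.congr fun t => ?_
      congr 1
      ext x
      simp only [Pi.sub_apply, hderiv]
      rw [← h.deriv_comp_flow_inv, ← h.deriv_comp_flow_inv]
    · refine tendsto_of_le_ofReal (C := C) hl ?_
      filter_upwards [hlτ] with t ht
      -- Unlike `lagU`, the function `lagD` is differentiable only almost everywhere, so this
      -- identity holds only almost everywhere.
      have h1 : deriv (lagD c cx g gx u₀ u₀' t) - deriv (lagD c cx g gx u₀ u₀' s) =ᵐ[volume]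
          deriv (fun a => lagD c cx g gx u₀ u₀' t a - lagD c cx g gx u₀ u₀' s a) := by
        filter_upwards [(h.energy_lagD ht).ae_differentiableAt,
          (h.energy_lagD hs).ae_differentiableAt] with a ha1 ha2
        exact (ha1.hasDerivAt.sub ha2.hasDerivAt).deriv.symm
      rw [eLpNorm_congr_ae h1]
      exact (hC s t hs ht).2.2.eLpNorm_deriv_le

end TransportData

end


/-! ### The nonlocal coefficients: derivatives, bounds and continuity. -/

/-- The factor `e^{-ū + ũ}`. -/
def expo (γa γb : ℝ) (f : ℝ → ℝ) (x : ℝ) : ℝ :=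
  Real.exp (-lookAhead γa f x + lookBehind γb f x)

/-- The derivative of the exponent `-ū + ũ`. -/
def gap (γa γb : ℝ) (f : ℝ → ℝ) (x : ℝ) : ℝ :=
  (f x - f (x + γa)) / γa + (f x - f (x - γb)) / γb

/-- The characteristic speed. -/
def vel (γa γb : ℝ) (f : ℝ → ℝ) (x : ℝ) : ℝ := (1 - 2 * f x) * expo γa γb f x

/-- The derivative of the characteristic speed, where `f'` is the derivative of `f`. -/
def velDeriv (γa γb : ℝ) (f f' : ℝ → ℝ) (x : ℝ) : ℝ :=
  -2 * (f' x * expo γa γb f x) + (1 - 2 * f x) * (expo γa γb f x * gap γa γb f x)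

/-- The damping rate along characteristics. -/
def rate (γa γb : ℝ) (f : ℝ → ℝ) (x : ℝ) : ℝ := (1 - f x) * (expo γa γb f x * gap γa γb f x)

/-- The derivative of the damping rate, where `f'` is the derivative of `f`. -/
def rateDeriv (γa γb : ℝ) (f f' : ℝ → ℝ) (x : ℝ) : ℝ :=
  -(f' x * (expo γa γb f x * gap γa γb f x)) + rate γa γb f x * gap γa γb f x
    + (1 - f x) * expo γa γb f x * gap γa γb f' x

section

variable {γa γb : ℝ}

/-- A fixed interval of integration turns the average into an integral of translates, to which the
energy estimate for integrals and continuity in parameters apply. -/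
theorem lookAhead_eq (ha : 0 < γa) (f : ℝ → ℝ) (x : ℝ) :
    lookAhead γa f x = ∫ r in (0 : ℝ)..1, f (x + r * γa) := by
  have := intervalIntegral.integral_comp_mul_add (a := 0) (b := 1) (c := γa) f ha.ne' x
  rw [lookAhead, one_div]
  simp only [mul_zero, zero_add, mul_one, smul_eq_mul] at this
  rw [add_comm x γa, ← this]
  congr 1; ext r; ring_nf

theorem lookBehind_eq (hb : 0 < γb) (f : ℝ → ℝ) (x : ℝ) :
    lookBehind γb f x = ∫ r in (0 : ℝ)..1, f (x - γb + r * γb) := by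
  have := intervalIntegral.integral_comp_mul_add (a := 0) (b := 1) (c := γb) f hb.ne' (x - γb)
  rw [lookBehind, one_div]
  simp only [mul_zero, zero_add, mul_one, smul_eq_mul, add_sub_cancel] at this
  rw [← this]
  congr 1; ext r; ring_nf

theorem hasDerivAt_lookAhead {f : ℝ → ℝ} (hf : Continuous f) (x : ℝ) :
    HasDerivAt (lookAhead γa f) ((f (x + γa) - f x) / γa) x := by
  have hF : ∀ x, HasDerivAt (fun x => ∫ r in (0 : ℝ)..x, f r) (f x) x := fun x =>
    intervalIntegral.integral_hasDerivAt_right (hf.intervalIntegrable _ _)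
      (hf.stronglyMeasurableAtFilter _ _) hf.continuousAt
  have h1 := (((hF (x + γa)).comp_add_const x γa).sub (hF x)).const_mul (1 / γa)
  refine (HasDerivAt.congr_deriv h1 (by ring)).congr_of_eventuallyEq
    (Eventually.of_forall fun y => ?_)
  simp only [lookAhead, Pi.sub_apply]
  rw [intervalIntegral.integral_interval_sub_left (hf.intervalIntegrable _ _)
    (hf.intervalIntegrable _ _)]

theorem hasDerivAt_lookBehind {f : ℝ → ℝ} (hf : Continuous f) (x : ℝ) :
    HasDerivAt (lookBehind γb f) ((f x - f (x - γb)) / γb) x := by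
  have hF : ∀ x, HasDerivAt (fun x => ∫ r in (0 : ℝ)..x, f r) (f x) x := fun x =>
    intervalIntegral.integral_hasDerivAt_right (hf.intervalIntegrable _ _)
      (hf.stronglyMeasurableAtFilter _ _) hf.continuousAt
  have h1 := ((hF x).sub ((hF (x - γb)).comp_sub_const x γb)).const_mul (1 / γb)
  refine (HasDerivAt.congr_deriv h1 (by ring)).congr_of_eventuallyEq
    (Eventually.of_forall fun y => ?_)
  simp only [lookBehind, Pi.sub_apply]
  rw [intervalIntegral.integral_interval_sub_left (hf.intervalIntegrable _ _)
    (hf.intervalIntegrable _ _)]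

theorem hasDerivAt_expo {f : ℝ → ℝ} (hf : Continuous f) (x : ℝ) :
    HasDerivAt (expo γa γb f) (expo γa γb f x * gap γa γb f x) x := by
  refine HasDerivAt.congr_deriv
    ((hasDerivAt_lookAhead hf x).neg.add (hasDerivAt_lookBehind hf x)).exp ?_
  simp only [expo, gap, Pi.add_apply, Pi.neg_apply]
  ring

theorem hasDerivAt_gap {f f' : ℝ → ℝ} (hf : ∀ x, HasDerivAt f (f' x) x) (x : ℝ) :
    HasDerivAt (gap γa γb f) (gap γa γb f' x) x :=
  (((hf x).sub ((hf (x + γa)).comp_add_const x γa)).div_const γa).add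
    (((hf x).sub ((hf (x - γb)).comp_sub_const x γb)).div_const γb)

theorem continuous_of_hasDerivAt {f f' : ℝ → ℝ} (hf : ∀ x, HasDerivAt f (f' x) x) :
    Continuous f := continuous_iff_continuousAt.2 fun x => (hf x).continuousAt

theorem hasDerivAt_vel {f f' : ℝ → ℝ} (hf : ∀ x, HasDerivAt f (f' x) x) (x : ℝ) :
    HasDerivAt (vel γa γb f) (velDeriv γa γb f f' x) x := by
  refine HasDerivAt.congr_deriv ((((hf x).const_mul 2).const_sub 1).mul
    (hasDerivAt_expo (continuous_of_hasDerivAt hf) x)) ?_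
  simp only [velDeriv]
  ring

theorem hasDerivAt_rate {f f' : ℝ → ℝ} (hf : ∀ x, HasDerivAt f (f' x) x) (x : ℝ) :
    HasDerivAt (rate γa γb f) (rateDeriv γa γb f f' x) x := by
  refine HasDerivAt.congr_deriv (((hf x).const_sub 1).mul
    ((hasDerivAt_expo (continuous_of_hasDerivAt hf) x).mul (hasDerivAt_gap hf x))) ?_
  simp only [rateDeriv, rate]
  ring

/-- This is the nonconservative form of the equation, a transport equation with speed `vel` and
damping `rate` once the coefficients are frozen. -/
theorem hasDerivAt_flux {f f' : ℝ → ℝ} (hf : ∀ x, HasDerivAt f (f' x) x) (x : ℝ) :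
    HasDerivAt (flux γa γb f) (vel γa γb f x * f' x + rate γa γb f x * f x) x := by
  refine HasDerivAt.congr_deriv (((hf x).mul ((hf x).const_sub 1)).mul
    (hasDerivAt_expo (continuous_of_hasDerivAt hf) x)) ?_
  simp only [vel, rate, expo, Pi.mul_apply]
  ring

theorem abs_lookAhead_le (ha : 0 < γa) {f : ℝ → ℝ} {C : ℝ} (hf : ∀ x, |f x| ≤ C) (x : ℝ) :
    |lookAhead γa f x| ≤ C := by
  rw [lookAhead_eq ha]
  simpa using intervalIntegral.norm_integral_le_of_norm_le_const (a := 0) (b := 1)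
    (f := fun r => f (x + r * γa)) (C := C) fun _ _ => hf _

theorem abs_lookBehind_le (hb : 0 < γb) {f : ℝ → ℝ} {C : ℝ} (hf : ∀ x, |f x| ≤ C) (x : ℝ) :
    |lookBehind γb f x| ≤ C := by
  rw [lookBehind_eq hb]
  simpa using intervalIntegral.norm_integral_le_of_norm_le_const (a := 0) (b := 1)
    (f := fun r => f (x - γb + r * γb)) (C := C) fun _ _ => hf _

theorem lookAhead_sub {f h : ℝ → ℝ} (hf : Continuous f) (hh : Continuous h) (x : ℝ) :
    lookAhead γa f x - lookAhead γa h x = lookAhead γa (fun y => f y - h y) x := by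
  simp only [lookAhead]
  rw [intervalIntegral.integral_sub (hf.intervalIntegrable _ _) (hh.intervalIntegrable _ _)]
  ring

theorem lookBehind_sub {f h : ℝ → ℝ} (hf : Continuous f) (hh : Continuous h) (x : ℝ) :
    lookBehind γb f x - lookBehind γb h x = lookBehind γb (fun y => f y - h y) x := by
  simp only [lookBehind]
  rw [intervalIntegral.integral_sub (hf.intervalIntegrable _ _) (hh.intervalIntegrable _ _)]
  ring

theorem exponent_le (ha : 0 < γa) (hb : 0 < γb) {f : ℝ → ℝ} (hf : ∀ x, |f x| ≤ 2) (x : ℝ) :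
    -lookAhead γa f x + lookBehind γb f x ≤ 4 := by
  have h1 := (neg_le_abs _).trans (abs_lookAhead_le ha hf x)
  have h2 := (le_abs_self _).trans (abs_lookBehind_le hb hf x)
  linarith

theorem abs_expo_le (ha : 0 < γa) (hb : 0 < γb) {f : ℝ → ℝ} (hf : ∀ x, |f x| ≤ 2) (x : ℝ) :
    |expo γa γb f x| ≤ Real.exp 4 := by
  rw [expo, Real.abs_exp]
  exact Real.exp_le_exp.2 (exponent_le ha hb hf x)

theorem abs_gap_le (ha : 0 < γa) (hb : 0 < γb) {f : ℝ → ℝ} {C : ℝ} (hf : ∀ x, |f x| ≤ C)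
    (x : ℝ) : |gap γa γb f x| ≤ 2 * (1 / γa + 1 / γb) * C := by
  have key : ∀ y, |f x - f y| ≤ 2 * C := fun y =>
    (abs_sub _ _).trans (by linarith [hf x, hf y])
  calc _ ≤ |f x - f (x + γa)| / γa + |f x - f (x - γb)| / γb := by
        refine (abs_add_le _ _).trans (le_of_eq ?_)
        rw [abs_div, abs_div, abs_of_pos ha, abs_of_pos hb]
    _ ≤ 2 * C / γa + 2 * C / γb := by gcongr <;> exact key _
    _ = _ := by ring

theorem abs_exp_sub_le {p q a : ℝ} (hp : p ≤ a) (hq : q ≤ a) :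
    |Real.exp p - Real.exp q| ≤ Real.exp a * |p - q| := by
  wlog hpq : q ≤ p generalizing p q
  · rw [abs_sub_comm, abs_sub_comm p]
    exact this hq hp (le_of_not_ge hpq)
  rw [abs_of_nonneg (sub_nonneg.2 (Real.exp_le_exp.2 hpq)), abs_of_nonneg (sub_nonneg.2 hpq)]
  have h1 := Real.add_one_le_exp (q - p)
  have h2 : Real.exp q = Real.exp p * Real.exp (q - p) := by rw [← Real.exp_add]; ring_nf
  have h3 : Real.exp p - Real.exp q ≤ Real.exp p * (p - q) := by
    rw [h2]; nlinarith [Real.exp_pos p]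
  exact h3.trans (mul_le_mul_of_nonneg_right (Real.exp_le_exp.2 hp) (by linarith))

theorem abs_mul_sub_mul_le {a b a' b' A B εa εb : ℝ} (ha : |a| ≤ A) (hb : |b'| ≤ B)
    (hab : |a - a'| ≤ εa) (hbb : |b - b'| ≤ εb) : |a * b - a' * b'| ≤ A * εb + B * εa := by
  have hA := (abs_nonneg _).trans ha
  have hB := (abs_nonneg _).trans hb
  calc _ = |a * (b - b') + b' * (a - a')| := by congr 1; ring
    _ ≤ |a| * |b - b'| + |b'| * |a - a'| := by
      rw [← abs_mul, ← abs_mul]; exact abs_add_le _ _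
    _ ≤ _ := by gcongr

/-- The coefficients depend Lipschitz continuously on the solution in the uniform norm. -/
theorem coeff_sub_le (ha : 0 < γa) (hb : 0 < γb) : ∃ Λ : ℝ, 0 < Λ ∧ ∀ (f h : ℝ → ℝ) (ε : ℝ),
    Continuous f → Continuous h → (∀ x, |f x| ≤ 2) → (∀ x, |h x| ≤ 2) →
    (∀ x, |f x - h x| ≤ ε) → ∀ x,
      |vel γa γb f x - vel γa γb h x| ≤ Λ * ε ∧ |rate γa γb f x - rate γa γb h x| ≤ Λ * ε := by
  set K := 1 / γa + 1 / γb with hK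
  have hK0 : 0 < K := by positivity
  set M := Real.exp 4 with hM
  have hM0 : 0 < M := Real.exp_pos 4
  refine ⟨12 * M + 34 * K * M, by positivity, fun f h ε hfc hhc hf hh hε x => ?_⟩
  have hε0 : 0 ≤ ε := (abs_nonneg _).trans (hε 0)
  have eE : |expo γa γb f x - expo γa γb h x| ≤ M * (2 * ε) := by
    refine (abs_exp_sub_le (exponent_le ha hb hf x) (exponent_le ha hb hh x)).trans ?_
    gcongr
    calc _ = |-(lookAhead γa f x - lookAhead γa h x)
          + (lookBehind γb f x - lookBehind γb h x)| := by congr 1; ring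
      _ ≤ ε + ε := by
        refine (abs_add_le _ _).trans (add_le_add ?_ ?_)
        · rw [abs_neg, lookAhead_sub hfc hhc]; exact abs_lookAhead_le ha hε x
        · rw [lookBehind_sub hfc hhc]; exact abs_lookBehind_le hb hε x
      _ = _ := by ring
  have eθ : |gap γa γb f x - gap γa γb h x| ≤ 2 * K * ε := by
    have : gap γa γb f x - gap γa γb h x = gap γa γb (fun y => f y - h y) x := by
      simp only [gap]; ring
    rw [this]
    exact abs_gap_le ha hb hε x
  have bE := abs_expo_le ha hb hh x
  have bE' := abs_expo_le ha hb hf x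
  have bθ := abs_gap_le ha hb hh x
  have e1 : |(1 - 2 * f x) - (1 - 2 * h x)| ≤ 2 * ε := by
    calc _ = |2 * (f x - h x)| := by rw [← abs_neg]; congr 1; ring
      _ = 2 * |f x - h x| := by rw [abs_mul, abs_two]
      _ ≤ _ := by gcongr; exact hε x
  have b1 : |1 - 2 * f x| ≤ 5 := by
    have := abs_le.1 (hf x); rw [abs_le]; constructor <;> linarith
  have e2 : |(1 - f x) - (1 - h x)| ≤ ε := by
    calc _ = |f x - h x| := by rw [← abs_neg]; congr 1; ring
      _ ≤ _ := hε x
  have b2 : |1 - f x| ≤ 3 := by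
    have := abs_le.1 (hf x); rw [abs_le]; constructor <;> linarith
  have eEθ := abs_mul_sub_mul_le bE' bθ eE eθ
  have bEθ : |expo γa γb h x * gap γa γb h x| ≤ M * (2 * K * 2) := by
    rw [abs_mul]; gcongr
  have h1 := abs_mul_sub_mul_le b1 bE e1 eE
  have h2 := abs_mul_sub_mul_le b2 bEθ e2 eEθ
  have hp : 0 ≤ K * M * ε := by positivity
  have hq : 0 ≤ M * ε := by positivity
  constructor
  · refine h1.trans ?_
    rw [← hM]
    nlinarith
  · refine h2.trans ?_
    nlinarith

/-- Bounds for the coefficients in terms of bounds for the solution. -/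
theorem coeff_bounds (ha : 0 < γa) (hb : 0 < γb) {L : ℝ} (hL : 0 ≤ L) :
    ∃ A C : ℝ, 0 < A ∧ 0 < C ∧ ∀ (f f' : ℝ → ℝ) (b : ℝ),
    (∀ x, |f x| ≤ 2) → (∀ x, |f' x| ≤ L) → EnergyLE f b → EnergyLE f' b →
      (∀ x, |vel γa γb f x| ≤ A ∧ |velDeriv γa γb f f' x| ≤ A ∧ |rate γa γb f x| ≤ A ∧
        |rateDeriv γa γb f f' x| ≤ A) ∧
      EnergyLE (velDeriv γa γb f f') (C * b) ∧ EnergyLE (rate γa γb f) (C * b) ∧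
      EnergyLE (rateDeriv γa γb f f') (C * b) := by
  set K := 1 / γa + 1 / γb with hK
  have hK0 : 0 < K := by positivity
  set M := Real.exp 4 with hM
  have hM0 : 0 < M := Real.exp_pos 4
  -- Crude sums of the product-rule constants. The first does not involve `b` and the second enters
  -- only as a factor of `b`, so neither makes the existence time depend on the `H²` norm.
  refine ⟨5 * M + (2 * L * M + 20 * K * M) + 12 * K * M + (10 * K * M * L + 48 * K ^ 2 * M),
    4 * M * L + 2 * M + 58 * K * M + 34 * K * M + 24 * K * M * L + 10 * K * M + 160 * K ^ 2 * M,
    by positivity, by positivity, fun f f' b hf hf' ef ef' => ?_⟩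
  have hb0 := ef.1
  have bE := abs_expo_le ha hb hf
  have bθ : ∀ x, |gap γa γb f x| ≤ 4 * K := fun x =>
    (abs_gap_le ha hb hf x).trans (le_of_eq (by ring))
  have bθ' : ∀ x, |gap γa γb f' x| ≤ 2 * K * L := abs_gap_le ha hb hf'
  have bEθ : ∀ x, |expo γa γb f x * gap γa γb f x| ≤ M * (4 * K) := fun x => by
    rw [abs_mul]; gcongr; exacts [bE x, bθ x]
  have b1 : ∀ x, |1 - 2 * f x| ≤ 5 := fun x => by
    have := abs_le.1 (hf x); rw [abs_le]; constructor <;> linarith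
  have b2 : ∀ x, |1 - f x| ≤ 3 := fun x => by
    have := abs_le.1 (hf x); rw [abs_le]; constructor <;> linarith
  have bv : ∀ x, |rate γa γb f x| ≤ 3 * (M * (4 * K)) := fun x => by
    rw [rate, abs_mul]; gcongr; exacts [b2 x, bEθ x]
  have bF : ∀ x, |(1 - f x) * expo γa γb f x| ≤ 3 * M := fun x => by
    rw [abs_mul]; gcongr; exacts [b2 x, bE x]
  have eA : EnergyLE (lookAhead γa f) b := by
    have := EnergyLE.intervalIntegral (F := fun r x => f (x + r * γa)) (s := 0) (t := 1) (B := b)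
      (fun r _ => ef.comp_add_const (r * γa)) fun x => ef.continuous.comp (by fun_prop)
    rw [sub_zero, abs_one, one_mul] at this
    rwa [funext (lookAhead_eq ha f)]
  have eB : EnergyLE (lookBehind γb f) b := by
    have := EnergyLE.intervalIntegral (F := fun r x => f (x - γb + r * γb)) (s := 0) (t := 1)
      (B := b) (fun r _ => by
        have := ef.comp_add_const (-γb + r * γb)
        simpa only [← add_assoc, ← sub_eq_add_neg] using this)
      fun x => ef.continuous.comp (by fun_prop)
    rw [sub_zero, abs_one, one_mul] at this
    rwa [funext (lookBehind_eq hb f)]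
  have eE : EnergyLE (expo γa γb f) (M * (b + b)) := (eA.neg.add eB).exp (exponent_le ha hb hf)
  have egap : ∀ h : ℝ → ℝ, EnergyLE h b → EnergyLE (gap γa γb h) (2 * K * b) := by
    intro h eh
    have e1 := ((eh.sub (eh.comp_add_const γa)).const_mul (1 / γa)).add
      ((eh.sub (eh.comp_add_const (-γb))).const_mul (1 / γb))
    rw [abs_of_pos (by positivity), abs_of_pos (by positivity)] at e1
    have : gap γa γb h = fun x => 1 / γa * (h x - h (x + γa)) + 1 / γb * (h x - h (x + -γb)) := by
      ext x; simp only [gap, ← sub_eq_add_neg]; ring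
    rw [this]
    exact e1.mono (le_of_eq (by ring))
  have eθ := egap f ef
  have eθ' := egap f' ef'
  have eEθ : EnergyLE (fun x => expo γa γb f x * gap γa γb f x) _ := eE.mul eθ bE bθ
  have e1 : EnergyLE (fun x => 1 - 2 * f x) (0 + |2| * b) := (EnergyLE.const 1).sub (ef.const_mul 2)
  have e2 : EnergyLE (fun x => 1 - f x) (0 + b) := (EnergyLE.const 1).sub ef
  have ev : EnergyLE (rate γa γb f) _ := e2.mul eEθ b2 bEθ
  have evel : EnergyLE (velDeriv γa γb f f') _ :=
    ((ef'.mul eE hf' bE).const_mul (-2)).add (e1.mul eEθ b1 bEθ)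
  have erate : EnergyLE (rateDeriv γa γb f f') _ :=
    ((ef'.mul eEθ hf' bEθ).neg.add (ev.mul eθ bv bθ)).add ((e2.mul eE b2 bE).mul eθ' bF bθ')
  have p1 : 0 ≤ K * M := by positivity
  have p2 : 0 ≤ K * M * L := by positivity
  have p3 : 0 ≤ K ^ 2 * M := by positivity
  have p4 : 0 ≤ M * L := by positivity
  have q0 : 0 ≤ M * b := by positivity
  have q1 : 0 ≤ K * M * b := by positivity
  have q2 : 0 ≤ K * M * L * b := by positivity
  have q3 : 0 ≤ K ^ 2 * M * b := by positivity
  have q4 : 0 ≤ M * L * b := by positivity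
  refine ⟨fun x => ⟨?_, ?_, ?_, ?_⟩, evel.mono ?_, ev.mono ?_, erate.mono ?_⟩
  · calc |vel γa γb f x| ≤ 5 * M := by
          rw [vel, abs_mul]; gcongr; exacts [b1 x, bE x]
      _ ≤ _ := by nlinarith
  · calc |velDeriv γa γb f f' x| ≤ 2 * (L * M) + 5 * (M * (4 * K)) := by
          rw [velDeriv]
          refine (abs_add_le _ _).trans (add_le_add ?_ ?_)
          · rw [abs_mul, abs_neg, abs_two, abs_mul]; gcongr; exacts [hf' x, bE x]
          · rw [abs_mul]; gcongr; exacts [b1 x, bEθ x]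
      _ ≤ _ := by nlinarith
  · exact (bv x).trans (by nlinarith)
  · calc |rateDeriv γa γb f f' x|
        ≤ L * (M * (4 * K)) + 3 * (M * (4 * K)) * (4 * K) + 3 * M * (2 * K * L) := by
          rw [rateDeriv]
          refine (abs_add_le _ _).trans (add_le_add ((abs_add_le _ _).trans
            (add_le_add ?_ ?_)) ?_)
          · rw [abs_neg, abs_mul]; gcongr; exacts [hf' x, bEθ x]
          · rw [abs_mul]; gcongr; exacts [bv x, bθ x]
          · rw [abs_mul]; gcongr; exacts [bF x, bθ' x]
      _ ≤ _ := by nlinarith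
  · rw [abs_neg, abs_two, ← hM]; nlinarith
  · rw [← hM]; nlinarith
  · rw [← hM]; nlinarith

end


section

variable {γa γb : ℝ}

theorem continuous_lookAhead_param (ha : 0 < γa) {v : ℝ → ℝ → ℝ}
    (hv : Continuous (Function.uncurry v)) :
    Continuous fun p : ℝ × ℝ => lookAhead γa (v p.1) p.2 := by
  simp_rw [lookAhead_eq ha]
  apply intervalIntegral.continuous_parametric_intervalIntegral_of_continuous'
  exact hv.comp (f := fun q : (ℝ × ℝ) × ℝ => (q.1.1, q.1.2 + q.2 * γa)) (by fun_prop)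

theorem continuous_lookBehind_param (hb : 0 < γb) {v : ℝ → ℝ → ℝ}
    (hv : Continuous (Function.uncurry v)) :
    Continuous fun p : ℝ × ℝ => lookBehind γb (v p.1) p.2 := by
  simp_rw [lookBehind_eq hb]
  apply intervalIntegral.continuous_parametric_intervalIntegral_of_continuous'
  exact hv.comp (f := fun q : (ℝ × ℝ) × ℝ => (q.1.1, q.1.2 - γb + q.2 * γb)) (by fun_prop)

theorem continuous_expo_param (ha : 0 < γa) (hb : 0 < γb) {v : ℝ → ℝ → ℝ}
    (hv : Continuous (Function.uncurry v)) :
    Continuous fun p : ℝ × ℝ => expo γa γb (v p.1) p.2 :=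
  Real.continuous_exp.comp ((continuous_lookAhead_param ha hv).neg.add
    (continuous_lookBehind_param hb hv))

theorem continuous_gap_param {v : ℝ → ℝ → ℝ} (hv : Continuous (Function.uncurry v)) :
    Continuous fun p : ℝ × ℝ => gap γa γb (v p.1) p.2 := by
  have h0 : Continuous fun p : ℝ × ℝ => v p.1 p.2 := hv
  have h1 : Continuous fun p : ℝ × ℝ => v p.1 (p.2 + γa) :=
    hv.comp (f := fun p : ℝ × ℝ => (p.1, p.2 + γa)) (by fun_prop)
  have h2 : Continuous fun p : ℝ × ℝ => v p.1 (p.2 - γb) :=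
    hv.comp (f := fun p : ℝ × ℝ => (p.1, p.2 - γb)) (by fun_prop)
  unfold gap
  fun_prop

theorem continuous_vel_param (ha : 0 < γa) (hb : 0 < γb) {v : ℝ → ℝ → ℝ}
    (hv : Continuous (Function.uncurry v)) :
    Continuous (Function.uncurry fun t => vel γa γb (v t)) := by
  have h0 : Continuous fun p : ℝ × ℝ => v p.1 p.2 := hv
  have h1 := continuous_expo_param ha hb hv
  exact (continuous_const.sub (continuous_const.mul h0)).mul h1

theorem continuous_rate_param (ha : 0 < γa) (hb : 0 < γb) {v : ℝ → ℝ → ℝ}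
    (hv : Continuous (Function.uncurry v)) :
    Continuous (Function.uncurry fun t => rate γa γb (v t)) := by
  have h0 : Continuous fun p : ℝ × ℝ => v p.1 p.2 := hv
  exact (continuous_const.sub h0).mul
    ((continuous_expo_param ha hb hv).mul (continuous_gap_param hv))

theorem continuous_velDeriv_param (ha : 0 < γa) (hb : 0 < γb) {v d : ℝ → ℝ → ℝ}
    (hv : Continuous (Function.uncurry v)) (hd : Continuous (Function.uncurry d)) :
    Continuous (Function.uncurry fun t => velDeriv γa γb (v t) (d t)) := by
  have h0 : Continuous fun p : ℝ × ℝ => v p.1 p.2 := hv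
  have hd0 : Continuous fun p : ℝ × ℝ => d p.1 p.2 := hd
  have h1 := continuous_expo_param ha hb hv
  have h2 := continuous_gap_param (γa := γa) (γb := γb) hv
  exact (continuous_const.mul (hd0.mul h1)).add
    ((continuous_const.sub (continuous_const.mul h0)).mul (h1.mul h2))

theorem continuous_rateDeriv_param (ha : 0 < γa) (hb : 0 < γb) {v d : ℝ → ℝ → ℝ}
    (hv : Continuous (Function.uncurry v)) (hd : Continuous (Function.uncurry d)) :
    Continuous (Function.uncurry fun t => rateDeriv γa γb (v t) (d t)) := by
  have h0 : Continuous fun p : ℝ × ℝ => v p.1 p.2 := hv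
  have hd0 : Continuous fun p : ℝ × ℝ => d p.1 p.2 := hd
  have h1 := continuous_expo_param ha hb hv
  have h2 := continuous_gap_param (γa := γa) (γb := γb) hv
  have h3 := continuous_gap_param (γa := γa) (γb := γb) hd
  have h4 : Continuous fun p : ℝ × ℝ => rate γa γb (v p.1) p.2 := continuous_rate_param ha hb hv
  exact ((hd0.mul (h1.mul h2)).neg.add (h4.mul h2)).add
    (((continuous_const.sub h0).mul h1).mul h3)

end

/-! ### Fixed point argument and local existence. -/

/-- A Hölder bound on the derivative controls the error of difference quotients. -/
theorem abs_slope_sub_deriv_le {f f' : ℝ → ℝ} {b : ℝ} (hf : ∀ x, HasDerivAt f (f' x) x)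
    (he : EnergyLE f' b) {δ : ℝ} (hδ : 0 < δ) (x : ℝ) :
    |(f (x + δ) - f x) / δ - f' x| ≤ b * √δ := by
  obtain ⟨z, hz, hz'⟩ := exists_hasDerivAt_eq_slope f f' (by linarith : x < x + δ)
    (continuous_iff_continuousAt.2 fun x => (hf x).continuousAt).continuousOn fun y _ => hf y
  rw [add_sub_cancel_left] at hz'
  rw [← hz']
  refine (he.abs_sub_le x z).trans ?_
  have := he.1
  gcongr
  rw [abs_of_pos (by linarith [hz.1])]
  linarith [hz.2]

/-- The functions bounded by `2` with space derivative bounded by `L`, both with energy at most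
`b` at every time. -/
def IsTame (L b : ℝ) (v d : ℝ → ℝ → ℝ) : Prop :=
  ∀ t, (∀ x, HasDerivAt (v t) (d t x) x) ∧ (∀ x, |v t x| ≤ 2) ∧ (∀ x, |d t x| ≤ L) ∧
    EnergyLE (v t) b ∧ EnergyLE (d t) b

theorem tendsto_mul_sqrt (b : ℝ) : Tendsto (fun δ => b * √δ) (𝓝[>] 0) (𝓝 0) := by
  have : Continuous fun δ => b * √δ := by fun_prop
  simpa using (this.tendsto 0).mono_left nhdsWithin_le_nhds

/-- The slices of `d` are Hölder 1/2 with one common constant, so `d` is a uniform limit of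
difference quotients of `v`, which are jointly continuous. -/
theorem IsTame.continuous_deriv {L b : ℝ} {v d : ℝ → ℝ → ℝ} (h : IsTame L b v d)
    (hv : Continuous (Function.uncurry v)) : Continuous (Function.uncurry d) := by
  have hu : TendstoUniformly (fun (δ : ℝ) (p : ℝ × ℝ) => (v p.1 (p.2 + δ) - v p.1 p.2) / δ)
      (Function.uncurry d) (𝓝[>] 0) := by
    rw [Metric.tendstoUniformly_iff]
    intro ε hε
    filter_upwards [(tendsto_mul_sqrt b).eventually (gt_mem_nhds hε), self_mem_nhdsWithin]
      with δ h1 h2 p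
    rw [dist_comm, Real.dist_eq]
    exact (abs_slope_sub_deriv_le (h p.1).1 (h p.1).2.2.2.2 h2 p.2).trans_lt h1
  refine hu.continuous (Eventually.frequently (Eventually.of_forall fun δ => ?_))
  have h1 : Continuous fun p : ℝ × ℝ => v p.1 (p.2 + δ) :=
    hv.comp (f := fun p : ℝ × ℝ => (p.1, p.2 + δ)) (by fun_prop)
  exact (h1.sub hv).div_const δ

/-- Uniform limits of tame functions are tame. -/
theorem IsTame.of_tendstoUniformly {L b : ℝ} {V D : ℕ → ℝ → ℝ → ℝ} {v : ℝ → ℝ → ℝ}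
    (h : ∀ n, IsTame L b (V n) (D n))
    (hu : ∀ ε > 0, ∀ᶠ n in atTop, ∀ t x, |V n t x - v t x| < ε) : ∃ d, IsTame L b v d := by
  have hlim : ∀ t x, Tendsto (fun n => V n t x) atTop (𝓝 (v t x)) := fun t x => by
    rw [Metric.tendsto_nhds]
    intro ε hε
    filter_upwards [hu ε hε] with n hn
    exact hn t x
  have hcauchy : ∀ ε > 0, ∃ N, ∀ m ≥ N, ∀ n ≥ N, ∀ t x, |D m t x - D n t x| < ε := by
    intro ε hε
    have hε4 : 0 < ε / 4 := by positivity
    -- The step `δ` is fixed first, by the common Hölder bound, so that difference quotients replace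
    -- derivatives up to `ε / 4`; only then is `N` chosen, in terms of `ε * δ`.
    obtain ⟨δ, h1, h2⟩ := (((tendsto_mul_sqrt b).eventually (gt_mem_nhds hε4)).and
      self_mem_nhdsWithin).exists
    have hδ : (0 : ℝ) < δ := h2
    obtain ⟨N, hN⟩ := eventually_atTop.1 (hu (ε * δ / 8) (by positivity))
    refine ⟨N, fun m hm n hn t x => ?_⟩
    have a1 := abs_slope_sub_deriv_le (h m t).1 (h m t).2.2.2.2 hδ x
    have a2 := abs_slope_sub_deriv_le (h n t).1 (h n t).2.2.2.2 hδ x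
    have a3 : |(V m t (x + δ) - V m t x) / δ - (V n t (x + δ) - V n t x) / δ| ≤ ε / 2 := by
      rw [← sub_div, abs_div, abs_of_pos hδ, div_le_iff₀ hδ]
      have b1 := abs_lt.1 (hN m hm t (x + δ))
      have b2 := abs_lt.1 (hN n hn t (x + δ))
      have b3 := abs_lt.1 (hN m hm t x)
      have b4 := abs_lt.1 (hN n hn t x)
      rw [abs_le]
      constructor <;> linarith [b1.1, b1.2, b2.1, b2.2, b3.1, b3.2, b4.1, b4.2]
    rw [abs_le] at a1 a2 a3
    rw [abs_lt]
    constructor <;> linarith [a1.1, a1.2, a2.1, a2.2, a3.1, a3.2]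
  have hDlim : ∀ t x, ∃ y, Tendsto (fun n => D n t x) atTop (𝓝 y) := fun t x => by
    apply cauchySeq_tendsto_of_complete
    rw [Metric.cauchySeq_iff]
    intro ε hε
    obtain ⟨N, hN⟩ := hcauchy ε hε
    exact ⟨N, fun m hm n hn => hN m hm n hn t x⟩
  choose d hd using hDlim
  refine ⟨d, fun t => ⟨fun x => ?_, fun x => ?_, fun x => ?_, ?_, ?_⟩⟩
  · refine hasDerivAt_of_tendstoUniformly (f' := fun n => D n t) (f := fun n => V n t) (l := atTop)
      ?_ (Eventually.of_forall fun n => (h n t).1) (hlim t) x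
    refine UniformCauchySeqOn.tendstoUniformlyOn_of_tendsto (s := Set.univ) ?_ (fun x _ => hd t x)
      |> tendstoUniformlyOn_univ.1
    rw [Metric.uniformCauchySeqOn_iff]
    intro ε hε
    obtain ⟨N, hN⟩ := hcauchy ε hε
    exact ⟨N, fun m hm n hn x _ => hN m hm n hn t x⟩
  · exact le_of_tendsto (hlim t x).abs (Eventually.of_forall fun n => (h n t).2.1 x)
  · exact le_of_tendsto (hd t x).abs (Eventually.of_forall fun n => (h n t).2.2.1 x)
  · exact EnergyLE.of_tendsto (Eventually.of_forall fun n => (h n t).2.2.2.1) (hlim t)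
  · exact EnergyLE.of_tendsto (Eventually.of_forall fun n => (h n t).2.2.2.2) (hd t)

section

variable {γa γb : ℝ}

/-- The solution of the transport equation whose coefficients are frozen at `v`. -/
def frozen (γa γb : ℝ) (u₀ : ℝ → ℝ) (v : ℝ → ℝ → ℝ) : ℝ → ℝ → ℝ :=
  transport (fun t => vel γa γb (v t)) (fun t => rate γa γb (v t)) u₀

theorem TransportData.transport_eq {c cx g gx : ℝ → ℝ → ℝ} {u₀ u₀' : ℝ → ℝ}
    {A τ L b₀ b₁ B : ℝ} (h : TransportData c cx g gx u₀ u₀' A τ L b₀ b₁ B) (t x : ℝ) :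
    transport c g u₀ t x
      = u₀ (flow c t x 0) * Real.exp (-∫ r in (0 : ℝ)..t, g r (flow c t x r)) := by
  rw [transport, lagU, damp]
  simp_rw [h.flow_flow_zero t x]

/-- Stability of the transport equation under perturbations of the coefficients. -/
theorem TransportData.abs_sub_le {c₁ cx₁ g₁ gx₁ c₂ cx₂ g₂ gx₂ : ℝ → ℝ → ℝ} {u₀ u₀' : ℝ → ℝ}
    {A τ L b₀ b₁ B : ℝ} (h₁ : TransportData c₁ cx₁ g₁ gx₁ u₀ u₀' A τ L b₀ b₁ B)
    (h₂ : TransportData c₂ cx₂ g₂ gx₂ u₀ u₀' A τ L b₀ b₁ B) {ε : ℝ}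
    (hc : ∀ t x, |c₁ t x - c₂ t x| ≤ ε) (hg : ∀ t x, |g₁ t x - g₂ t x| ≤ ε) {t : ℝ}
    (ht0 : 0 ≤ t) (ht : t ≤ τ) (x : ℝ) :
    |transport c₁ g₁ u₀ t x - transport c₂ g₂ u₀ t x| ≤ 4 * (L + 1) * τ * ε := by
  have hA := h₁.fieldc.nonneg
  have hτ := h₁.τ_nonneg
  have hL := h₁.L_nonneg
  have hε0 : 0 ≤ ε := (abs_nonneg _).trans (hc 0 0)
  set ξ := flow c₁ t x with hξ
  set η := flow c₂ t x with hη
  have hξt : IsTraj c₁ ξ := isTraj_flow h₁.fieldc t x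
  have hηt : IsTraj c₂ η := isTraj_flow h₂.fieldc t x
  have hz : ∀ r ∈ Set.Icc 0 t, |ξ r - η r| ≤ 2 * τ * ε := by
    -- In place of Gronwall's inequality, the maximal distance `m` satisfies `m ≤ (A * m + ε) * τ`
    -- because the two characteristics meet at time `t`, and `A * τ ≤ 1 / 2` absorbs `m`.
    obtain ⟨s, hs, hmax⟩ := isCompact_Icc.exists_isMaxOn (Set.nonempty_Icc.2 ht0)
      ((hξt.continuous.sub hηt.continuous).abs.continuousOn (s := Set.Icc 0 t))
    have hmax' : ∀ r ∈ Set.Icc 0 t, |ξ r - η r| ≤ |ξ s - η s| := fun r hr => hmax hr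
    set m := |ξ s - η s| with hm
    have hder : ∀ r ∈ Set.Icc 0 t, |c₁ r (ξ r) - c₂ r (η r)| ≤ A * m + ε := by
      intro r hr
      calc _ = |(c₁ r (ξ r) - c₁ r (η r)) + (c₁ r (η r) - c₂ r (η r))| := by congr 1; ring
        _ ≤ A * |ξ r - η r| + ε :=
          (abs_add_le _ _).trans (add_le_add (h₁.fieldc.abs_sub_le _ _ _) (hc _ _))
        _ ≤ _ := by gcongr; exact hmax' r hr
    have hmv := (convex_Icc 0 t).norm_image_sub_le_of_norm_hasDerivWithin_le
      (f := fun r => ξ r - η r) (C := A * m + ε)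
      (fun r _ => ((hξt r).sub (hηt r)).hasDerivWithinAt) (fun r hr => hder r hr)
      (Set.right_mem_Icc.2 ht0) hs
    have e0 : ξ t - η t = 0 := by
      rw [hξ, hη, flow_self h₁.fieldc, flow_self h₂.fieldc, sub_self]
    simp only [e0, sub_zero, Real.norm_eq_abs] at hmv
    rw [← hm] at hmv
    have hst : |s - t| ≤ τ := by
      rw [abs_sub_comm, abs_of_nonneg (by linarith [hs.2])]; linarith [hs.1]
    have hm0 : 0 ≤ m := abs_nonneg _
    have h5 : m ≤ (A * m + ε) * τ := hmv.trans (by gcongr)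
    have h6 : A * τ * m ≤ 1 / 2 * m := by gcongr; exact h₁.small
    have hfin : m ≤ 2 * τ * ε := by nlinarith
    exact fun r hr => (hmax' r hr).trans hfin
  rw [h₁.transport_eq, h₂.transport_eq, ← hξ, ← hη]
  set G₁ := ∫ r in (0 : ℝ)..t, g₁ r (ξ r) with hG₁
  set G₂ := ∫ r in (0 : ℝ)..t, g₂ r (η r) with hG₂
  have habs : |t| ≤ τ := by rwa [abs_of_nonneg ht0]
  have bG₁ : |G₁| ≤ 1 / 2 := by
    have := h₁.abs_damp_le habs (ξ 0)
    rwa [damp, h₁.flow_flow_zero t x] at this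
  have bG₂ : |G₂| ≤ 1 / 2 := by
    have := h₂.abs_damp_le habs (η 0)
    rwa [damp, h₂.flow_flow_zero t x] at this
  have eG : |G₁ - G₂| ≤ 2 * τ * ε := by
    have i₁ : IntervalIntegrable (fun r => g₁ r (ξ r)) volume 0 t :=
      (h₁.fieldg.continuous_comp continuous_id hξt.continuous).intervalIntegrable _ _
    have i₂ : IntervalIntegrable (fun r => g₂ r (η r)) volume 0 t :=
      (h₂.fieldg.continuous_comp continuous_id hηt.continuous).intervalIntegrable _ _
    rw [hG₁, hG₂, ← intervalIntegral.integral_sub i₁ i₂]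
    have := intervalIntegral.norm_integral_le_of_norm_le_const (a := 0) (b := t)
      (f := fun r => g₁ r (ξ r) - g₂ r (η r)) (C := A * (2 * τ * ε) + ε) fun r hr => by
        rw [Set.uIoc_of_le ht0] at hr
        have hr' : r ∈ Set.Icc 0 t := ⟨hr.1.le, hr.2⟩
        calc _ = |(g₁ r (ξ r) - g₁ r (η r)) + (g₁ r (η r) - g₂ r (η r))| := by
              rw [Real.norm_eq_abs]; congr 1; ring
          _ ≤ A * |ξ r - η r| + ε :=
            (abs_add_le _ _).trans (add_le_add (h₁.fieldg.abs_sub_le _ _ _) (hg _ _))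
          _ ≤ _ := by gcongr; exact hz r hr'
    rw [sub_zero] at this
    refine this.trans ?_
    calc (A * (2 * τ * ε) + ε) * |t| ≤ (A * (2 * τ * ε) + ε) * τ := by gcongr
      _ = (2 * (A * τ) + 1) * τ * ε := by ring
      _ ≤ (2 * (1 / 2) + 1) * τ * ε := by gcongr; exact h₁.small
      _ = _ := by ring
  have e1 : |Real.exp (-G₁) - Real.exp (-G₂)| ≤ 2 * (2 * τ * ε) := by
    refine (abs_exp_sub_le ((neg_le_abs _).trans bG₁) ((neg_le_abs _).trans bG₂)).trans ?_
    gcongr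
    · exact exp_half_le_two
    · rw [← abs_neg]; refine le_trans (le_of_eq ?_) eG; congr 1; ring
  have e2 : |u₀ (ξ 0) - u₀ (η 0)| ≤ L * (2 * τ * ε) := by
    have := Convex.norm_image_sub_le_of_norm_hasDerivWithin_le (f := u₀) (s := Set.univ) (C := L)
      (x := η 0) (y := ξ 0) (fun r _ => (h₁.hasDerivAt r).hasDerivWithinAt)
      (fun r _ => h₁.bound₁ r) convex_univ trivial trivial
    refine this.trans ?_
    gcongr
    exact hz 0 (Set.left_mem_Icc.2 ht0)
  have b2 : |Real.exp (-G₂)| ≤ 2 := by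
    rw [Real.abs_exp]
    exact (Real.exp_le_exp.2 ((neg_le_abs _).trans bG₂)).trans exp_half_le_two
  refine (abs_mul_sub_mul_le (h₁.bound₀ _) b2 e2 e1).trans (le_of_eq ?_)
  ring

/-- Uniform existence time for the fixed point equation, in terms of a Lipschitz bound. -/
theorem exists_fixedPoint (ha : 0 < γa) (hb : 0 < γb) (L : ℝ) (hL : 0 ≤ L) :
    ∃ τ A B : ℝ, 0 < τ ∧ ∀ (u₀ u₀' : ℝ → ℝ) (b₀ b₁ : ℝ), (∀ x, HasDerivAt u₀ (u₀' x) x) →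
      (∀ x, |u₀ x| ≤ 1) → (∀ x, |u₀' x| ≤ L) → EnergyLE u₀ b₀ → EnergyLE u₀' b₁ →
      ∃ v d : ℝ → ℝ → ℝ,
        TransportData (fun t => vel γa γb (v t)) (fun t => velDeriv γa γb (v t) (d t))
          (fun t => rate γa γb (v t)) (fun t => rateDeriv γa γb (v t) (d t)) u₀ u₀' A τ L b₀ b₁
          (B * (b₀ + b₁)) ∧
        (∀ t x, HasDerivAt (v t) (d t x) x) ∧
        ∀ t ∈ Set.Icc 0 τ, ∀ x, v t x = frozen γa γb u₀ v t x := by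
  obtain ⟨Λ, hΛ, hΛ'⟩ := coeff_sub_le ha hb
  obtain ⟨A, C, hA, hC, hAC⟩ := coeff_bounds ha hb (L := 3 * (L + 1)) (by positivity)
  -- The three summands yield, in order, the smallness required in `TransportData`, contraction with
  -- factor 1/2, and stability of the energy bound. None of them involves `b₀` or `b₁`.
  set N := 2 * A + 8 * (L + 1) * Λ + 120 * (L + 1) * C with hN
  have hNpos : 0 < N := by positivity
  set τ := 1 / N with hτ
  have hτ0 : 0 < τ := by positivity
  have hNτ : N * τ = 1 := by rw [hτ]; field_simp
  have hτA : A * τ ≤ 1 / 2 := by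
    have h1 : 0 ≤ (8 * (L + 1) * Λ) * τ := by positivity
    have h2 : 0 ≤ (120 * (L + 1) * C) * τ := by positivity
    nlinarith
  have hτΛ : 4 * (L + 1) * τ * Λ ≤ 1 / 2 := by
    have h1 : 0 ≤ A * τ := by positivity
    have h2 : 0 ≤ (120 * (L + 1) * C) * τ := by positivity
    nlinarith
  have hτC : 60 * (L + 1) * τ * C ≤ 1 / 2 := by
    have h1 : 0 ≤ A * τ := by positivity
    have h2 : 0 ≤ (8 * (L + 1) * Λ) * τ := by positivity
    nlinarith
  refine ⟨τ, A, C * 12, hτ0, fun u₀ u₀' b₀ b₁ hu hu1 hu2 he₀ he₁ => ?_⟩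
  have hb₀ := he₀.1
  have hb₁ := he₁.1
  -- The transported derivative has energy at most `6 * (b₀ + b₁)` plus half of `b`, so this choice
  -- reproduces `b`.
  set b := 12 * (b₀ + b₁) with hbdef
  have hdata : ∀ v d : ℝ → ℝ → ℝ, Continuous (Function.uncurry v) → IsTame (3 * (L + 1)) b v d →
      TransportData (fun t => vel γa γb (v t)) (fun t => velDeriv γa γb (v t) (d t))
          (fun t => rate γa γb (v t)) (fun t => rateDeriv γa γb (v t) (d t)) u₀ u₀' A τ L b₀ b₁
          (C * 12 * (b₀ + b₁)) := by
    intro v d hv hT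
    have hd := hT.continuous_deriv hv
    have hB : ∀ t, _ := fun t =>
      hAC (v t) (d t) b (hT t).2.1 (hT t).2.2.1 (hT t).2.2.2.1 (hT t).2.2.2.2
    have hCb : C * b = C * 12 * (b₀ + b₁) := by rw [hbdef]; ring
    rw [hCb] at hB
    exact
      { fieldc := ⟨continuous_vel_param ha hb hv, continuous_velDeriv_param ha hb hv hd,
          fun t x => hasDerivAt_vel (hT t).1 x, fun t x => ((hB t).1 x).1,
          fun t x => ((hB t).1 x).2.1⟩
        fieldg := ⟨continuous_rate_param ha hb hv, continuous_rateDeriv_param ha hb hv hd,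
          fun t x => hasDerivAt_rate (hT t).1 x, fun t x => ((hB t).1 x).2.2.1,
          fun t x => ((hB t).1 x).2.2.2⟩
        τ_nonneg := hτ0.le
        small := hτA
        hasDerivAt := hu
        bound₀ := hu1
        bound₁ := hu2
        energy₀ := he₀
        energy₁ := he₁
        energyc := fun t => (hB t).2.1
        energyg := fun t => (hB t).2.2.1
        energygx := fun t => (hB t).2.2.2 }
  -- Freezing time outside `[0, τ]` lets the iteration run in the complete space of bounded
  -- continuous functions on the whole plane.
  set clamp : ℝ → ℝ := fun t => max 0 (min t τ) with hclamp
  have hclampc : Continuous clamp := by fun_prop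
  have hcl0 : ∀ t, 0 ≤ clamp t := fun t => le_max_left _ _
  have hcl1 : ∀ t, clamp t ≤ τ := fun t => max_le hτ0.le (min_le_right _ _)
  have hcl : ∀ t, |clamp t| ≤ τ := fun t => by rw [abs_of_nonneg (hcl0 t)]; exact hcl1 t
  -- The value 0 is never taken through the default branch on the set `S` of tame functions, the
  -- only place where `Φ` is used.
  set Φ : BoundedContinuousFunction (ℝ × ℝ) ℝ → BoundedContinuousFunction (ℝ × ℝ) ℝ := fun v =>
    open Classical in
    if h : Continuous (fun p : ℝ × ℝ => frozen γa γb u₀ (fun t x => v (t, x)) (clamp p.1) p.2) ∧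
      ∀ p : ℝ × ℝ, ‖frozen γa γb u₀ (fun t x => v (t, x)) (clamp p.1) p.2‖ ≤ 2
    then BoundedContinuousFunction.ofNormedAddCommGroup _ h.1 2 h.2 else 0 with hΦ
  set S : Set (BoundedContinuousFunction (ℝ × ℝ) ℝ) :=
    {v | ∃ d, IsTame (3 * (L + 1)) b (fun t x => v (t, x)) d} with hS
  have hcont : ∀ v : BoundedContinuousFunction (ℝ × ℝ) ℝ,
      Continuous (Function.uncurry fun t x => v (t, x)) := fun v => v.continuous
  have hΦeq : ∀ v ∈ S, ∀ p : ℝ × ℝ,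
      Φ v p = frozen γa γb u₀ (fun t x => v (t, x)) (clamp p.1) p.2 := by
    rintro v ⟨d, hd⟩ p
    have hD := hdata _ d (hcont v) hd
    have h : Continuous (fun p : ℝ × ℝ => frozen γa γb u₀ (fun t x => v (t, x)) (clamp p.1) p.2) ∧
        ∀ p : ℝ × ℝ, ‖frozen γa γb u₀ (fun t x => v (t, x)) (clamp p.1) p.2‖ ≤ 2 :=
      ⟨hD.continuous_transport.comp (f := fun p : ℝ × ℝ => (clamp p.1, p.2)) (by fun_prop),
        fun p => hD.abs_transport_le (hcl p.1) p.2⟩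
    rw [hΦ]
    simp only
    rw [dif_pos h]
    rfl
  have hmaps : Set.MapsTo Φ S S := by
    rintro v ⟨d, hd⟩
    have hD := hdata _ d (hcont v) hd
    have hbC : 0 ≤ b := by positivity
    have key : 60 * (L + 1) * τ * (C * 12 * (b₀ + b₁)) ≤ 1 / 2 * b := by
      calc _ = 60 * (L + 1) * τ * C * b := by rw [hbdef]; ring
        _ ≤ _ := by gcongr
    refine ⟨fun t => transportDeriv (fun t => vel γa γb fun x => v (t, x))
      (fun t => velDeriv γa γb (fun x => v (t, x)) (d t)) (fun t => rate γa γb fun x => v (t, x))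
      (fun t => rateDeriv γa γb (fun x => v (t, x)) (d t)) u₀ u₀' (clamp t), fun t => ?_⟩
    have hfun : (fun x => Φ v (t, x)) = frozen γa γb u₀ (fun t x => v (t, x)) (clamp t) :=
      funext fun x => hΦeq v ⟨d, hd⟩ (t, x)
    change (∀ x, HasDerivAt (fun x => Φ v (t, x)) _ x) ∧
      (∀ x, |(fun x => Φ v (t, x)) x| ≤ 2) ∧ _ ∧ EnergyLE (fun x => Φ v (t, x)) b ∧ _
    rw [hfun]
    refine ⟨hD.hasDerivAt_transport (clamp t), hD.abs_transport_le (hcl t),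
      hD.abs_transportDeriv_le (hcl t), (hD.energy_transport (hcl t)).mono ?_,
      (hD.energy_transportDeriv (hcl t)).mono ?_⟩
    · have h1 : 8 * τ * (C * 12 * (b₀ + b₁)) ≤ 60 * (L + 1) * τ * (C * 12 * (b₀ + b₁)) := by
        gcongr; linarith
      linarith
    · linarith
  -- Derivative and energy bounds survive uniform limits, so contraction in the sup norm alone is
  -- enough.
  have hclosed : IsClosed S := by
    apply IsSeqClosed.isClosed
    intro V v hV hlim
    choose D hD using hV
    refine IsTame.of_tendstoUniformly hD fun ε hε => ?_
    filter_upwards [(Metric.tendsto_nhds.1 hlim) ε hε] with n hn t x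
    exact (BoundedContinuousFunction.dist_coe_le_dist (t, x)).trans_lt hn
  have hcontr : ∀ v ∈ S, ∀ w ∈ S, dist (Φ v) (Φ w) ≤ 1 / 2 * dist v w := by
    rintro v ⟨d, hd⟩ w ⟨e, he⟩
    rw [BoundedContinuousFunction.dist_le (by positivity)]
    intro p
    rw [hΦeq v ⟨d, hd⟩, hΦeq w ⟨e, he⟩, Real.dist_eq]
    have hsub := fun t => hΛ' (fun x => v (t, x)) (fun x => w (t, x)) (dist v w)
      ((hd t).2.2.2.1.continuous) ((he t).2.2.2.1.continuous) (hd t).2.1 (he t).2.1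
      (fun x => by rw [← Real.dist_eq]; exact BoundedContinuousFunction.dist_coe_le_dist (t, x))
    refine ((hdata _ d (hcont v) hd).abs_sub_le (hdata _ e (hcont w) he)
      (fun t x => (hsub t x).1) (fun t x => (hsub t x).2) (hcl0 p.1) (hcl1 p.1) p.2).trans ?_
    calc _ = 4 * (L + 1) * τ * Λ * dist v w := by ring
      _ ≤ _ := by gcongr
  have hx₀ : BoundedContinuousFunction.ofNormedAddCommGroup (fun p : ℝ × ℝ => u₀ p.2)
      (he₀.continuous.comp continuous_snd) 1 (fun p => hu1 p.2) ∈ S := by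
    refine ⟨fun _ => u₀', fun t => ⟨hu, fun x => (hu1 x).trans one_le_two, fun x =>
      (hu2 x).trans (by linarith), he₀.mono ?_, he₁.mono ?_⟩⟩ <;> rw [hbdef] <;> linarith
  have hCW : ContractingWith (1 / 2) (hmaps.restrict Φ S S) := by
    refine ⟨by norm_num, LipschitzWith.of_dist_le_mul fun v w => ?_⟩
    have := hcontr v v.2 w w.2
    simpa using! this
  obtain ⟨v, hvS, hfix, -⟩ := hCW.exists_fixedPoint' hclosed.isComplete hmaps hx₀ (edist_ne_top _ _)
  obtain ⟨d, hd⟩ := hvS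
  refine ⟨fun t x => v (t, x), d, hdata _ d (hcont v) hd, fun t x => (hd t).1 x,
    fun t ht x => ?_⟩
  have h1 := hΦeq v ⟨d, hd⟩ (t, x)
  rw [hfix] at h1
  have h2 : clamp t = t := by
    simp only [hclamp]
    rw [min_eq_left ht.2, max_eq_right ht.1]
  simpa only [h2] using h1

/-- The rate of change of `u_x` along characteristics. -/
def charRHS (γa γb : ℝ) (f : ℝ → ℝ) (x : ℝ) : ℝ :=
  expo γa γb f x * (2 * deriv f x ^ 2 - 2 * (1 - 2 * f x) * gap γa γb f x * deriv f x
    - f x * (1 - f x) * (gap γa γb f x ^ 2 + gap γa γb (deriv f) x))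

/-- The evolution of `u_x` along characteristics. -/
def HasCharacteristics (γa γb T : ℝ) (u : ℝ → ℝ → ℝ) : Prop :=
  ∀ t ∈ Set.Ico 0 T, ∀ x, ∃ ξ : ℝ → ℝ, ξ t = x ∧
    HasDerivWithinAt (fun r => deriv (u r) (ξ r)) (charRHS γa γb (u t) x) (Set.Ico 0 T) t

/-- Local existence, with an existence time which depends only on a Lipschitz bound. -/
theorem exists_local_solution (ha : 0 < γa) (hb : 0 < γb) (L : ℝ) (hL : 0 ≤ L) :
    ∃ τ : ℝ, 0 < τ ∧ ∀ u₀ : ℝ → ℝ, MemH2 u₀ → (∀ x, |u₀ x| ≤ 1) → (∀ x, |deriv u₀ x| ≤ L) →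
      ∃ u, IsH2Solution γa γb u₀ τ u ∧ HasCharacteristics γa γb τ u := by
  obtain ⟨τ, A, B, hτ, hmain⟩ := exists_fixedPoint ha hb L hL
  refine ⟨τ, hτ, fun u₀ hu₀ hu1 hu2 => ?_⟩
  obtain ⟨f₂, hf₂⟩ := hu₀
  obtain ⟨b₀, b₁, he₀, he₁⟩ := hf₂.exists_energy
  obtain ⟨v, d, hD, hvd, hfix⟩ := hmain u₀ (deriv u₀) b₀ b₁ hf₂.hasDerivAt hu1 hu2 he₀ he₁
  set u := frozen γa γb u₀ v with hu
  have hvu : ∀ t ∈ Set.Icc 0 τ, v t = u t := fun t ht => funext fun x => hfix t ht x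
  have habs : ∀ t ∈ Set.Ico 0 τ, |t| ≤ τ := fun t ht => by
    rw [abs_of_nonneg ht.1]; exact ht.2.le
  have hderiv : ∀ t x, HasDerivAt (u t) (transportDeriv (fun t => vel γa γb (v t))
      (fun t => velDeriv γa γb (v t) (d t)) (fun t => rate γa γb (v t))
      (fun t => rateDeriv γa γb (v t) (d t)) u₀ (deriv u₀) t x) x := hD.hasDerivAt_transport
  have hdeq : ∀ t ∈ Set.Icc 0 τ, d t = deriv (u t) := fun t ht => funext fun x => by
    rw [← hvu t ht]; exact (hvd t x).deriv.symm
  refine ⟨u, ⟨⟨fun t => deriv (deriv (u t)), fun t ht =>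
    hD.isH2With_transport hf₂.memLp (habs t ht), fun s hs => ?_⟩, hD.transport_zero,
    fun t ht x => ?_⟩, fun t ht x => ?_⟩
  · exact hD.tendsto_H2 hf₂.memLp (habs s hs) nhdsWithin_le_nhds
      (eventually_mem_nhdsWithin.mono habs)
  · have h1 := hD.hasDerivAt_transport_left t x
    refine HasDerivAt.congr_deriv h1 ?_
    have ht' : t ∈ Set.Icc 0 τ := ⟨ht.1.le, ht.2.le⟩
    have hfl := hasDerivAt_flux (γa := γa) (γb := γb) (hderiv t) x
    rw [hfl.deriv, hvu t ht']
    rfl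
  -- Along the characteristic through `(t, x)`, the derivative `u_x` is `lagD` at a fixed starting
  -- point, whose time derivative is known.
  · refine ⟨flow (fun t => vel γa γb (v t)) t x, flow_self hD.fieldc t x, ?_⟩
    have ht' : t ∈ Set.Icc 0 τ := ⟨ht.1, ht.2.le⟩
    have h1 := hD.hasDerivAt_lagD_left t (flow (fun t => vel γa γb (v t)) t x 0)
    have heq : (fun r => deriv (u r) (flow (fun t => vel γa γb (v t)) t x r)) = fun r =>
        lagD (fun t => vel γa γb (v t)) (fun t => velDeriv γa γb (v t) (d t))
          (fun t => rate γa γb (v t)) (fun t => rateDeriv γa γb (v t) (d t)) u₀ (deriv u₀) r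
          (flow (fun t => vel γa γb (v t)) t x 0) := by
      ext r
      rw [(hderiv r _).deriv, ← hD.lagD_flow, hD.flow_flow_zero]
    rw [heq]
    refine (HasDerivAt.congr_deriv h1 ?_).hasDerivWithinAt
    have h2 := congrFun heq t
    beta_reduce at h2
    rw [flow_self hD.fieldc] at h2
    rw [← h2, ← hD.lagU_flow, hD.flow_flow_zero, flow_self hD.fieldc]
    have h3 : transport (fun t => vel γa γb (v t)) (fun t => rate γa γb (v t)) u₀ t x = u t x := rfl
    rw [h3, hvu t ht', hdeq t ht']
    simp only [charRHS, rateDeriv, velDeriv, rate]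
    ring

end


/-! ### Paths in `C₀(ℝ)` and a maximum principle. -/

/-- A path in `C₀(ℝ)`, continuous for the uniform norm. -/
structure IsC0Path (I : Set ℝ) (f : ℝ → ℝ → ℝ) : Prop where
  continuous : ∀ t ∈ I, Continuous (f t)
  tendsto_zero : ∀ t ∈ I, Tendsto (f t) (cocompact ℝ) (𝓝 0)
  tendstoUniformly : ∀ s ∈ I, TendstoUniformly f (f s) (𝓝[I] s)

namespace IsC0Path

variable {I : Set ℝ} {f g : ℝ → ℝ → ℝ}

theorem exists_isMax (h : IsC0Path I f) {t : ℝ} (ht : t ∈ I) {x₀ : ℝ} (hx₀ : 0 < f t x₀) :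
    ∃ x, ∀ y, f t y ≤ f t x :=
  (h.continuous t ht).exists_forall_ge' x₀
    (((h.tendsto_zero t ht).eventually (gt_mem_nhds hx₀)).mono fun _ hx => le_of_lt hx)

theorem bddAbove (h : IsC0Path I f) {t : ℝ} (ht : t ∈ I) : BddAbove (Set.range (f t)) := by
  by_cases hx : ∃ x₀, 0 < f t x₀
  · obtain ⟨x₀, hx₀⟩ := hx
    obtain ⟨x, hx⟩ := h.exists_isMax ht hx₀
    exact ⟨f t x, Set.forall_mem_range.2 hx⟩
  · push Not at hx
    exact ⟨0, Set.forall_mem_range.2 hx⟩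

theorem le_iSup (h : IsC0Path I f) {t : ℝ} (ht : t ∈ I) (x : ℝ) : f t x ≤ ⨆ x, f t x :=
  le_ciSup (h.bddAbove ht) x

theorem iSup_nonneg (h : IsC0Path I f) {t : ℝ} (ht : t ∈ I) : 0 ≤ ⨆ x, f t x :=
  le_of_tendsto' (h.tendsto_zero t ht) (h.le_iSup ht)

theorem exists_eq_iSup (h : IsC0Path I f) {t : ℝ} (ht : t ∈ I) (hpos : 0 < ⨆ x, f t x) :
    ∃ x, f t x = ⨆ x, f t x := by
  obtain ⟨x₀, hx₀⟩ := exists_lt_of_lt_ciSup hpos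
  obtain ⟨x, hx⟩ := h.exists_isMax ht hx₀
  exact ⟨x, le_antisymm (h.le_iSup ht x) (ciSup_le hx)⟩

theorem continuousOn_iSup (h : IsC0Path I f) : ContinuousOn (fun t => ⨆ x, f t x) I := by
  intro s hs
  rw [ContinuousWithinAt, Metric.tendsto_nhds]
  intro ε hε
  filter_upwards [Metric.tendstoUniformly_iff.1 (h.tendstoUniformly s hs) (ε / 2) (by positivity),
    self_mem_nhdsWithin] with t ht htI
  rw [Real.dist_eq, abs_lt]
  have key : ∀ x, |f s x - f t x| < ε / 2 := fun x => by rw [← Real.dist_eq]; exact ht x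
  have h1 : ⨆ x, f t x ≤ (⨆ x, f s x) + ε / 2 := ciSup_le fun x => by
    linarith [(abs_lt.1 (key x)).1, h.le_iSup hs x]
  have h2 : ⨆ x, f s x ≤ (⨆ x, f t x) + ε / 2 := ciSup_le fun x => by
    linarith [(abs_lt.1 (key x)).2, h.le_iSup htI x]
  constructor <;> linarith

theorem mono {J : Set ℝ} (h : IsC0Path I f) (hJ : J ⊆ I) : IsC0Path J f :=
  ⟨fun t ht => h.continuous t (hJ ht), fun t ht => h.tendsto_zero t (hJ ht), fun s hs u hu =>
    (h.tendstoUniformly s (hJ hs) u hu).filter_mono (nhdsWithin_mono s hJ)⟩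

theorem neg (h : IsC0Path I f) : IsC0Path I fun t x => -f t x := by
  refine ⟨fun t ht => (h.continuous t ht).neg,
    fun t ht => by simpa using (h.tendsto_zero t ht).neg, fun s hs => ?_⟩
  rw [Metric.tendstoUniformly_iff]
  intro ε hε
  filter_upwards [Metric.tendstoUniformly_iff.1 (h.tendstoUniformly s hs) ε hε] with t ht x
  rw [dist_neg_neg]
  exact ht x

theorem sub (h : IsC0Path I f) (h' : IsC0Path I g) : IsC0Path I fun t x => f t x - g t x := by
  refine ⟨fun t ht => (h.continuous t ht).sub (h'.continuous t ht), fun t ht => by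
    simpa using (h.tendsto_zero t ht).sub (h'.tendsto_zero t ht), fun s hs => ?_⟩
  rw [Metric.tendstoUniformly_iff]
  intro ε hε
  filter_upwards [Metric.tendstoUniformly_iff.1 (h.tendstoUniformly s hs) (ε / 2) (by positivity),
    Metric.tendstoUniformly_iff.1 (h'.tendstoUniformly s hs) (ε / 2) (by positivity)]
    with t ht ht' x
  have h1 := abs_lt.1 (Real.dist_eq (f s x) (f t x) ▸ ht x)
  have h2 := abs_lt.1 (Real.dist_eq (g s x) (g t x) ▸ ht' x)
  rw [Real.dist_eq, abs_lt]
  constructor <;> linarith [h1.1, h1.2, h2.1, h2.2]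

theorem exists_abs_le_of_mem (h : IsC0Path I f) {t : ℝ} (ht : t ∈ I) :
    ∃ C, 0 ≤ C ∧ ∀ x, |f t x| ≤ C := by
  refine ⟨(⨆ x, f t x) + ⨆ x, -f t x, add_nonneg (h.iSup_nonneg ht) (h.neg.iSup_nonneg ht),
    fun x => abs_le.2 ?_⟩
  have := h.iSup_nonneg ht
  have := h.neg.iSup_nonneg ht
  constructor <;> linarith [h.le_iSup ht x, h.neg.le_iSup ht x]

theorem exists_abs_le (h : IsC0Path I f) (hI : IsCompact I) :
    ∃ C, 0 ≤ C ∧ ∀ t ∈ I, ∀ x, |f t x| ≤ C := by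
  obtain ⟨C₁, h₁⟩ := hI.bddAbove_image h.continuousOn_iSup
  obtain ⟨C₂, h₂⟩ := hI.bddAbove_image h.neg.continuousOn_iSup
  refine ⟨|C₁| + |C₂|, by positivity, fun t ht x => abs_le.2 ?_⟩
  have a1 := h₁ (Set.mem_image_of_mem _ ht)
  have a2 := h₂ (Set.mem_image_of_mem _ ht)
  have a3 := h.le_iSup ht x
  have a4 := h.neg.le_iSup ht x
  beta_reduce at a1 a2
  constructor <;> linarith [le_abs_self C₁, le_abs_self C₂, abs_nonneg C₁, abs_nonneg C₂]

theorem sq (h : IsC0Path I f) : IsC0Path I fun t x => f t x ^ 2 := by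
  refine ⟨fun t ht => (h.continuous t ht).pow 2, fun t ht => by
    simpa using (h.tendsto_zero t ht).pow 2, fun s hs => ?_⟩
  obtain ⟨C, hC, hC'⟩ := h.exists_abs_le_of_mem hs
  rw [Metric.tendstoUniformly_iff]
  intro ε hε
  filter_upwards [Metric.tendstoUniformly_iff.1 (h.tendstoUniformly s hs) 1 one_pos,
    Metric.tendstoUniformly_iff.1 (h.tendstoUniformly s hs) (ε / (2 * C + 1)) (by positivity)]
    with t h1 h2 x
  have a1 := h1 x
  have a2 := h2 x
  rw [Real.dist_eq] at a1 a2 ⊢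
  have a3 : f s x ^ 2 - f t x ^ 2 = (f s x - f t x) * (2 * f s x - (f s x - f t x)) := by ring
  have a4 : |2 * f s x - (f s x - f t x)| ≤ 2 * C + 1 := by
    refine (abs_sub _ _).trans (add_le_add ?_ a1.le)
    rw [abs_mul, abs_two]
    gcongr
    exact hC' x
  rw [a3, abs_mul]
  calc _ ≤ |f s x - f t x| * (2 * C + 1) := by gcongr
    _ < ε / (2 * C + 1) * (2 * C + 1) := by gcongr
    _ = ε := by field_simp

/-- A maximum principle for paths in `C₀(ℝ)`. -/
theorem le_of_hasDerivWithinAt_le {a b k C : ℝ} (h : IsC0Path (Set.Icc a b) f) (hk : 0 ≤ k)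
    (ha : ∀ x, f a x ≤ k)
    (hd : ∀ t ∈ Set.Ioc a b, ∀ x, k < f t x → (∀ y, f t y ≤ f t x) → ∃ (ξ : ℝ → ℝ) (D : ℝ),
      ξ t = x ∧ HasDerivWithinAt (fun r => f r (ξ r)) D (Set.Icc a t) t ∧ D ≤ C * (f t x - k)) :
    ∀ t ∈ Set.Icc a b, ∀ x, f t x ≤ k := by
  intro t₀ ht₀ x₀
  by_contra! hlt
  -- The exponent `C + 1` gives strictness. At a positive maximum of the weighted excess the slopes
  -- from the left along `ξ` are nonnegative, whereas the derivative is at most `w t * (C - (C + 1))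
  -- * (f t x - k) < 0`.
  set w : ℝ → ℝ := fun t => Real.exp (-(C + 1) * (t - a)) with hw
  have hw0 : ∀ t, 0 < w t := fun t => Real.exp_pos _
  set g : ℝ → ℝ := fun t => w t * ((⨆ x, f t x) - k) with hg
  have hgc : ContinuousOn g (Set.Icc a b) :=
    ContinuousOn.mul (by fun_prop) (h.continuousOn_iSup.sub continuousOn_const)
  obtain ⟨t, ht, hmax⟩ := isCompact_Icc.exists_isMaxOn ⟨t₀, ht₀⟩ hgc
  have hmax' : ∀ r ∈ Set.Icc a b, g r ≤ g t := fun r hr => hmax hr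
  have hpos : 0 < g t := by
    refine lt_of_lt_of_le ?_ (hmax' t₀ ht₀)
    exact mul_pos (hw0 _) (by linarith [h.le_iSup ht₀ x₀])
  have hMk : k < ⨆ x, f t x := by
    have := pos_of_mul_pos_right hpos (hw0 t).le
    linarith
  have hta : a < t := by
    refine lt_of_le_of_ne ht.1 fun heq => ?_
    rw [← heq] at hMk
    exact absurd (ciSup_le ha) (not_le.2 hMk)
  obtain ⟨x, hx⟩ := h.exists_eq_iSup ht (hk.trans_lt hMk)
  obtain ⟨ξ, D, hξ, hD, hDle⟩ := hd t ⟨hta, ht.2⟩ x (hx ▸ hMk) fun y => hx ▸ h.le_iSup ht y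
  have hwd : HasDerivAt w (w t * (-(C + 1))) t := by
    have := (((hasDerivAt_id t).sub_const a).const_mul (-(C + 1))).exp
    refine HasDerivAt.congr_deriv this ?_
    simp [hw]
  have hφ := hwd.hasDerivWithinAt (s := Set.Icc a t) |>.mul (hD.sub_const k)
  rw [hasDerivWithinAt_iff_tendsto_slope] at hφ
  have hφ' := hφ.mono_left (nhdsWithin_mono t (s := Set.Ioo a t) fun r hr =>
    ⟨⟨hr.1.le, hr.2.le⟩, hr.2.ne⟩)
  have : (𝓝[Set.Ioo a t] t).NeBot := by
    rw [nhdsWithin_Ioo_eq_nhdsLT hta]; infer_instance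
  have hnonneg := ge_of_tendsto hφ' (b := 0) (by
    filter_upwards [self_mem_nhdsWithin] with r hr
    rw [slope_def_field]
    refine div_nonneg_of_nonpos ?_ (by linarith [hr.2])
    have hrI : r ∈ Set.Icc a b := ⟨hr.1.le, hr.2.le.trans ht.2⟩
    have h1 : w r * (f r (ξ r) - k) ≤ g r := by
      apply mul_le_mul_of_nonneg_left _ (hw0 r).le
      linarith [h.le_iSup hrI (ξ r)]
    have h2 : w t * (f t (ξ t) - k) = g t := by rw [hξ, hx]
    simp only [Pi.mul_apply]
    linarith [hmax' r hrI])
  rw [hξ] at hnonneg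
  have h3 : k < f t x := hx ▸ hMk
  have h4 := hw0 t
  nlinarith [mul_le_mul_of_nonneg_left hDle h4.le, mul_pos h4 (sub_pos.2 h3)]

end IsC0Path

section

variable {T : ℝ} {u : ℝ → ℝ → ℝ}

/-- The second derivatives in `ContinuousIntoH2` can be taken to be iterated derivatives. -/
theorem continuousIntoH2_iff : ContinuousIntoH2 T u ↔
    (∀ t ∈ Set.Ico 0 T, IsH2With (u t) (deriv (deriv (u t)))) ∧
    ∀ s ∈ Set.Ico 0 T,
      Tendsto (fun t => eLpNorm (u t - u s) 2 volume) (𝓝[Set.Ico 0 T] s) (𝓝 0) ∧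
      Tendsto (fun t => eLpNorm (deriv (u t) - deriv (u s)) 2 volume)
        (𝓝[Set.Ico 0 T] s) (𝓝 0) ∧
      Tendsto (fun t => eLpNorm (deriv (deriv (u t)) - deriv (deriv (u s))) 2 volume)
        (𝓝[Set.Ico 0 T] s) (𝓝 0) := by
  refine ⟨fun ⟨w, hw, h⟩ => ⟨fun t ht => (hw t ht).canonical, fun s hs =>
    ⟨(h s hs).1, (h s hs).2.1, (h s hs).2.2.congr' ?_⟩⟩, fun h => ⟨_, h⟩⟩
  filter_upwards [self_mem_nhdsWithin] with t ht
  exact eLpNorm_congr_ae ((hw t ht).second_ae_eq.sub (hw s hs).second_ae_eq)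

/-- The Sobolev inequality applied to `F t - F s`. It turns continuity into `H²` into uniform
continuity statements for `u` and `u_x`. -/
theorem tendstoUniformly_of_primitive {F G : ℝ → ℝ → ℝ} {l : Filter ℝ} {s : ℝ}
    (hF : ∀ᶠ t in l, MemLp (F t) 2 ∧ MemLp (G t) 2 ∧ ∀ x y, F t y - F t x = ∫ r in x..y, G t r)
    (hFs : MemLp (F s) 2 ∧ MemLp (G s) 2 ∧ ∀ x y, F s y - F s x = ∫ r in x..y, G s r)
    (h0 : Tendsto (fun t => eLpNorm (F t - F s) 2 volume) l (𝓝 0))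
    (h1 : Tendsto (fun t => eLpNorm (G t - G s) 2 volume) l (𝓝 0)) :
    TendstoUniformly F (F s) l := by
  have h2 : Tendsto (fun t => 2 * ((eLpNorm (F t - F s) 2 volume).toReal
      + (eLpNorm (G t - G s) 2 volume).toReal)) l (𝓝 0) := by
    have := (((ENNReal.tendsto_toReal ENNReal.zero_ne_top).comp h0).add
      ((ENNReal.tendsto_toReal ENNReal.zero_ne_top).comp h1)).const_mul 2
    simpa using this
  rw [Metric.tendstoUniformly_iff]
  intro ε hε
  filter_upwards [hF, h2.eventually (gt_mem_nhds hε)] with t ht hlt x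
  rw [dist_comm, Real.dist_eq]
  refine lt_of_le_of_lt ?_ hlt
  refine abs_le_of_primitive (f := F t - F s) (g := G t - G s) (ht.1.sub hFs.1)
    (ht.2.1.sub hFs.2.1) (fun x y => ?_) x
  simp only [Pi.sub_apply]
  rw [intervalIntegral.integral_sub (MemLp.intervalIntegrable ht.2.1 _ _)
    (MemLp.intervalIntegrable hFs.2.1 _ _), ← ht.2.2, ← hFs.2.2]
  ring

theorem ContinuousIntoH2.isC0Path (h : ContinuousIntoH2 T u) : IsC0Path (Set.Ico 0 T) u := by
  obtain ⟨w, hw, h⟩ := h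
  refine ⟨fun t ht => (hw t ht).continuous, fun t ht => (hw t ht).tendsto_zero, fun s hs => ?_⟩
  refine tendstoUniformly_of_primitive (G := fun t => deriv (u t)) ?_
    ⟨(hw s hs).memLp, (hw s hs).memLp_deriv, (hw s hs).sub_eq⟩ (h s hs).1 (h s hs).2.1
  filter_upwards [self_mem_nhdsWithin] with t ht
  exact ⟨(hw t ht).memLp, (hw t ht).memLp_deriv, (hw t ht).sub_eq⟩

theorem ContinuousIntoH2.isC0Path_deriv (h : ContinuousIntoH2 T u) :
    IsC0Path (Set.Ico 0 T) fun t => deriv (u t) := by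
  obtain ⟨w, hw, h⟩ := h
  refine ⟨fun t ht => (hw t ht).continuous_deriv, fun t ht => (hw t ht).deriv_tendsto_zero,
    fun s hs => ?_⟩
  refine tendstoUniformly_of_primitive (F := fun t => deriv (u t)) (G := w) ?_
    ⟨(hw s hs).memLp_deriv, (hw s hs).memLp_second, (hw s hs).deriv_sub_eq⟩ (h s hs).2.1 (h s hs).2.2
  filter_upwards [self_mem_nhdsWithin] with t ht
  exact ⟨(hw t ht).memLp_deriv, (hw t ht).memLp_second, (hw t ht).deriv_sub_eq⟩

end


/-! ### Invariance of `[0,1]`, uniqueness, restarting and gluing of solutions. -/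

section

variable {γa γb T : ℝ} {u₀ : ℝ → ℝ} {u v : ℝ → ℝ → ℝ}

theorem IsH2Solution.isC0Path (h : IsH2Solution γa γb u₀ T u) : IsC0Path (Set.Ico 0 T) u :=
  h.continuousIntoH2.isC0Path

theorem IsH2Solution.isC0Path_deriv (h : IsH2Solution γa γb u₀ T u) :
    IsC0Path (Set.Ico 0 T) fun t => deriv (u t) :=
  h.continuousIntoH2.isC0Path_deriv

theorem IsH2Solution.isH2With (h : IsH2Solution γa γb u₀ T u) {t : ℝ} (ht : t ∈ Set.Ico 0 T) :
    IsH2With (u t) (deriv (deriv (u t))) :=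
  (continuousIntoH2_iff.1 h.continuousIntoH2).1 t ht

theorem Icc_subset_Ico_of_lt {b T : ℝ} (hb : b < T) : Set.Icc 0 b ⊆ Set.Ico 0 T :=
  fun _ hx => ⟨hx.1, hx.2.trans_lt hb⟩

theorem IsH2Solution.hasDerivAt (h : IsH2Solution γa γb u₀ T u) {t : ℝ} (ht : t ∈ Set.Ioo 0 T)
    (x : ℝ) : HasDerivAt (fun s => u s x)
      (-(vel γa γb (u t) x * deriv (u t) x + rate γa γb (u t) x * u t x)) t := by
  have := h.equation t ht x
  rwa [(hasDerivAt_flux (h.isH2With ⟨ht.1.le, ht.2⟩).hasDerivAt x).deriv] at this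

theorem deriv_eq_zero_of_forall_le {f : ℝ → ℝ} {x : ℝ} (h : ∀ y, f y ≤ f x) : deriv f x = 0 :=
  IsLocalMax.deriv_eq_zero (Eventually.of_forall h)

theorem deriv_eq_zero_of_forall_ge {f : ℝ → ℝ} {x : ℝ} (h : ∀ y, f x ≤ f y) : deriv f x = 0 :=
  IsLocalMin.deriv_eq_zero (Eventually.of_forall h)

theorem expo_mul_abs_gap_le (ha : 0 < γa) (hb : 0 < γb) {f : ℝ → ℝ} {m : ℝ}
    (hf : ∀ x, |f x| ≤ m) (x : ℝ) :
    |expo γa γb f x * gap γa γb f x| ≤ Real.exp (2 * m) * (2 * (1 / γa + 1 / γb) * m) := by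
  rw [abs_mul]
  gcongr
  · rw [expo, Real.abs_exp]
    refine Real.exp_le_exp.2 ?_
    linarith [(neg_le_abs _).trans (abs_lookAhead_le ha hf x),
      (le_abs_self _).trans (abs_lookBehind_le hb hf x)]
  · exact abs_gap_le ha hb hf x

/-- Solutions with values in `[0,1]` initially keep this property. -/
theorem IsH2Solution.range (ha : 0 < γa) (hb : 0 < γb) (h : IsH2Solution γa γb u₀ T u)
    (h0 : ∀ x, 0 ≤ u₀ x ∧ u₀ x ≤ 1) : ∀ t ∈ Set.Ico 0 T, ∀ x, 0 ≤ u t x ∧ u t x ≤ 1 := by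
  intro b hbT
  have hsub := Icc_subset_Ico_of_lt hbT.2
  have hC := h.isC0Path.mono hsub
  obtain ⟨m, hm, hm'⟩ := hC.exists_abs_le isCompact_Icc
  set K := Real.exp (2 * m) * (2 * (1 / γa + 1 / γb) * m) with hK
  have hK0 : 0 ≤ K := by positivity
  have hEθ : ∀ t ∈ Set.Icc 0 b, ∀ x, |expo γa γb (u t) x * gap γa γb (u t) x| ≤ K :=
    fun t ht => expo_mul_abs_gap_le ha hb (hm' t ht)
  -- At a spatial extremum `u_x` vanishes and only `rate * u` remains, a multiple of `u * (1 - u)`.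
  -- Its zeros at 0 and 1 make the growth linear in the violation, for both bounds.
  have low := hC.neg.le_of_hasDerivWithinAt_le (k := 0) (C := (1 + m) * K) le_rfl
    (fun x => by simpa [h.initial] using (h0 x).1) (fun t ht x hx hmax => by
      refine ⟨fun _ => x, _, rfl, (h.hasDerivAt ⟨ht.1, ht.2.trans_lt hbT.2⟩ x).neg.hasDerivWithinAt,
        ?_⟩
      rw [deriv_eq_zero_of_forall_ge fun y => neg_le_neg_iff.1 (hmax y), rate]
      have h1 := abs_le.1 (hEθ t ⟨ht.1.le, ht.2⟩ x)
      have h2 := abs_le.1 (hm' t ⟨ht.1.le, ht.2⟩ x)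
      have h3 : -((1 - u t x) * (expo γa γb (u t) x * gap γa γb (u t) x)) ≤ (1 + m) * K := by
        have : 0 ≤ 1 - u t x := by linarith
        nlinarith
      nlinarith)
  have up := hC.le_of_hasDerivWithinAt_le (k := 1) (C := (1 + m) * K) zero_le_one
    (fun x => by simpa [h.initial] using (h0 x).2) (fun t ht x hx hmax => by
      refine ⟨fun _ => x, _, rfl, (h.hasDerivAt ⟨ht.1, ht.2.trans_lt hbT.2⟩ x).hasDerivWithinAt,
        ?_⟩
      rw [deriv_eq_zero_of_forall_le hmax, rate]
      have h1 := abs_le.1 (hEθ t ⟨ht.1.le, ht.2⟩ x)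
      have h2 := abs_le.1 (hm' t ⟨ht.1.le, ht.2⟩ x)
      have h3 : expo γa γb (u t) x * gap γa γb (u t) x * u t x ≤ (1 + m) * K := by nlinarith
      nlinarith)
  intro x
  have h1 := low b (Set.right_mem_Icc.2 hbT.1) x
  exact ⟨by linarith, up b (Set.right_mem_Icc.2 hbT.1) x⟩

theorem ContinuousIntoH2.mono {T' : ℝ} (h : ContinuousIntoH2 T u) (hT : T' ≤ T) :
    ContinuousIntoH2 T' u := by
  obtain ⟨w, hw, h⟩ := h
  have hsub : Set.Ico 0 T' ⊆ Set.Ico 0 T := Set.Ico_subset_Ico_right hT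
  refine ⟨w, fun t ht => hw t (hsub ht), fun s hs => ?_⟩
  obtain ⟨h1, h2, h3⟩ := h s (hsub hs)
  have hle := nhdsWithin_mono s hsub
  exact ⟨h1.mono_left hle, h2.mono_left hle, h3.mono_left hle⟩

theorem IsH2Solution.mono {T' : ℝ} (h : IsH2Solution γa γb u₀ T u) (hT : T' ≤ T) :
    IsH2Solution γa γb u₀ T' u :=
  ⟨h.continuousIntoH2.mono hT, h.initial, fun t ht => h.equation t ⟨ht.1, ht.2.trans_le hT⟩⟩

/-- Uniqueness of solutions with values in `[0,1]`. -/
theorem IsH2Solution.eq (ha : 0 < γa) (hb : 0 < γb) (hu : IsH2Solution γa γb u₀ T u)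
    (hv : IsH2Solution γa γb u₀ T v) (h0 : ∀ x, 0 ≤ u₀ x ∧ u₀ x ≤ 1) :
    ∀ t ∈ Set.Ico 0 T, u t = v t := by
  intro b hbT
  have hsub := Icc_subset_Ico_of_lt hbT.2
  obtain ⟨L, hL, hL'⟩ := (hu.isC0Path_deriv.mono hsub).exists_abs_le isCompact_Icc
  obtain ⟨Λ, hΛ, hΛ'⟩ := coeff_sub_le ha hb
  have ru := hu.range ha hb h0
  have rv := hv.range ha hb h0
  -- The square treats both signs at once. At a positive maximum of it the two space derivatives
  -- coincide, so the difference of the transport terms is the difference of the speeds times one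
  -- bounded derivative.
  have hC := ((hu.isC0Path.mono hsub).sub (hv.isC0Path.mono hsub)).sq
  have key := hC.le_of_hasDerivWithinAt_le (k := 0) (C := 2 * (Λ * L + Λ * 1 + Λ * 1)) le_rfl
    (fun x => by simp [hu.initial, hv.initial]) (fun t ht x hx hmax => by
      have htT : t ∈ Set.Ioo 0 T := ⟨ht.1, ht.2.trans_lt hbT.2⟩
      have htI : t ∈ Set.Ico 0 T := ⟨ht.1.le, htT.2⟩
      refine ⟨fun _ => x, _, rfl,
        (((hu.hasDerivAt htT x).sub (hv.hasDerivAt htT x)).pow 2).hasDerivWithinAt, ?_⟩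
      set ε := |u t x - v t x| with hε
      have hεpos : 0 < ε := abs_pos.2 fun h => by simp [h] at hx
      have hdiff : ∀ y, |u t y - v t y| ≤ ε := fun y => sq_le_sq.1 (hmax y)
      have hU := hu.isH2With htI
      have hV := hv.isH2With htI
      have hdd : deriv (v t) x = deriv (u t) x := by
        have h1 := ((hU.hasDerivAt x).sub (hV.hasDerivAt x)).pow 2
        have h2 := deriv_eq_zero_of_forall_le (f := (u t - v t) ^ 2) hmax
        rw [h1.deriv] at h2
        have h3 : u t x - v t x ≠ 0 := abs_pos.1 hεpos
        simp only [Pi.sub_apply, Nat.cast_ofNat, Nat.add_one_sub_one, pow_one, mul_eq_zero,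
          OfNat.ofNat_ne_zero, false_or] at h2
        rcases h2 with h2 | h2
        · exact absurd h2 h3
        · linarith
      have hau : ∀ y, |u t y| ≤ 1 := fun y => abs_le.2 ⟨by linarith [(ru t htI y).1], (ru t htI y).2⟩
      have hav : ∀ y, |v t y| ≤ 1 := fun y => abs_le.2 ⟨by linarith [(rv t htI y).1], (rv t htI y).2⟩
      obtain ⟨c1, c2⟩ := hΛ' (u t) (v t) ε hU.continuous hV.continuous
        (fun y => (hau y).trans one_le_two) (fun y => (hav y).trans one_le_two) hdiff x
      -- The rate of the zero function vanishes, so the Lipschitz estimate also bounds the rate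
      -- itself.
      have c3 := (hΛ' (v t) (fun _ => 0) 1 hV.continuous continuous_const
        (fun y => (hav y).trans one_le_two) (fun y => by simp) (fun y => by simpa using hav y) x).2
      have hz : rate γa γb (fun _ => 0) x = 0 := by simp [rate, gap]
      rw [hz, sub_zero] at c3
      have hd := hL' t ⟨ht.1.le, ht.2⟩ x
      rw [hdd]
      set p := vel γa γb (u t) x - vel γa γb (v t) x with hp
      set q := rate γa γb (u t) x - rate γa γb (v t) x with hq
      set e := u t x - v t x with he
      have heq : -(vel γa γb (u t) x * deriv (u t) x + rate γa γb (u t) x * u t x)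
          - -(vel γa γb (v t) x * deriv (u t) x + rate γa γb (v t) x * v t x)
          = -(p * deriv (u t) x + q * u t x + rate γa γb (v t) x * e) := by
        rw [hp, hq, he]; ring
      rw [heq]
      have hb1 : |p * deriv (u t) x + q * u t x + rate γa γb (v t) x * e|
          ≤ Λ * ε * L + Λ * ε * 1 + Λ * 1 * ε := by
        refine (abs_add_three _ _ _).trans (add_le_add_three ?_ ?_ ?_) <;> rw [abs_mul]
        · gcongr
        · gcongr; exact hau x
        · gcongr
      simp only [Pi.sub_apply, Nat.cast_ofNat, Nat.add_one_sub_one, pow_one, sub_zero]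
      rw [← he]
      have h5 : 2 * e * -(p * deriv (u t) x + q * u t x + rate γa γb (v t) x * e)
          ≤ 2 * ε * (Λ * ε * L + Λ * ε * 1 + Λ * 1 * ε) := by
        refine (le_abs_self _).trans ?_
        rw [abs_mul, abs_neg, abs_mul, abs_two, ← hε]
        gcongr
      refine h5.trans (le_of_eq ?_)
      rw [← sq_abs e, ← hε]
      ring)
  ext x
  have h1 := key b (Set.right_mem_Icc.2 hbT.1) x
  have h2 := pow_eq_zero_iff (two_ne_zero) |>.1 (le_antisymm h1 (sq_nonneg _))
  linarith

/-- Restarting a solution at a positive time. -/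
theorem IsH2Solution.shift (h : IsH2Solution γa γb u₀ T u) {s : ℝ} (hs : s ∈ Set.Ico 0 T) :
    IsH2Solution γa γb (u s) (T - s) fun r => u (s + r) := by
  obtain ⟨h1, h2⟩ := continuousIntoH2_iff.1 h.continuousIntoH2
  have hmaps : ∀ r ∈ Set.Ico 0 (T - s), s + r ∈ Set.Ico 0 T := fun r hr =>
    ⟨by linarith [hr.1, hs.1], by linarith [hr.2]⟩
  refine ⟨continuousIntoH2_iff.2 ⟨fun r hr => h1 _ (hmaps r hr), fun r hr => ?_⟩, by simp,
    fun r hr x => ?_⟩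
  · have ht : Tendsto (fun r => s + r) (𝓝[Set.Ico 0 (T - s)] r) (𝓝[Set.Ico 0 T] (s + r)) :=
      (continuous_const.add continuous_id).continuousWithinAt.tendsto_nhdsWithin hmaps
    obtain ⟨a1, a2, a3⟩ := h2 _ (hmaps r hr)
    exact ⟨a1.comp ht, a2.comp ht, a3.comp ht⟩
  · have := h.equation (s + r) ⟨by linarith [hr.1, hs.1], by linarith [hr.2]⟩ x
    exact this.comp_const_add s r

/-- A family which is locally in time given by shifted solutions is a solution. -/
theorem IsH2Solution.of_locally (h0 : u 0 = u₀) (h : ∀ t ∈ Set.Ico 0 T, ∃ (s T₁ : ℝ) (f : ℝ → ℝ)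
    (v : ℝ → ℝ → ℝ), IsH2Solution γa γb f T₁ v ∧ s ≤ t ∧ t < s + T₁ ∧ (s = 0 ∨ s < t) ∧
      ∀ r ∈ Set.Ico s (s + T₁), r < T → u r = v (r - s)) : IsH2Solution γa γb u₀ T u := by
  refine ⟨continuousIntoH2_iff.2 ⟨fun t ht => ?_, fun t ht => ?_⟩, h0, fun t ht x => ?_⟩
  · obtain ⟨s, T₁, f, v, hv, hst, htT, -, heq⟩ := h t ht
    rw [heq t ⟨hst, htT⟩ ht.2]
    exact hv.isH2With ⟨by linarith, by linarith⟩
  · obtain ⟨s, T₁, f, v, hv, hst, htT, hs0, heq⟩ := h t ht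
    have hmem : ∀ᶠ r in 𝓝[Set.Ico 0 T] t, r ∈ Set.Ico s (s + T₁) ∧ r < T := by
      filter_upwards [self_mem_nhdsWithin, mem_nhdsWithin_of_mem_nhds (Iio_mem_nhds htT),
        show ∀ᶠ r in 𝓝[Set.Ico 0 T] t, s ≤ r by
          rcases hs0 with rfl | hs0
          · filter_upwards [self_mem_nhdsWithin] with r hr using hr.1
          · filter_upwards [mem_nhdsWithin_of_mem_nhds (Ioi_mem_nhds hs0)] with r hr
            exact le_of_lt hr] with r h1 h2 h3
      exact ⟨⟨h3, h2⟩, h1.2⟩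
    have hshift : Tendsto (fun r => r - s) (𝓝[Set.Ico 0 T] t) (𝓝[Set.Ico 0 T₁] (t - s)) := by
      refine tendsto_nhdsWithin_iff.2 ⟨?_, ?_⟩
      · exact ((continuous_id.sub continuous_const).tendsto t).mono_left nhdsWithin_le_nhds
      · filter_upwards [hmem] with r hr
        exact ⟨by linarith [hr.1.1], by linarith [hr.1.2]⟩
    have htm : t - s ∈ Set.Ico 0 T₁ := ⟨by linarith, by linarith⟩
    obtain ⟨a1, a2, a3⟩ := (continuousIntoH2_iff.1 hv.continuousIntoH2).2 _ htm
    rw [heq t ⟨hst, htT⟩ ht.2]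
    refine ⟨(a1.comp hshift).congr' ?_, (a2.comp hshift).congr' ?_, (a3.comp hshift).congr' ?_⟩ <;>
    · filter_upwards [hmem] with r hr
      simp only [Function.comp_apply]
      rw [heq r hr.1 hr.2]
  · obtain ⟨s, T₁, f, v, hv, hst, htT, hs0, heq⟩ := h t ⟨ht.1.le, ht.2⟩
    -- A two-sided time derivative requires `t` to be interior to the piece; when `s = 0` this
    -- follows from `t > 0`.
    have hst' : s < t := by
      rcases hs0 with rfl | hs0
      exacts [ht.1, hs0]
    have h1 := hv.equation (t - s) ⟨by linarith, by linarith⟩ x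
    rw [heq t ⟨hst, htT⟩ ht.2]
    refine (h1.comp_sub_const t s).congr_of_eventuallyEq ?_
    filter_upwards [Ioi_mem_nhds hst', Iio_mem_nhds htT, Iio_mem_nhds ht.2] with r h1 h2 h3
    rw [heq r ⟨le_of_lt h1, h2⟩ h3]

theorem hasDerivWithinAt_comp_sub_const {f : ℝ → ℝ} {f' s t r : ℝ} {S : Set ℝ}
    (h : HasDerivWithinAt f f' S r) (hr : t - s = r) :
    HasDerivWithinAt (fun x => f (x - s)) f' ((fun x => x - s) ⁻¹' S) t := by
  subst hr
  have h2 : HasDerivWithinAt (fun x => x - s) 1 ((fun x => x - s) ⁻¹' S) t :=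
    ((hasDerivAt_id t).sub_const s).hasDerivWithinAt
  have := h.comp t h2 (Set.mapsTo_preimage _ _)
  rw [mul_one] at this
  exact this

/-- Every solution with values in `[0,1]` has characteristics. -/
theorem IsH2Solution.hasCharacteristics (ha : 0 < γa) (hb : 0 < γb)
    (h : IsH2Solution γa γb u₀ T u) (h0 : ∀ x, 0 ≤ u₀ x ∧ u₀ x ≤ 1) :
    HasCharacteristics γa γb T u := by
  intro t ht x
  have hran := h.range ha hb h0
  obtain ⟨L, hL, hL'⟩ := (h.isC0Path_deriv.mono (Icc_subset_Ico_of_lt ht.2)).exists_abs_le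
    isCompact_Icc
  obtain ⟨τ, hτ, hloc⟩ := exists_local_solution ha hb L hL
  -- Restart shortly before `t`: the constructed local solution still covers `t`, and by uniqueness
  -- it coincides with `u`, which thereby inherits its characteristics.
  set s := max 0 (t - τ / 2) with hs
  have hs0 : 0 ≤ s := le_max_left _ _
  have hst : s ≤ t := max_le ht.1 (by linarith)
  have hts : t - s < τ := by linarith [le_max_right 0 (t - τ / 2)]
  have hsI : s ∈ Set.Ico 0 T := ⟨hs0, hst.trans_lt ht.2⟩
  obtain ⟨v, hv, hchar⟩ := hloc (u s) ⟨_, h.isH2With hsI⟩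
    (fun y => abs_le.2 ⟨by linarith [(hran s hsI y).1], (hran s hsI y).2⟩) (hL' s ⟨hs0, hst⟩)
  set τ' := min τ (T - s) with hτ'
  have heq : ∀ r ∈ Set.Ico 0 τ', u (s + r) = v r :=
    ((h.shift hsI).mono (min_le_right _ _)).eq ha hb (hv.mono (min_le_left _ _)) (hran s hsI)
  have htm : t - s ∈ Set.Ico 0 τ' := ⟨by linarith, lt_min hts (by linarith [ht.2])⟩
  obtain ⟨ξ, hξ, hd⟩ := hchar (t - s) ⟨htm.1, hts⟩ x
  refine ⟨fun r => ξ (r - s), hξ, ?_⟩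
  rw [← heq _ htm, add_sub_cancel] at hd
  have hmem : ∀ᶠ r in 𝓝[Set.Ico 0 T] t, r - s ∈ Set.Ico 0 τ' := by
    have hlt : t < s + τ' := by linarith [htm.2]
    filter_upwards [mem_nhdsWithin_of_mem_nhds (Iio_mem_nhds hlt),
      show ∀ᶠ r in 𝓝[Set.Ico 0 T] t, s ≤ r by
        rcases le_or_gt (t - τ / 2) 0 with h1 | h1
        · rw [hs, max_eq_left h1]
          filter_upwards [self_mem_nhdsWithin] with r hr using hr.1
        · have : s < t := by rw [hs, max_eq_right h1.le]; linarith
          filter_upwards [mem_nhdsWithin_of_mem_nhds (Ioi_mem_nhds this)] with r hr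
          exact le_of_lt hr] with r h1 h2
    exact ⟨by linarith, by linarith [Set.mem_Iio.1 h1]⟩
  have hd' := hasDerivWithinAt_comp_sub_const
    (hd.mono (Set.Ico_subset_Ico_right (min_le_left τ (T - s)))) rfl
  refine (hd'.mono_of_mem_nhdsWithin hmem).congr_of_eventuallyEq ?_ ?_
  · filter_upwards [hmem] with r hr
    rw [← heq _ hr, add_sub_cancel]
  · rw [← heq _ htm, add_sub_cancel]

end


/-! ### Pointwise inequalities for the evolution of `u_x`. -/

section

variable {γa γb : ℝ} {f : ℝ → ℝ}

theorem gap_le (ha : 0 < γa) (hb : 0 < γb) {m : ℝ} (hm : ∀ x, m ≤ f x) (x : ℝ) :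
    gap γa γb f x ≤ (1 / γa + 1 / γb) * (f x - m) := by
  calc gap γa γb f x ≤ (f x - m) / γa + (f x - m) / γb := by
        unfold gap; gcongr <;> exact hm _
    _ = _ := by ring

theorem le_gap (ha : 0 < γa) (hb : 0 < γb) {M : ℝ} (hM : ∀ x, f x ≤ M) (x : ℝ) :
    (1 / γa + 1 / γb) * (f x - M) ≤ gap γa γb f x := by
  calc _ = (f x - M) / γa + (f x - M) / γb := by ring
    _ ≤ _ := by unfold gap; gcongr <;> exact hM _

theorem one_third_le_expo (ha : 0 < γa) (hb : 0 < γb) (hf : ∀ x, 0 ≤ f x ∧ f x ≤ 1) (x : ℝ) :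
    1 / 3 ≤ expo γa γb f x := by
  have h1 : lookAhead γa f x ≤ 1 := (le_abs_self _).trans (abs_lookAhead_le ha
    (fun x => abs_le.2 ⟨by linarith [(hf x).1], (hf x).2⟩) x)
  have h2 : 0 ≤ lookBehind γb f x := by
    rw [lookBehind_eq hb]
    exact intervalIntegral.integral_nonneg zero_le_one fun r _ => (hf _).1
  calc (1 : ℝ) / 3 ≤ 1 / Real.exp 1 := by
        have := exp_one_le_three
        have := Real.exp_pos 1
        gcongr
    _ = Real.exp (-1) := by rw [Real.exp_neg, one_div]
    _ ≤ _ := Real.exp_le_exp.2 (by linarith)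

/-- The quadratic lower bound for the right-hand side. -/
theorem quadratic_le {K φ θ κ M ℓ : ℝ} (hK : 0 < K) (h0 : 0 ≤ φ) (h1 : φ ≤ 1)
    (hθ : θ ≤ K * φ) (hθ' : K * (φ - 1) ≤ θ) (hM : 0 ≤ M) (hℓ : ℓ ≤ M) (hκ : κ ≤ K * (M - ℓ)) :
    2 * M ^ 2 - 2 * K * M - K ^ 2 / 4 + K * ℓ / 4
      ≤ 2 * M ^ 2 - 2 * (1 - 2 * φ) * θ * M - φ * (1 - φ) * (θ ^ 2 + κ) := by
  have hp : 0 ≤ φ * (1 - φ) := mul_nonneg h0 (by linarith)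
  have hp' : φ * (1 - φ) ≤ 1 / 4 := by nlinarith [sq_nonneg (φ - 1 / 2)]
  -- The constant is not sharp. With the contribution `K * M / 4` of `κ`, the terms linear in `M`
  -- amount to at most `(3 / 4) * K * M`, well within the allowed `2 * K * M`.
  have hA : (1 - 2 * φ) * θ ≤ K * (1 / 4) := by
    rcases le_total φ (1 / 2) with h | h
    · calc (1 - 2 * φ) * θ ≤ (1 - 2 * φ) * (K * φ) := by gcongr; linarith
        _ = K * ((1 - 2 * φ) * φ) := by ring
        _ ≤ _ := by gcongr; nlinarith [sq_nonneg (φ - 1 / 4)]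
    · calc (1 - 2 * φ) * θ = (2 * φ - 1) * -θ := by ring
        _ ≤ (2 * φ - 1) * (K * (1 - φ)) := by gcongr <;> linarith
        _ = K * ((2 * φ - 1) * (1 - φ)) := by ring
        _ ≤ _ := by gcongr; nlinarith [sq_nonneg (φ - 3 / 4)]
  have hθK : θ ^ 2 ≤ K ^ 2 := by
    apply sq_le_sq'
    · nlinarith
    · nlinarith
  have hB : φ * (1 - φ) * (θ ^ 2 + κ) ≤ 1 / 4 * (K ^ 2 + K * (M - ℓ)) := by
    have : 0 ≤ K ^ 2 + K * (M - ℓ) := by have := sub_nonneg.2 hℓ; positivity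
    calc _ ≤ φ * (1 - φ) * (K ^ 2 + K * (M - ℓ)) := by gcongr
      _ ≤ _ := by gcongr
  have hAM := mul_le_mul_of_nonneg_right hA hM
  have hKM := mul_nonneg hK.le hM
  nlinarith

/-- The sign of the right-hand side at a minimum below `-K`. -/
theorem quadratic_nonneg_of_min {K φ θ κ s : ℝ} (hK : 0 < K) (h0 : 0 ≤ φ) (h1 : φ ≤ 1)
    (hθ : θ ≤ K * φ) (hθ' : K * (φ - 1) ≤ θ) (hs : s ≤ -K) (hκ : κ ≤ 0) :
    0 ≤ 2 * s ^ 2 - 2 * (1 - 2 * φ) * θ * s - φ * (1 - φ) * (θ ^ 2 + κ) := by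
  have hp : 0 ≤ φ * (1 - φ) := mul_nonneg h0 (by linarith)
  have hθK : θ ^ 2 ≤ K ^ 2 := by
    apply sq_le_sq'
    · nlinarith
    · nlinarith
  have hB : φ * (1 - φ) * (θ ^ 2 + κ) ≤ φ * (1 - φ) * K ^ 2 := by gcongr; linarith
  -- With `p = φ * (1 - φ)` and `σ = -s ≥ K`, this bounds the expression below by `2 * σ * (σ - K) +
  -- p * (2 * K * σ - K ^ 2)`, and both terms are nonnegative.
  have hA : -(K * (1 - φ * (1 - φ))) ≤ (1 - 2 * φ) * θ := by
    rcases le_total φ (1 / 2) with h | h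
    · have : (1 - 2 * φ) * (K * (φ - 1)) ≤ (1 - 2 * φ) * θ := by gcongr; linarith
      have h3 : K * (3 * φ - 2 * φ ^ 2) ≥ K * (φ * (1 - φ)) :=
        mul_le_mul_of_nonneg_left (by nlinarith) hK.le
      nlinarith
    · have : (2 * φ - 1) * θ ≤ (2 * φ - 1) * (K * φ) := by gcongr; linarith
      have h3 : K * ((1 - φ) * (1 + 2 * φ)) ≥ K * (φ * (1 - φ)) :=
        mul_le_mul_of_nonneg_left (by nlinarith) hK.le
      nlinarith
  have hq : φ * (1 - φ) ≤ 1 / 4 := by nlinarith [sq_nonneg (φ - 1 / 2)]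
  have hKq : 0 ≤ K * (φ * (1 - φ)) := by positivity
  have hs0 : 0 ≤ -s := by linarith
  have h5 := mul_le_mul_of_nonneg_right hA hs0
  have h6 : K * (φ * (1 - φ)) * K ≤ K * (φ * (1 - φ)) * -s := by gcongr; linarith
  nlinarith [mul_nonneg hs0 (by linarith : 0 ≤ -s - K)]

/-- Since `R` is a root, the quadratic at `d = deriv f x` equals `2 * (d - R) ^ 2 + (4 * R - 2 * K)
* (d - R)`, and `K ≤ 2 * R` makes the last term nonnegative. The exponential factor is at least 1/3.
-/
theorem le_charRHS (ha : 0 < γa) (hb : 0 < γb) (hf : ∀ x, 0 ≤ f x ∧ f x ≤ 1) {ℓ R x : ℝ}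
    (hℓ : ∀ y, ℓ ≤ deriv f y)
    (hR : 1 / γa + 1 / γb ≤ 2 * R)
    (hRq : 2 * R ^ 2 - 2 * (1 / γa + 1 / γb) * R - (1 / γa + 1 / γb) ^ 2 / 4
      + (1 / γa + 1 / γb) * ℓ / 4 = 0) (hx : R ≤ deriv f x) :
    2 / 3 * (deriv f x - R) ^ 2 ≤ charRHS γa γb f x := by
  set K := 1 / γa + 1 / γb with hK
  have hK0 : 0 < K := by positivity
  have h1 := gap_le ha hb (fun x => (hf x).1) x
  rw [sub_zero] at h1
  have h2 := quadratic_le hK0 (hf x).1 (hf x).2 h1 (le_gap ha hb (fun x => (hf x).2) x)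
    (by linarith : 0 ≤ deriv f x) (hℓ x) (gap_le ha hb hℓ x)
  have h3 := one_third_le_expo ha hb hf x
  have h4 : 2 * (deriv f x - R) ^ 2 ≤ 2 * deriv f x ^ 2 - 2 * K * deriv f x - K ^ 2 / 4
      + K * ℓ / 4 := by
    nlinarith [mul_nonneg (sub_nonneg.2 hR) (sub_nonneg.2 hx)]
  rw [charRHS]
  calc _ = 1 / 3 * (2 * (deriv f x - R) ^ 2) := by ring
    _ ≤ _ := by
      have h5 := h4.trans h2
      gcongr

/-- At a minimum of `deriv f` all increments in `gap γa γb (deriv f) x` are nonpositive, which gives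
the sign of `κ` required by `quadratic_nonneg_of_min`. -/
theorem charRHS_nonneg_of_min (ha : 0 < γa) (hb : 0 < γb) (hf : ∀ x, 0 ≤ f x ∧ f x ≤ 1) {x : ℝ}
    (hmin : ∀ y, deriv f x ≤ deriv f y) (hx : deriv f x ≤ -(1 / γa + 1 / γb)) :
    0 ≤ charRHS γa γb f x := by
  have h1 := gap_le ha hb (fun x => (hf x).1) x
  rw [sub_zero] at h1
  have h2 := gap_le ha hb hmin x
  rw [sub_self, mul_zero] at h2
  exact mul_nonneg (Real.exp_pos _).le (quadratic_nonneg_of_min (by positivity) (hf x).1 (hf x).2 h1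
    (le_gap ha hb (fun x => (hf x).2) x) hx h2)

end

section

variable {γa γb T : ℝ} {u₀ : ℝ → ℝ} {u : ℝ → ℝ → ℝ}

/-- A lower bound for `u_x` below `-K` is preserved. -/
theorem IsH2Solution.le_deriv (ha : 0 < γa) (hb : 0 < γb) (h : IsH2Solution γa γb u₀ T u)
    (h0 : ∀ x, 0 ≤ u₀ x ∧ u₀ x ≤ 1) {ℓ : ℝ} (hℓ : ℓ ≤ -(1 / γa + 1 / γb))
    (hℓ0 : ∀ x, ℓ ≤ deriv u₀ x) : ∀ t ∈ Set.Ico 0 T, ∀ x, ℓ ≤ deriv (u t) x := by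
  intro b hbT x
  have hsub := Icc_subset_Ico_of_lt hbT.2
  have hK0 : 0 < 1 / γa + 1 / γb := by positivity
  have := (h.isC0Path_deriv.mono hsub).neg.le_of_hasDerivWithinAt_le (k := -ℓ) (C := 0)
    (by linarith) (fun x => neg_le_neg (by rw [h.initial]; exact hℓ0 x)) (fun t ht x hx hmax => by
      have htT : t ∈ Set.Ico 0 T := ⟨ht.1.le, ht.2.trans_lt hbT.2⟩
      obtain ⟨ξ, hξ, hd⟩ := h.hasCharacteristics ha hb h0 t htT x
      refine ⟨ξ, _, hξ, (hd.mono (Icc_subset_Ico_of_lt htT.2)).neg, ?_⟩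
      rw [zero_mul, neg_nonpos]
      exact charRHS_nonneg_of_min ha hb (h.range ha hb h0 t htT) (fun y => neg_le_neg_iff.1 (hmax y))
        (by linarith)) b (Set.right_mem_Icc.2 hbT.1) x
  linarith

/-- The excess of `sup u_x` over the level `R`. -/
def excess (R : ℝ) (u : ℝ → ℝ → ℝ) (t : ℝ) : ℝ := max ((⨆ x, deriv (u t) x) - R) 0

theorem IsH2Solution.continuousOn_excess (h : IsH2Solution γa γb u₀ T u) (R : ℝ) :
    ContinuousOn (excess R u) (Set.Ico 0 T) :=
  (h.isC0Path_deriv.continuousOn_iSup.sub continuousOn_const).sup continuousOn_const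

/-- The supremum need not be differentiable, so the inequality is stated with slopes to the right.
Above `R`, start the characteristic curve at a maximum point: later suprema dominate `u_x` along it.
At or below `R` the truncated excess is 0 and can only grow. -/
theorem IsH2Solution.frequently_lt_slope_excess (ha : 0 < γa) (hb : 0 < γb)
    (h : IsH2Solution γa γb u₀ T u) (h0 : ∀ x, 0 ≤ u₀ x ∧ u₀ x ≤ 1) {ℓ R : ℝ}
    (hℓ : ℓ ≤ -(1 / γa + 1 / γb)) (hℓ0 : ∀ x, ℓ ≤ deriv u₀ x) (hR : 1 / γa + 1 / γb ≤ 2 * R)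
    (hRq : 2 * R ^ 2 - 2 * (1 / γa + 1 / γb) * R - (1 / γa + 1 / γb) ^ 2 / 4
      + (1 / γa + 1 / γb) * ℓ / 4 = 0) {t : ℝ} (ht : t ∈ Set.Ico 0 T) {r : ℝ}
    (hr : r < 2 / 3 * excess R u t ^ 2) : ∃ᶠ z in 𝓝[>] t, r < slope (excess R u) t z := by
  have hK0 : 0 < 1 / γa + 1 / γb := by positivity
  have hC := h.isC0Path_deriv
  refine Eventually.frequently ?_
  rcases le_or_gt (⨆ x, deriv (u t) x) R with hM | hM
  · have hY : excess R u t = 0 := max_eq_right (by linarith)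
    rw [hY] at hr
    filter_upwards [self_mem_nhdsWithin] with z hz
    rw [slope_def_field, hY, sub_zero]
    have h1 : 0 ≤ excess R u z := le_max_right _ _
    have h2 : 0 < z - t := sub_pos.2 hz
    have := div_nonneg h1 h2.le
    linarith
  · obtain ⟨x, hx⟩ := hC.exists_eq_iSup ht (by linarith)
    have hY : excess R u t = deriv (u t) x - R := by
      rw [excess, max_eq_left (by linarith), hx]
    obtain ⟨ξ, hξ, hd⟩ := h.hasCharacteristics ha hb h0 t ht x
    have hge := le_charRHS ha hb (h.range ha hb h0 t ht) (h.le_deriv ha hb h0 hℓ hℓ0 t ht)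
      hR hRq (by rw [hx]; exact hM.le)
    rw [← hY] at hge
    have hsub : 𝓝[Set.Ioo t T] t ≤ 𝓝[Set.Ico 0 T \ {t}] t :=
      nhdsWithin_mono _ fun z hz => ⟨⟨ht.1.trans hz.1.le, hz.2⟩, hz.1.ne'⟩
    have hslope := ((hasDerivWithinAt_iff_tendsto_slope.1 hd).mono_left hsub).eventually
      (lt_mem_nhds (hr.trans_le hge))
    rw [nhdsWithin_Ioo_eq_nhdsGT ht.2] at hslope
    filter_upwards [hslope, Ioo_mem_nhdsGT ht.2] with z hz hzI
    refine hz.trans_le ?_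
    rw [slope_def_field, slope_def_field, hξ, hY]
    have h3 : 0 < z - t := sub_pos.2 hzI.1
    have h4 : deriv (u z) (ξ z) ≤ ⨆ x, deriv (u z) x :=
      hC.le_iSup (t := z) ⟨ht.1.trans hzI.1.le, hzI.2⟩ (ξ z)
    have h5 : (⨆ x, deriv (u z) x) - R ≤ excess R u z := le_max_left _ _
    exact div_le_div_of_nonneg_right (by linarith) h3.le

end

/-! ### Comparison for a Riccati inequality with Dini derivatives. -/

section Riccati

variable {Y : ℝ → ℝ} {a b : ℝ}

theorem le_of_riccati (hc : ContinuousOn Y (Set.Icc a b)) (hab : a ≤ b)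
    (hs : ∀ t ∈ Set.Ico a b, ∀ r < 2 / 3 * Y t ^ 2, ∃ᶠ z in 𝓝[>] t, r < slope Y t z)
    {B B' : ℝ → ℝ} (ha : B a ≤ Y a) (hB : ContinuousOn B (Set.Icc a b))
    (hB' : ∀ t ∈ Set.Ico a b, HasDerivWithinAt B (B' t) (Set.Ici t) t)
    (bound : ∀ t ∈ Set.Ico a b, Y t = B t → B' t < 2 / 3 * Y t ^ 2) : B b ≤ Y b := by
  have := image_le_of_liminf_slope_right_lt_deriv_boundary' (f := fun t => -Y t)
    (f' := fun t => -(2 / 3 * Y t ^ 2)) (B := fun t => -B t) (B' := fun t => -B' t) hc.neg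
    (fun t ht r hr => (hs t ht (-r) (by linarith)).mono fun z hz => by
      rw [slope_def_field] at hz ⊢
      have : (-Y z - -Y t) / (z - t) = -((Y z - Y t) / (z - t)) := by ring
      linarith) (neg_le_neg ha) hB.neg (fun t ht => (hB' t ht).neg)
    (fun t ht heq => neg_lt_neg (bound t ht (neg_inj.1 heq))) (Set.right_mem_Icc.2 hab)
  linarith

/-- A constant is a strict barrier as soon as `Y a > 0`; when `Y a = 0`, nonnegativity is enough. -/
theorem mono_of_riccati (hc : ContinuousOn Y (Set.Icc a b)) (hab : a ≤ b)
    (h0 : ∀ t ∈ Set.Icc a b, 0 ≤ Y t)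
    (hs : ∀ t ∈ Set.Ico a b, ∀ r < 2 / 3 * Y t ^ 2, ∃ᶠ z in 𝓝[>] t, r < slope Y t z) :
    Y a ≤ Y b := by
  rcases (h0 a (Set.left_mem_Icc.2 hab)).eq_or_lt with h | h
  · rw [← h]
    exact h0 b (Set.right_mem_Icc.2 hab)
  · refine le_of_riccati (B := fun _ => Y a) (B' := fun _ => 0) hc hab hs le_rfl
      continuousOn_const (fun t _ => hasDerivWithinAt_const _ _ _) fun t _ heq => ?_
    rw [heq]
    positivity

/-- The barrier starting at `Y a` and solving `B' = B ^ 2 / 2` is strict because `1 / 2 < 2 / 3`. It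
becomes infinite at time `a + 2 / Y a`, which a function continuous up to that time cannot follow.
-/
theorem lt_of_riccati (hc : ContinuousOn Y (Set.Icc a b)) (hab : a ≤ b)
    (hs : ∀ t ∈ Set.Ico a b, ∀ r < 2 / 3 * Y t ^ 2, ∃ᶠ z in 𝓝[>] t, r < slope Y t z)
    (hpos : 0 < Y a) : b - a < 2 / Y a := by
  by_contra! hle
  obtain ⟨m, hm⟩ := isCompact_Icc.bddAbove_image hc
  have hm' : ∀ t ∈ Set.Icc a b, Y t ≤ m := fun t ht => hm (Set.mem_image_of_mem _ ht)
  have hma := hm' a (Set.left_mem_Icc.2 hab)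
  set y := Y a with hy
  set N := m + 1 with hN
  have hN0 : 0 < N := by linarith
  have hyN : 1 / N ≤ 1 / y := by gcongr; linarith
  -- The time at which the barrier equals `N = m + 1`, above every value of `Y`.
  set t := a + 2 * (1 / y - 1 / N) with ht
  have hNinv : 0 < 1 / N := by positivity
  have hat : a ≤ t := by linarith
  have htb : t ≤ b := by
    have : 2 / y = 2 * (1 / y) := by ring
    linarith
  have hden : ∀ r ≤ t, 0 < 1 / y - (r - a) / 2 := fun r hr => by linarith
  have hsub : Set.Icc a t ⊆ Set.Icc a b := Set.Icc_subset_Icc_right htb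
  have hder : ∀ r ≤ t, HasDerivAt (fun r => (1 / y - (r - a) / 2)⁻¹)
      (1 / 2 / (1 / y - (r - a) / 2) ^ 2) r := fun r hr => by
    have h1 := ((((hasDerivAt_id r).sub_const a).div_const 2).const_sub (1 / y)).inv (hden r hr).ne'
    refine HasDerivAt.congr_deriv h1 ?_
    simp
  have key := le_of_riccati (B := fun r => (1 / y - (r - a) / 2)⁻¹)
    (B' := fun r => 1 / 2 / (1 / y - (r - a) / 2) ^ 2) (hc.mono hsub) hat
    (fun r hr => hs r ⟨hr.1, hr.2.trans_le htb⟩) (by simp [hy])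
    (fun r hr => (hder r hr.2).continuousAt.continuousWithinAt)
    (fun r hr => (hder r hr.2.le).hasDerivWithinAt) fun r hr heq => by
      rw [heq]
      have := hden r hr.2.le
      rw [inv_pow, ← div_eq_mul_inv]
      exact div_lt_div_of_pos_right (by norm_num) (by positivity)
  have h1 : 1 / y - (t - a) / 2 = 1 / N := by rw [ht]; ring
  beta_reduce at key
  rw [h1, one_div, inv_inv] at key
  linarith [hm' t ⟨hat, htb⟩]

end Riccati


/-! ### Continuation, the maximal solution and blow-up. -/

section

variable {γa γb T : ℝ} {u₀ : ℝ → ℝ} {u : ℝ → ℝ → ℝ}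

/-- A solution whose space derivative stays bounded can be continued. -/
theorem IsH2Solution.exists_extension (ha : 0 < γa) (hb : 0 < γb) (hT : 0 < T)
    (h : IsH2Solution γa γb u₀ T u) (h0 : ∀ x, 0 ≤ u₀ x ∧ u₀ x ≤ 1) {L : ℝ} (hL : 0 ≤ L)
    (hL' : ∀ t ∈ Set.Ico 0 T, ∀ x, |deriv (u t) x| ≤ L) :
    ∃ T' > T, ∃ v, IsH2Solution γa γb u₀ T' v := by
  have hran := h.range ha hb h0
  obtain ⟨τ, hτ, hloc⟩ := exists_local_solution ha hb L hL
  -- Restarting less than `τ` before `T` pushes the local solution past `T`, as `τ` depends only on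
  -- `L`.
  obtain ⟨s, hs0, hsT, hTs⟩ : ∃ s, 0 ≤ s ∧ s < T ∧ T < s + τ :=
    ⟨max 0 (T - τ / 2), le_max_left _ _, max_lt hT (by linarith),
      by linarith [le_max_right 0 (T - τ / 2)]⟩
  have hsI : s ∈ Set.Ico 0 T := ⟨hs0, hsT⟩
  obtain ⟨v, hv, -⟩ := hloc (u s) ⟨_, h.isH2With hsI⟩
    (fun y => abs_le.2 ⟨by linarith [(hran s hsI y).1], (hran s hsI y).2⟩) (hL' s hsI)
  have heq : ∀ r ∈ Set.Ico 0 (T - s), u (s + r) = v r :=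
    (h.shift hsI).eq ha hb (hv.mono (by linarith)) (hran s hsI)
  refine ⟨s + τ, hTs, fun t => if t < T then u t else v (t - s),
    IsH2Solution.of_locally (γa := γa) (γb := γb) (by rw [if_pos hT, h.initial]) fun t ht => ?_⟩
  rcases lt_or_ge t T with htT | htT
  · exact ⟨0, T, u₀, u, h, ht.1, by simpa, Or.inl rfl, fun r hr _ => by
      rw [zero_add] at hr
      rw [if_pos hr.2, sub_zero]⟩
  · refine ⟨s, τ, u s, v, hv, by linarith, ht.2, Or.inr (by linarith), fun r hr _ => ?_⟩
    split_ifs with hrT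
    · rw [← heq (r - s) ⟨by linarith [hr.1], by linarith⟩, add_sub_cancel]
    · rfl

theorem MemH2.exists_solution (ha : 0 < γa) (hb : 0 < γb) (hu₀ : MemH2 u₀)
    (h0 : ∀ x, 0 ≤ u₀ x ∧ u₀ x ≤ 1) : ∃ T > 0, ∃ u, IsH2Solution γa γb u₀ T u := by
  obtain ⟨f₂, hf₂⟩ := hu₀
  obtain ⟨τ, hτ, hloc⟩ := exists_local_solution ha hb _ ((abs_nonneg _).trans (hf₂.abs_deriv_le 0))
  obtain ⟨u, hu, -⟩ := hloc u₀ ⟨_, hf₂⟩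
    (fun y => abs_le.2 ⟨by linarith [(h0 y).1], (h0 y).2⟩) hf₂.abs_deriv_le
  exact ⟨τ, hτ, u, hu⟩

/-- If the existence times are bounded then there is a maximal solution. -/
theorem exists_maximal (ha : 0 < γa) (hb : 0 < γb) (hu₀ : MemH2 u₀)
    (h0 : ∀ x, 0 ≤ u₀ x ∧ u₀ x ≤ 1)
    (hbdd : BddAbove {T | 0 < T ∧ ∃ u, IsH2Solution γa γb u₀ T u}) :
    ∃ T > 0, ∃ u, IsMaximalH2Solution γa γb u₀ T u := by
  set S := {T | 0 < T ∧ ∃ u, IsH2Solution γa γb u₀ T u} with hS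
  obtain ⟨T₀, hT₀, u', hu'⟩ := hu₀.exists_solution ha hb h0
  have hne : S.Nonempty := ⟨T₀, hT₀, u', hu'⟩
  have hpos : 0 < sSup S := hT₀.trans_le (le_csSup hbdd ⟨hT₀, u', hu'⟩)
  -- By uniqueness all solutions defined at time `t` have the same value there, so the choices of
  -- these values for different `t` are automatically consistent.
  have hex : ∀ t, ∃ f : ℝ → ℝ, ∀ T v, IsH2Solution γa γb u₀ T v → t ∈ Set.Ico 0 T → v t = f := by
    intro t
    by_cases h : ∃ T v, IsH2Solution γa γb u₀ T v ∧ t ∈ Set.Ico 0 T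
    · obtain ⟨T, v, hv, ht⟩ := h
      exact ⟨v t, fun T' v' hv' ht' => (hv'.mono (min_le_right T T')).eq ha hb
        (hv.mono (min_le_left T T')) h0 t ⟨ht.1, lt_min ht.2 ht'.2⟩⟩
    · exact ⟨u₀, fun T v hv ht => absurd ⟨T, v, hv, ht⟩ h⟩
  choose u hu using hex
  refine ⟨sSup S, hpos, u, ⟨IsH2Solution.of_locally (γa := γa) (γb := γb) ?_ fun t ht => ?_,
    fun T' v hv => ⟨?_, fun t ht => hu t T' v hv ht⟩⟩⟩
  · rw [← hu 0 T₀ u' hu' ⟨le_rfl, hT₀⟩, hu'.initial]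
  · obtain ⟨T, ⟨-, v, hv⟩, htT⟩ := exists_lt_of_lt_csSup hne ht.2
    exact ⟨0, T, u₀, v, hv, ht.1, by simpa, Or.inl rfl, fun r hr _ => by
      rw [zero_add] at hr
      rw [← hu r T v hv hr, sub_zero]⟩
  -- Nonpositive `T'` is excluded from `S` but must be covered by maximality.
  · rcases le_or_gt T' 0 with h | h
    · exact h.trans hpos.le
    · exact le_csSup hbdd ⟨h, v, hv⟩

/-- Blow-up of `u_x` when it exceeds initially a root `R` of the quadratic lower bound. -/
theorem exists_blowup (ha : 0 < γa) (hb : 0 < γb) (hu₀ : MemH2 u₀)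
    (h0 : ∀ x, 0 ≤ u₀ x ∧ u₀ x ≤ 1) {ℓ R : ℝ} (hℓ : ℓ ≤ -(1 / γa + 1 / γb))
    (hℓ0 : ∀ x, ℓ ≤ deriv u₀ x) (hR : 1 / γa + 1 / γb ≤ 2 * R)
    (hRq : 2 * R ^ 2 - 2 * (1 / γa + 1 / γb) * R - (1 / γa + 1 / γb) ^ 2 / 4
      + (1 / γa + 1 / γb) * ℓ / 4 = 0) (hsup : R < ⨆ x, deriv u₀ x) :
    ∃ T : ℝ, 0 < T ∧ ∃ u : ℝ → ℝ → ℝ, IsMaximalH2Solution γa γb u₀ T u ∧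
      Tendsto (fun t => ⨆ x, deriv (u t) x) (𝓝[<] T) atTop := by
  have hslope : ∀ {T : ℝ} {u : ℝ → ℝ → ℝ}, IsH2Solution γa γb u₀ T u → ∀ {a b : ℝ}, 0 ≤ a → b < T →
      ∀ t ∈ Set.Ico a b, ∀ r < 2 / 3 * excess R u t ^ 2,
        ∃ᶠ z in 𝓝[>] t, r < slope (excess R u) t z := fun h _ _ ha0 hbT t ht r hr =>
    h.frequently_lt_slope_excess ha hb h0 hℓ hℓ0 hR hRq ⟨ha0.trans ht.1, ht.2.trans hbT⟩ hr
  have hcont : ∀ {T : ℝ} {u : ℝ → ℝ → ℝ}, IsH2Solution γa γb u₀ T u → ∀ {a b : ℝ}, 0 ≤ a → b < T →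
      ContinuousOn (excess R u) (Set.Icc a b) := fun h _ _ ha0 hbT =>
    (h.continuousOn_excess R).mono fun t ht => ⟨ha0.trans ht.1, ht.2.trans_lt hbT⟩
  set y := (⨆ x, deriv u₀ x) - R with hy
  have hy0 : 0 < y := by linarith
  have hbdd : BddAbove {T | 0 < T ∧ ∃ u, IsH2Solution γa γb u₀ T u} := by
    refine ⟨2 / y, fun T ⟨hT, u, hu⟩ => ?_⟩
    by_contra! hlt
    have hyu : excess R u 0 = y := by rw [excess, hu.initial, max_eq_left hy0.le]
    have := lt_of_riccati (hcont hu le_rfl hlt) (by positivity) (hslope hu le_rfl hlt)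
      (by rw [hyu]; exact hy0)
    rw [hyu, sub_zero] at this
    exact lt_irrefl _ this
  obtain ⟨T, hT, u, hmax⟩ := exists_maximal ha hb hu₀ h0 hbdd
  have hu := hmax.isH2Solution
  have hC := hu.isC0Path_deriv
  refine ⟨T, hT, u, hmax, ?_⟩
  -- An upper bound on `sup u_x`, together with the preserved lower bound `ℓ`, bounds `|u_x|` and
  -- permits an extension beyond the maximal time.
  have hunb : ∀ m, ∃ t ∈ Set.Ico 0 T, m < ⨆ x, deriv (u t) x := by
    intro m
    by_contra! hm
    have hle := hu.le_deriv ha hb h0 hℓ hℓ0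
    obtain ⟨T', hT', v, hv⟩ := hu.exists_extension ha hb hT h0 (L := max |m| |ℓ|)
      (le_max_of_le_left (abs_nonneg _)) fun t ht x => abs_le.2
        ⟨(neg_le_neg (le_max_right _ _)).trans ((neg_abs_le ℓ).trans (hle t ht x)),
          ((hC.le_iSup ht x).trans (hm t ht)).trans ((le_abs_self m).trans (le_max_left _ _))⟩
    exact absurd (hmax.maximal T' v hv).1 (not_le.2 hT')
  rw [tendsto_atTop]
  intro m
  -- Beyond one time at which the supremum exceeds both `m` and `R`, the excess cannot decrease, so
  -- it stays above `m - R`.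
  obtain ⟨t, ht, hmt⟩ := hunb (max m R)
  filter_upwards [Ioo_mem_nhdsLT ht.2] with z hz
  have h1 := mono_of_riccati (hcont hu ht.1 hz.2) hz.1.le (fun _ _ => le_max_right _ _)
    (hslope hu ht.1 hz.2)
  have h2 : R < ⨆ x, deriv (u t) x := (le_max_right _ _).trans_lt hmt
  have h3 : m < ⨆ x, deriv (u t) x := (le_max_left _ _).trans_lt hmt
  have h4 : excess R u t = (⨆ x, deriv (u t) x) - R := max_eq_left (by linarith)
  rcases max_choice ((⨆ x, deriv (u z) x) - R) 0 with h5 | h5 <;>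
  · rw [excess, excess, h5, max_eq_left (by linarith)] at h1
    linarith

end

end Traffic
end

/-- With `ℓ = K * m` and `R = K * r` the root equation becomes `2 r² - 2 r - 1/4 + m/4 = 0`, whose
larger solution is `1/2 + √2/4 * √(3 - m)`. The minimum with `-1` ensures `ℓ ≤ -K`, the range in
which lower bounds on `u_x` are preserved. -/
theorem theorem1p1 (γa γb : ℝ) (hγb : 0 < γb) (hγab : γb ≤ γa)
    (u₀ : ℝ → ℝ) (hu₀ : Traffic.MemH2 u₀) (hrange : ∀ x, 0 ≤ u₀ x ∧ u₀ x ≤ 1)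
    (hthreshold :
      (γa + γb) / (γa * γb) *
          (1 / 2 + √2 / 4 * √(3 - min (-1) (γa * γb / (γa + γb) * ⨅ x : ℝ, deriv u₀ x)))
        < ⨆ x : ℝ, deriv u₀ x) :
    ∃ T : ℝ, 0 < T ∧ ∃ u : ℝ → ℝ → ℝ,
      Traffic.IsMaximalH2Solution γa γb u₀ T u ∧
      Tendsto (fun t => ⨆ x : ℝ, deriv (u t) x) (𝓝[<] T) atTop := by
  have hγa : 0 < γa := hγb.trans_le hγab
  set K := (γa + γb) / (γa * γb) with hK
  have hK0 : 0 < K := by positivity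
  have hKeq : 1 / γa + 1 / γb = K := by rw [hK]; field_simp; ring
  have hKinv : γa * γb / (γa + γb) = K⁻¹ := by rw [hK, inv_div]
  rw [hKinv] at hthreshold
  set m := min (-1) (K⁻¹ * ⨅ x : ℝ, deriv u₀ x) with hm
  have hm1 : m ≤ -1 := min_le_left _ _
  have hm2 : K * m ≤ ⨅ x : ℝ, deriv u₀ x := by
    calc K * m ≤ K * (K⁻¹ * ⨅ x : ℝ, deriv u₀ x) := by gcongr; exact min_le_right _ _
      _ = _ := mul_inv_cancel_left₀ hK0.ne' _
  have hbdd : BddBelow (Set.range (deriv u₀)) := by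
    obtain ⟨f₂, hf₂⟩ := hu₀
    exact ⟨_, Set.forall_mem_range.2 fun x => (abs_le.1 (hf₂.abs_deriv_le x)).1⟩
  set q := √2 / 4 * √(3 - m) with hq
  have hq0 : 0 ≤ q := by positivity
  have hq2 : q ^ 2 = (3 - m) / 8 := by
    rw [hq, mul_pow, div_pow, Real.sq_sqrt (by norm_num), Real.sq_sqrt (by linarith)]
    ring
  refine Traffic.exists_blowup hγa hγb hu₀ hrange (ℓ := K * m) (R := K * (1 / 2 + q)) ?_
    (fun x => hm2.trans (ciInf_le hbdd x)) ?_ ?_ hthreshold <;> rw [hKeq]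
  · nlinarith
  · nlinarith [mul_nonneg hK0.le hq0]
  · linear_combination 2 * K ^ 2 * hq2
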